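/- **Setting.** Let $0<\lambda_1<\lambda_2<\cdots\to\infty$ and $0<\mu_1<\mu_2<\cdots\to\infty$, let $(a_n)$, $(b_n)$ be complex sequences, and suppose that $\phi(s)=\sum_{n\ge1}a_n\lambda_n^{-s}$ and $\psi(s)=\sum_{n\ge1}b_n\mu_n^{-s}$ have finite abscissae of absolute convergence $\sigma_a$ and $\sigma_b$. Let $\delta>0$, $Q>0$, $|\omega|=1$, $r\ge1$, $\alpha_i>0$, $\Re\beta_i\ge0$ $(1\le i\le r)$, and put $d_F'=\sum_{i=1}^r\alpha_i$, $F(s)=\phi(s)\prod_{i=1}^r\Gamma(\alpha_is+\beta_i)$, $G(s)=\psi(s)\prod_{i=1}^r\Gamma(\alpha_is+\beta_i)$. Suppose that the functional equation $$Q^sF(s)=\omega Q^{\delta-s}\,\overline{G(\delta-\bar s)}$$ holds in the following sense: there are a compact set $S\subset\mathbb C$ with connected complement $D$ and an analytic function $\chi$ on $D$ with $\chi(s)=Q^sF(s)$ for $s \in D$, $\Re s>\sigma_a$, and $\chi(s)=\omega Q^{\delta-s}\overline{G(\delta-\bar s)}$ for $s\in D$, $\Re s<\delta-\sigma_b$;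 and for some constant $\theta<1$, in every strip $\sigma_1\le\Re s\le\sigma_2$, $\chi(s)=O\big(\exp\exp(\theta\pi|s|/(\sigma_2-\sigma_1))\big)$ uniformly as $|\Im s|\to\infty$. Thus $\phi$ continues analytically to $D$ through $\phi(s)=Q^{-s}\chi(s)/\prod_i\Gamma(\alpha_is+\beta_i)$. Let $a>\max\{0,\sigma_a,\sigma_b\}$ be so large that $S$ (which contains all the singularities of $F$) lies in the strip $\delta-a<\Re s<a$, and let $C$ be a circle in this strip that has in its interior $S$ and all the singularities of $\phi(s)\Gamma(s)$ lying in the strip. Let $\rho>(2\sigma_b-\delta)d_F'-\tfrac12$ be real, put $$K_\rho(s)=\frac{\Gamma(\delta-s)\prod_{i=1}^r\Gamma(\alpha_is+\bar\beta_i)}{\Gamma(1+\delta-s+\rho)\prod_{i=1}^r\Gamma(\alpha_i(\delta-s)+\beta_i)},$$ and assume that $K_\rho$ has no pole at $s=a$ (automatic if $a-\delta\notin\{0,1,2,\dots\}$). For $y>0$ let $J_\rho(y)=\frac1{2\pi i}\int_{(a)}K_\rho(s)\,y^{-s}\,ds$ be the Mellin–Barnes integral along the line $\Re s=a$ with its ends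 bent to the left for convergence, i.e. the integral along the polygonal path $$c-i\infty\to c-iT\to a-iT\to a+iT\to c+iT\to c+i\infty,$$ where $c\le a$, $(2c-\delta)d_F'<\rho$, $T>0$ and $T>|\Im\beta_i|/\alpha_i$ for all $i$. **Theorem.** The integral $J_\rho(y)$ converges absolutely and does not depend on the choice of such $c$ and $T$. If $\rho\ge(2a-\delta)d_F'-1$, then the integral along the straight line converges to the same value: $$J_\rho(y)=\lim_{T\to\infty}\frac1{2\pi i}\int_{a-iT}^{a+iT}K_\rho(s)\,y^{-s}\,ds .$$ For every $x>0$ the series below converges absolutely, and $$\frac1{\Gamma(\rho+1)}\sideset{}{'}\sum_{\lambda_n\le x}a_n(x-\lambda_n)^\rho=Q_\rho(x)+\frac{\omega x^{\delta+\rho}}{Q^\delta}\sum_{n=1}^\infty\bar b_n\,J_\rho\!\left(\frac{\mu_nx}{Q^2}\right),$$ where the dash means that a term with $\lambda_n=x$ is halved if $\rho=0$, and $$Q_\rho(x)=\frac1{2\pi i}\int_C\frac{\phi(s)\Gamma(s)x^{s+\rho}}{\Gamma(s+\rho+1)}\,ds .$$ Moreover $Q_\rho$ is a residual function: it is differentiable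 on $(0,\infty)$; it is $O(x^{-k})$ as $x\to0$ and $O(x^{k})$ as $x\to\infty$ for some $k>0$; and $\int_0^1Q_\rho(x)x^{s-1}dx$ ($\Re s$ large) and $-\int_1^\infty Q_\rho(x)x^{s-1}dx$ ($-\Re s$ large) are restrictions of one function, analytic in the connected complement of a compact set, which tends to $0$ as $|\Im s|\to\infty$ uniformly in vertical strips. -/

import Mathlib

open Filter Topology

namespace RieszSum

/-- The frequencies of a general Dirichlet series: positive, strictly increasing, unbounded. -/
def IsFrequencySequence (lam : ℕ → ℝ) : Prop :=
  (∀ n, 0 < lam n) ∧ StrictMono lam ∧ Tendsto lam atTop atTop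

/-- The general Dirichlet series `∑ aₙ λₙ^{-s}` (the index set is `ℕ`, starting at `0`). -/
noncomputable def dirichletSeries (a : ℕ → ℂ) (lam : ℕ → ℝ) (s : ℂ) : ℂ :=
  ∑' n, a n * (lam n : ℂ) ^ (-s)

/-- The series `∑ aₙ λₙ^{-s}` has the finite abscissa of absolute convergence `σ`. -/
def HasAbscissa (a : ℕ → ℂ) (lam : ℕ → ℝ) (σ : ℝ) : Prop :=
  IsGLB {x : ℝ | Summable fun n => ‖a n‖ * lam n ^ (-x)} σ

/-- The Gamma factor `∏ᵢ Γ(αᵢ s + βᵢ)`. -/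
noncomputable def gammaFactor {r : ℕ} (α : Fin r → ℝ) (β : Fin r → ℂ) (s : ℂ) : ℂ :=
  ∏ i, Complex.Gamma ((α i : ℂ) * s + β i)

/-- `s` is not a pole of any of the factors `Γ(αᵢ s + βᵢ)`. -/
def IsRegularPoint {r : ℕ} (α : Fin r → ℝ) (β : Fin r → ℂ) (s : ℂ) : Prop :=
  ∀ i, ∀ k : ℕ, (α i : ℂ) * s + β i ≠ -(k : ℂ)

/-- The Dirichlet series `φ = ∑ aₙ λₙ^{-s}` and `ψ = ∑ bₙ μₙ^{-s}` belong to the class `𝒞`: with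
`F = φ · ∏ᵢ Γ(αᵢ s + βᵢ)` and `G = ψ · ∏ᵢ Γ(αᵢ s + βᵢ)` they satisfy the functional equation
`Q^s F(s) = ω Q^{δ-s} conj (G (δ - conj s))`, in the sense that a function `χ`, analytic in the
domain which is the complement of the compact set `S`, equals the left side for `Re s > σa` and
the right side for `Re s < δ - σb` and satisfies the growth condition in vertical strips. The two
equalities are required where the Gamma factor on the right has no pole (at a pole of it that lies
outside `S`, they persist for the analytic continuations). -/
structure InClassC {r : ℕ} (a b : ℕ → ℂ) (lam mu : ℕ → ℝ) (σa σb δ Q : ℝ) (ω : ℂ)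
    (α : Fin r → ℝ) (β : Fin r → ℂ) (S : Set ℂ) (χ : ℂ → ℂ) : Prop where
  lam_seq : IsFrequencySequence lam
  mu_seq : IsFrequencySequence mu
  abscissa_a : HasAbscissa a lam σa
  abscissa_b : HasAbscissa b mu σb
  r_pos : 0 < r
  δ_pos : 0 < δ
  Q_pos : 0 < Q
  norm_ω : ‖ω‖ = 1
  α_pos : ∀ i, 0 < α i
  β_re : ∀ i, 0 ≤ (β i).re
  compact : IsCompact S
  domain : IsConnected Sᶜ
  analytic : DifferentiableOn ℂ χ Sᶜ
  eq_right : ∀ s ∉ S, σa < s.re → IsRegularPoint α β s →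
    χ s = (Q : ℂ) ^ s * (dirichletSeries a lam s * gammaFactor α β s)
  eq_left : ∀ s ∉ S, s.re < δ - σb → IsRegularPoint α β (δ - starRingEnd ℂ s) →
    χ s = ω * (Q : ℂ) ^ ((δ : ℂ) - s) *
      starRingEnd ℂ (dirichletSeries b mu (δ - starRingEnd ℂ s) *
        gammaFactor α β (δ - starRingEnd ℂ s))
  growth : ∃ θ : ℝ, θ < 1 ∧ ∀ σ₁ σ₂ : ℝ, σ₁ < σ₂ → ∃ M t₀ : ℝ, ∀ s : ℂ,
    σ₁ ≤ s.re → s.re ≤ σ₂ → t₀ ≤ |s.im| →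
      ‖χ s‖ ≤ M * Real.exp (Real.exp (θ * Real.pi * ‖s‖ / (σ₂ - σ₁)))

/-- The analytic continuation of `φ` to the domain of `χ`: `Q^{-s} χ(s) / ∏ᵢ Γ(αᵢ s + βᵢ)`. The
reciprocal Gamma function is entire, with value `0` at the poles of `Γ`, which is also the value
of `(Complex.Gamma s)⁻¹` there. -/
noncomputable def phiCont {r : ℕ} (Q : ℝ) (α : Fin r → ℝ) (β : Fin r → ℂ) (χ : ℂ → ℂ)
    (s : ℂ) : ℂ :=
  (Q : ℂ) ^ (-s) * χ s * (gammaFactor α β s)⁻¹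

/-- `s` is a (non-removable) singularity of `f`. -/
def IsSingularity (f : ℂ → ℂ) (s : ℂ) : Prop :=
  ¬ ∃ g : ℂ → ℂ, AnalyticAt ℂ g s ∧ f =ᶠ[𝓝[≠] s] g

/-- The open vertical strip `δ - p < Re s < p`. -/
def strip (δ p : ℝ) : Set ℂ := {s | δ - p < s.re ∧ s.re < p}

/-- The circle with centre `z₀` and radius `R` lies in the strip `δ - p < Re s < p`; inside it are
the set `S` and all singularities of `φ(s) Γ(s)` in that strip (the entire factor `x^{s+ρ}`, which
has no zero, does not change the singularities). -/
structure IsAdmissibleCircle {r : ℕ} (δ Q : ℝ) (α : Fin r → ℝ) (β : Fin r → ℂ) (S : Set ℂ)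
    (χ : ℂ → ℂ) (p : ℝ) (z₀ : ℂ) (R : ℝ) : Prop where
  radius_pos : 0 < R
  subset_strip : Metric.sphere z₀ R ⊆ strip δ p
  encloses_S : S ⊆ Metric.ball z₀ R
  encloses_sing : ∀ s ∈ strip δ p,
    IsSingularity (fun z => phiCont Q α β χ z * Complex.Gamma z) s → s ∈ Metric.ball z₀ R

/-- The Riesz sum `(1/Γ(ρ+1)) ∑'_{λₙ ≤ x} aₙ (x - λₙ)^ρ`; the term with `λₙ = x` is halved when
`ρ = 0`. -/
noncomputable def rieszSum (a : ℕ → ℂ) (lam : ℕ → ℝ) (ρ x : ℝ) : ℂ :=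
  (Complex.Gamma ((ρ : ℂ) + 1))⁻¹ *
    ∑' n, if lam n ≤ x then
      (if ρ = 0 ∧ lam n = x then (1 / 2 : ℂ) else 1) * a n * (((x - lam n) ^ ρ : ℝ) : ℂ) else 0

/-- The function `Q_ρ(x) = (1/2πi) ∮ φ(s) Γ(s) x^{s+ρ} / Γ(s+ρ+1) ds` over the circle with centre
`z₀` and radius `R`. -/
noncomputable def residualTerm {r : ℕ} (Q : ℝ) (α : Fin r → ℝ) (β : Fin r → ℂ) (χ : ℂ → ℂ)
    (z₀ : ℂ) (R ρ x : ℝ) : ℂ :=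
  (2 * (Real.pi : ℂ) * Complex.I)⁻¹ *
    ∮ s in C(z₀, R), phiCont Q α β χ s * Complex.Gamma s * (x : ℂ) ^ (s + (ρ : ℂ)) /
      Complex.Gamma (s + ρ + 1)

/-- Residual functions in the sense of Bochner: `P` is differentiable on `(0,∞)`, of at most
polynomial growth at `0` and at `∞`, and `∫_0^1 P(x) x^{s-1} dx` and `-∫_1^∞ P(x) x^{s-1} dx` are
analytic continuations of each other in the exterior of a compact set, the continued function
tending to `0` as `|Im s| → ∞`, uniformly in vertical strips. -/
def IsResidualFunction (P : ℝ → ℂ) : Prop :=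
  DifferentiableOn ℝ P (Set.Ioi 0) ∧
  (∃ c : ℝ, 0 < c ∧ P =O[𝓝[>] 0] (fun x => x ^ (-c)) ∧ P =O[atTop] (fun x => x ^ c)) ∧
  ∃ (K : Set ℂ) (I : ℂ → ℂ), IsCompact K ∧ IsConnected Kᶜ ∧ DifferentiableOn ℂ I Kᶜ ∧
    (∃ A : ℝ, ∀ s ∉ K, A < s.re →
      MeasureTheory.IntegrableOn (fun x : ℝ => P x * (x : ℂ) ^ (s - 1)) (Set.Ioc 0 1) ∧
      I s = ∫ x in Set.Ioc (0 : ℝ) 1, P x * (x : ℂ) ^ (s - 1)) ∧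
    (∃ B : ℝ, ∀ s ∉ K, s.re < B →
      MeasureTheory.IntegrableOn (fun x : ℝ => P x * (x : ℂ) ^ (s - 1)) (Set.Ioi 1) ∧
      I s = -∫ x in Set.Ioi (1 : ℝ), P x * (x : ℂ) ^ (s - 1)) ∧
    ∀ σ₁ σ₂ : ℝ, ∀ ε > 0, ∃ t₀ : ℝ, ∀ s : ℂ,
      σ₁ ≤ s.re → s.re ≤ σ₂ → t₀ ≤ |s.im| → ‖I s‖ < ε

/-- The quotient of Gamma functions
`Γ(δ-s) ∏ᵢ Γ(αᵢ s + conj βᵢ) / (Γ(1+δ-s+ρ) ∏ᵢ Γ(αᵢ(δ-s) + βᵢ))`. -/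
noncomputable def gammaQuotient {r : ℕ} (δ : ℝ) (α : Fin r → ℝ) (β : Fin r → ℂ) (ρ : ℝ)
    (s : ℂ) : ℂ :=
  Complex.Gamma (δ - s) * gammaFactor α (fun i => starRingEnd ℂ (β i)) s /
    (Complex.Gamma (1 + δ - s + ρ) * gammaFactor α β (δ - s))

/-- The Mellin--Barnes integrand: the Gamma quotient times `y^{-s}`. -/
noncomputable def integrand {r : ℕ} (δ : ℝ) (α : Fin r → ℝ) (β : Fin r → ℂ) (ρ y : ℝ)
    (s : ℂ) : ℂ :=
  gammaQuotient δ α β ρ s * (y : ℂ) ^ (-s)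

/-- `(1/2πi) ∫_{p-iT}^{p+iT} f(s) ds` along the vertical segment. -/
noncomputable def segmentIntegral (f : ℂ → ℂ) (p T : ℝ) : ℂ :=
  (2 * (Real.pi : ℂ) * Complex.I)⁻¹ * (Complex.I * ∫ t in (-T)..T, f (p + t * Complex.I))

/-- `(1/2πi) ∫_{p-i∞}^{p+i∞} f(s) ds = J`, as an improper integral. -/
def HasLineIntegral (f : ℂ → ℂ) (p : ℝ) (J : ℂ) : Prop :=
  Tendsto (fun T : ℝ => segmentIntegral f p T) atTop (𝓝 J)

/-- `f` is integrable on each piece of the bent contour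
`c - i∞ → c - iT → p - iT → p + iT → c + iT → c + i∞`. -/
def BentIntegrable (f : ℂ → ℂ) (p c T : ℝ) : Prop :=
  MeasureTheory.IntegrableOn (fun t : ℝ => f (c + t * Complex.I)) (Set.Iic (-T)) ∧
  IntervalIntegrable (fun u : ℝ => f (u - T * Complex.I)) MeasureTheory.volume c p ∧
  IntervalIntegrable (fun t : ℝ => f (p + t * Complex.I)) MeasureTheory.volume (-T) T ∧
  IntervalIntegrable (fun u : ℝ => f (u + T * Complex.I)) MeasureTheory.volume c p ∧
  MeasureTheory.IntegrableOn (fun t : ℝ => f (c + t * Complex.I)) (Set.Ioi T)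

/-- `(1/2πi) ∫ f(s) ds` along the bent contour
`c - i∞ → c - iT → p - iT → p + iT → c + iT → c + i∞`. -/
noncomputable def bentIntegral (f : ℂ → ℂ) (p c T : ℝ) : ℂ :=
  (2 * (Real.pi : ℂ) * Complex.I)⁻¹ *
    (Complex.I * (∫ t in Set.Iic (-T), f (c + t * Complex.I)) +
      (∫ u in c..p, f (u - T * Complex.I)) +
      Complex.I * (∫ t in (-T)..T, f (p + t * Complex.I)) -
      (∫ u in c..p, f (u + T * Complex.I)) +
      Complex.I * ∫ t in Set.Ioi T, f (c + t * Complex.I))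

/-- `J` is the value of the Mellin--Barnes integral with Gamma quotient `gammaQuotient δ α β ρ`
taken along the line `Re s = p`, the ends of the line being bent to the left as far as
convergence requires: for every `c ≤ p` with `(2c - δ) ∑ αᵢ < ρ` and every `T` exceeding the
heights of the poles of the Gamma quotient, the integral along the bent contour converges
absolutely and equals `J`. -/
def HasBarnesIntegral {r : ℕ} (δ : ℝ) (α : Fin r → ℝ) (β : Fin r → ℂ) (ρ p y : ℝ)
    (J : ℂ) : Prop :=
  ∀ c T : ℝ, c ≤ p → (2 * c - δ) * ∑ i, α i < ρ → 0 < T → (∀ i, |(β i).im| / α i < T) →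
    BentIntegrable (integrand δ α β ρ y) p c T ∧ bentIntegral (integrand δ α β ρ y) p c T = J

end RieszSum

/-! For large order the identity is Perron's formula. The Riesz mean is the integral of
φ(s)Γ(s)x^{s+ρ}/Γ(s+ρ+1) over a line Re s = q with q slightly below the given abscissa. Moving the
line to Re s = δ - q produces the circle integral Q_ρ(x). On the new line the functional equation
turns φ into the conjugate of ψ times a quotient of Gamma factors, and integrating the series for ψ
term by term gives the integrals J_ρ(μ_n x/Q²). The shift requires polynomial growth of φ in the
strip. This follows from Phragmén–Lindelöf, because φ is controlled on both edges and the growth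
condition on χ survives division by the Gamma factor (`InClassC.exists_norm_phiCont_le`,
`InClassC.exists_rieszSum_eq_of_large`).

Smaller orders are reached by descent: differentiation in x lowers ρ by one in the Riesz mean, in
Q_ρ and in each x^{δ+ρ} J_ρ(μ_n x/Q²), all because of Γ(z+1) = zΓ(z). What has to be justified is
termwise differentiation of the dual series, that is, J_ρ(y) = O(y^{-σ}) on half-lines y ≥ y₀ > 0
for some σ > σ_b (`exists_norm_bentIntegral_le`, `hasDerivAt_tsum_mul_bentIntegral`).

The range ρ > (2σ_b - δ)d - 1/2, with d = ∑ α_i, comes from that estimate. By Stirling, K_ρ(σ+it)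
has modulus of order t^{(2σ-δ)d-1-ρ} and phase 2d t log t + lt. Absolute values would require
(2σ-δ)d < ρ. The oscillation of t log t makes the integral of the pure phase over [T,X] of size
O(√X), which gains a further 1/2. The factor y^{-it} only changes l, and the bounds do not depend on
l, so they are uniform in y apart from the factor y^{-σ} (`exists_norm_integral_integrand_le`). This
needs Stirling's formula with a relative error O(1/t), which `Gamma_stirling` obtains from
Gudermann's series.

Orders ρ ≤ 0 cannot satisfy the hypotheses: the dual side would make the piecewise linear Riesz mean
of order 1 differentiable, so that all a_n = 0, and then there is no finite abscissa
(`InClassC.order_pos`). Hence the halved term for ρ = 0 never intervenes.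

Instead of residues, the contour shift uses the splitting of a function analytic outside a disc into
a part analytic in the whole strip and a Cauchy transform. The same Cauchy transform is the common
Mellin continuation which makes Q_ρ a residual function. -/

namespace RieszSum

/-! ### Stirling's formula for the complex Gamma function -/

/-- The general term of Gudermann's series for the remainder in Stirling's formula. -/
noncomputable def gudermann (z : ℂ) : ℂ :=
  (z + 1 / 2) * (Complex.log (z + 1) - Complex.log z) - 1

/-- Summation by parts. The logarithms that do not telescope have coefficient one, so their
exponential is the product ∏ (z + n) from Euler's formula for Γ and no branch has to be followed. -/
theorem sum_gudermann (z : ℂ) (N : ℕ) :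
    ∑ n ∈ Finset.range N, gudermann (z + n) =
      (z + N - 1 / 2) * Complex.log (z + N) - (z - 1 / 2) * Complex.log z -
        ∑ n ∈ Finset.range N, Complex.log (z + n) - N := by
  induction N with
  | zero => simp
  | succ N ih =>
    rw [Finset.sum_range_succ, ih, Finset.sum_range_succ, gudermann]
    push_cast
    rw [← add_assoc z (N : ℂ) 1]
    ring

/-- With u = 1/z, the factor z + 1/2 is chosen so that the terms of order u in the expansion of the
logarithm cancel, leaving -u²/4 and a Taylor remainder. In the upper half-plane arg z and arg(1 + u)
have opposite signs, so the principal logarithms add. -/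
theorem norm_gudermann_le {z : ℂ} (hz : 0 < z.im) (hz2 : 2 ≤ ‖z‖) :
    ‖gudermann z‖ ≤ 2 / ‖z‖ ^ 2 := by
  have hz0 : z ≠ 0 := by rintro rfl; simp at hz
  set u : ℂ := z⁻¹ with hu
  have hun : ‖u‖ ≤ 1 / 2 := by
    rw [hu, norm_inv, one_div]
    exact inv_anti₀ (by norm_num) hz2
  have hu0 : u ≠ 0 := inv_ne_zero hz0
  have hure : 0 < (1 + u).re := by
    have := (Complex.abs_re_le_norm u).trans hun
    have := (abs_le.mp this).1
    simp only [Complex.add_re, Complex.one_re]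
    linarith
  have h1u : 1 + u ≠ 0 := by
    intro h; rw [h] at hure; simp at hure
  have hlog : Complex.log (z + 1) = Complex.log z + Complex.log (1 + u) := by
    have : z + 1 = z * (1 + u) := by rw [hu]; field_simp
    rw [this]
    apply (Complex.log_mul_eq_add_log_iff hz0 h1u).2
    have h1 : 0 ≤ z.arg := Complex.arg_nonneg_iff.2 hz.le
    have h2 : z.arg ≤ Real.pi := Complex.arg_le_pi z
    have h3 : (1 + u).arg < 0 := by
      rw [Complex.arg_neg_iff]
      simp only [Complex.add_im, Complex.one_im, zero_add, hu, Complex.inv_im]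
      exact div_neg_of_neg_of_pos (by linarith) (Complex.normSq_pos.2 hz0)
    have h4 : |(1 + u).arg| < Real.pi / 2 := Complex.abs_arg_lt_pi_div_two_iff.2 (Or.inl hure)
    have := abs_lt.mp h4
    constructor <;> linarith [Real.pi_pos]
  have hT : Complex.logTaylor 3 u = u - u ^ 2 / 2 := by
    simp [Complex.logTaylor_succ, Complex.logTaylor_zero]
    ring
  have hr := Complex.norm_log_sub_logTaylor_le 2 (z := u) (by linarith)
  rw [show (2 + 1 : ℕ) = 3 from rfl, hT] at hr
  set r := Complex.log (1 + u) - (u - u ^ 2 / 2) with hrdef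
  have hr' : ‖r‖ ≤ ‖u‖ ^ 3 := by
    refine hr.trans ?_
    have : (1 - ‖u‖)⁻¹ ≤ 2 := by
      rw [inv_le_comm₀ (by linarith) (by norm_num)]; linarith
    have h3 : 0 ≤ ‖u‖ ^ 3 := by positivity
    push_cast
    rw [div_le_iff₀ (by norm_num)]
    nlinarith
  have hg : gudermann z = -u ^ 2 / 4 + r * (u⁻¹ + 1 / 2) := by
    rw [gudermann, hlog, hrdef, show z = u⁻¹ by rw [hu, inv_inv]]
    field_simp
    ring
  have hinv : ‖r * (u⁻¹ + 1 / 2)‖ ≤ ‖u‖ ^ 2 + ‖u‖ ^ 3 / 2 := by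
    rw [norm_mul]
    have : ‖u⁻¹ + 1 / 2‖ ≤ ‖u‖⁻¹ + 1 / 2 := by
      refine (norm_add_le _ _).trans ?_
      rw [norm_inv]; norm_num
    calc ‖r‖ * ‖u⁻¹ + 1 / 2‖ ≤ ‖u‖ ^ 3 * (‖u‖⁻¹ + 1 / 2) := by gcongr
      _ = _ := by have : ‖u‖ ≠ 0 := norm_ne_zero_iff.2 hu0
                  field_simp
  have : 2 / ‖z‖ ^ 2 = 2 * ‖u‖ ^ 2 := by rw [hu, norm_inv]; field_simp
  rw [this, hg]
  refine (norm_add_le _ _).trans ?_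
  have h4 : ‖-u ^ 2 / 4‖ = ‖u‖ ^ 2 / 4 := by simp
  rw [h4]
  have : 0 ≤ ‖u‖ ^ 2 := by positivity
  nlinarith

/-- Euler's limit formula identifies the limit up to a constant, and Stirling's formula for N!
supplies the constant √(2π). Passing to exponentials makes the choice of logarithms immaterial. -/
theorem tendsto_exp_sum_gudermann {z : ℂ} (hz : 0 < z.im) :
    Tendsto (fun N : ℕ => Complex.exp (∑ n ∈ Finset.range N, gudermann (z + n))) atTop
      (𝓝 (Complex.Gamma z * Complex.exp (-(z - 1 / 2) * Complex.log z + z) /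
        (√(2 * Real.pi) : ℝ))) := by
  have hzn : ∀ n : ℕ, z + n ≠ 0 := by
    intro n h
    have := congrArg Complex.im h
    simp at this
    linarith
  have hdiv : Tendsto (fun N : ℕ => z / (N : ℂ)) atTop (𝓝 0) :=
    tendsto_const_div_atTop_nhds_zero_nat z
  have hlog0 : Tendsto (fun N : ℕ => Complex.log (1 + z / N)) atTop (𝓝 0) := by
    have : ContinuousAt (fun w : ℂ => Complex.log (1 + w)) 0 := by
      apply ContinuousAt.clog
      · fun_prop
      · simp
    have := this.tendsto.comp hdiv
    simpa [Function.comp_def] using this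
  have hNlog : Tendsto (fun N : ℕ => (N : ℂ) * Complex.log (1 + z / N)) atTop (𝓝 z) := by
    apply Complex.tendsto_nat_mul_log_one_add_of_tendsto
    apply tendsto_const_nhds.congr'
    filter_upwards [eventually_ne_atTop 0] with n hn
    field_simp
  have h1 : Tendsto (fun N : ℕ => Complex.exp ((z + N + 1 / 2) * Complex.log (1 + z / N))) atTop
      (𝓝 (Complex.exp z)) := by
    apply (Complex.continuous_exp.tendsto z).comp
    have := (hlog0.const_mul (z + 1 / 2)).add hNlog
    simp only [mul_zero, zero_add] at this
    apply this.congr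
    intro N; ring
  have h2 : Tendsto (fun N : ℕ => (((√2 * Stirling.stirlingSeq N)⁻¹ : ℝ) : ℂ)) atTop
      (𝓝 (((√(2 * Real.pi))⁻¹ : ℝ) : ℂ)) := by
    apply (Complex.continuous_ofReal.tendsto _).comp
    rw [Real.sqrt_mul (by norm_num)]
    refine Tendsto.inv₀ ?_ (by positivity)
    exact Stirling.tendsto_stirlingSeq_sqrt_pi.const_mul _
  have h3 := ((Complex.GammaSeq_tendsto_Gamma z).mul (h1.mul h2)).mul_const
    (Complex.exp (-(z - 1 / 2) * Complex.log z))
  have : Complex.Gamma z * Complex.exp (-(z - 1 / 2) * Complex.log z + z) /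
        (√(2 * Real.pi) : ℝ) = Complex.Gamma z * (Complex.exp z * (((√(2 * Real.pi))⁻¹ : ℝ) : ℂ)) *
        Complex.exp (-(z - 1 / 2) * Complex.log z) := by
    rw [Complex.exp_add]; push_cast; ring
  rw [this]
  refine h3.congr' ?_
  filter_upwards [eventually_ne_atTop 0] with N hN
  have hNpos : (0 : ℝ) < N := by exact_mod_cast Nat.pos_of_ne_zero hN
  have hNC : (N : ℂ) ≠ 0 := by exact_mod_cast hN
  have hlogN : Complex.log (z + N) = Real.log N + Complex.log (1 + z / N) := by
    have hne : 1 + z / N ≠ 0 := by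
      intro h
      apply hzn N
      have : z + N = N * (1 + z / N) := by field_simp; ring
      rw [this, h, mul_zero]
    have := Complex.log_ofReal_mul hNpos hne
    rw [← this]
    congr 1
    push_cast
    field_simp
    ring
  -- The sequence `Stirling.stirlingSeq` is normalised to tend to √π; the factor √2 turns its
  -- inverse into N^{N+1/2} e^{-N} / N!.
  have hst : (((√2 * Stirling.stirlingSeq N)⁻¹ : ℝ) : ℂ) =
      Complex.exp ((N + 1 / 2) * Real.log N - N) / (N.factorial : ℂ) := by
    have : ((√2 * Stirling.stirlingSeq N)⁻¹ : ℝ) =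
        Real.exp ((N + 1 / 2) * Real.log N - N) / (N.factorial : ℝ) := by
      rw [Stirling.stirlingSeq, Real.exp_sub, add_mul, Real.exp_add,
        Real.sqrt_mul (by norm_num) (N : ℝ), div_pow, ← Real.exp_nat_mul, mul_one,
        mul_comm (N : ℝ) (Real.log N), Real.exp_mul, Real.exp_log hNpos, Real.rpow_natCast,
        mul_comm (1 / 2 : ℝ) (Real.log N), Real.exp_mul, Real.exp_log hNpos, ← Real.sqrt_eq_rpow]
      have h2 : √(2 : ℝ) ≠ 0 := by positivity
      have h3 : √(N : ℝ) ≠ 0 := by positivity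
      field_simp
    rw [this]; push_cast; rfl
  rw [sum_gudermann, Complex.exp_sub, Complex.exp_sub, Complex.exp_sub, Complex.exp_sum, hst,
    Complex.GammaSeq, Finset.prod_range_succ]
  simp_rw [Complex.exp_log (hzn _)]
  have hzN : Complex.exp (Complex.log (z + N)) = z + N := Complex.exp_log (hzn N)
  have hpow : (N : ℂ) ^ z = Complex.exp (Real.log N * z) := by
    rw [Complex.cpow_def_of_ne_zero hNC, ← Complex.natCast_log]
  have hprod : ∏ j ∈ Finset.range N, (z + (j : ℂ)) ≠ 0 :=
    Finset.prod_ne_zero_iff.2 fun j _ => hzn j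
  have hfac : (N.factorial : ℂ) ≠ 0 := by exact_mod_cast N.factorial_ne_zero
  have hz' := hzn N
  rw [hpow]
  have hexp : Complex.exp ((z + N - 1 / 2) * Complex.log (z + N)) * (z + N) =
      Complex.exp (Real.log N * z) * Complex.exp ((z + N + 1 / 2) * Complex.log (1 + z / N)) *
        Complex.exp ((N + 1 / 2) * Real.log N - N) * Complex.exp N := by
    calc _ = Complex.exp ((z + N - 1 / 2) * Complex.log (z + N)) *
          Complex.exp (Complex.log (z + N)) := by rw [hzN]
      _ = _ := ?_
    rw [← Complex.exp_add, ← Complex.exp_add, ← Complex.exp_add, ← Complex.exp_add, hlogN]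
    congr 1
    ring
  have hexp' : Complex.exp ((z + N - 1 / 2) * Complex.log (z + N)) =
      Complex.exp (Real.log N * z) * Complex.exp ((z + N + 1 / 2) * Complex.log (1 + z / N)) *
        Complex.exp ((N + 1 / 2) * Real.log N - N) * Complex.exp N / (z + N) := by
    rw [← hexp]; field_simp
  rw [hexp', neg_mul, Complex.exp_neg]
  have e1 := Complex.exp_ne_zero ((z - 1 / 2) * Complex.log z)
  have e2 := Complex.exp_ne_zero (N : ℂ)
  field_simp

/-- For t large compared with w, the point w + it + n has modulus at least (n + t/2 + 1)/√2. The
terms are therefore dominated by a telescoping series with first term of order 1/t, uniformly in N.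
-/
theorem norm_sum_gudermann_le {M t : ℝ} {w : ℂ} (hw : ‖w‖ ≤ M) (ht : 4 * M + 4 ≤ t) (N : ℕ) :
    ‖∑ n ∈ Finset.range N, gudermann (w + t * Complex.I + n)‖ ≤ 8 / t := by
  have hM : 0 ≤ M := (norm_nonneg w).trans hw
  have hre := abs_le.mp ((Complex.abs_re_le_norm w).trans hw)
  have him := abs_le.mp ((Complex.abs_im_le_norm w).trans hw)
  have key : ∀ n : ℕ, ‖gudermann (w + t * Complex.I + n)‖ ≤
      4 * (1 / (n + t / 2) - 1 / ((n + 1 : ℕ) + t / 2)) := by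
    intro n
    set z := w + t * Complex.I + n with hz
    have hzre : z.re = w.re + n := by simp [hz]
    have hzim : z.im = w.im + t := by simp [hz]
    have hn : (0 : ℝ) ≤ n := n.cast_nonneg
    have hsq : ((n : ℝ) + t / 2 + 1) ^ 2 / 2 ≤ ‖z‖ ^ 2 := by
      rw [← Complex.normSq_eq_norm_sq, Complex.normSq_apply, hzre, hzim]
      have h1 : (n : ℝ) + t / 2 + 1 ≤ w.re + n + (w.im + t) := by linarith
      have h2 : ((n : ℝ) + t / 2 + 1) ^ 2 ≤ (w.re + n + (w.im + t)) ^ 2 :=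
        pow_le_pow_left₀ (by linarith) h1 2
      nlinarith [sq_nonneg (w.re + n - (w.im + t))]
    have hz2 : 2 ≤ ‖z‖ := by
      have := Complex.abs_im_le_norm z
      rw [hzim] at this
      have := le_abs_self (w.im + t)
      linarith
    refine (norm_gudermann_le (by rw [hzim]; linarith) hz2).trans ?_
    have hx : 0 < (n : ℝ) + t / 2 := by linarith
    calc 2 / ‖z‖ ^ 2 ≤ 2 / (((n : ℝ) + t / 2 + 1) ^ 2 / 2) := by gcongr
      _ = 4 / ((n : ℝ) + t / 2 + 1) ^ 2 := by field_simp; norm_num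
      _ ≤ 4 / (((n : ℝ) + t / 2) * ((n : ℝ) + t / 2 + 1)) := by
        gcongr; nlinarith
      _ = _ := by
        have : ((n + 1 : ℕ) : ℝ) + t / 2 = (n + t / 2) + 1 := by push_cast; ring
        rw [this]
        set x := (n : ℝ) + t / 2
        field_simp
        ring
  refine (norm_sum_le _ _).trans ((Finset.sum_le_sum fun n _ => key n).trans ?_)
  rw [← Finset.mul_sum, Finset.sum_range_sub' (fun n : ℕ => 1 / ((n : ℝ) + t / 2))]
  have : 0 ≤ 1 / ((N : ℝ) + t / 2) := by
    have : (0 : ℝ) ≤ N := N.cast_nonneg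
    apply div_nonneg (by norm_num); linarith
  have h2 : 1 / (((0 : ℕ) : ℝ) + t / 2) = 2 / t := by
    have : t ≠ 0 := by linarith
    simp
  rw [h2]
  have : 8 / t = 4 * (2 / t) := by ring
  linarith

theorem log_add_mul_I {w : ℂ} {t : ℝ} (ht : 0 < t) (hw : ‖w‖ < t) :
    Complex.log (w + t * Complex.I) =
      Real.log t + Complex.I * (Real.pi / 2) + Complex.log (1 + -Complex.I * w / t) := by
  set e : ℂ := -Complex.I * w / t with he
  have hen : ‖e‖ < 1 := by
    rw [he]; simp [abs_of_pos ht]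
    rw [div_lt_one ht]; exact hw
  have hre : 0 < (1 + e).re := by
    have := (abs_lt.mp ((Complex.abs_re_le_norm e).trans_lt hen)).1
    simp only [Complex.add_re, Complex.one_re]; linarith
  have hne : 1 + e ≠ 0 := by intro h; rw [h] at hre; simp at hre
  have htC : (t : ℂ) ≠ 0 := by exact_mod_cast ht.ne'
  have h1 : w + t * Complex.I = t * (Complex.I * (1 + e)) := by
    rw [he]; field_simp
    linear_combination w * Complex.I_sq
  rw [h1, Complex.log_ofReal_mul ht (mul_ne_zero Complex.I_ne_zero hne),
    (Complex.log_mul_eq_add_log_iff Complex.I_ne_zero hne).2, Complex.log_I]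
  · ring
  · rw [Complex.arg_I]
    have h4 : |(1 + e).arg| < Real.pi / 2 := Complex.abs_arg_lt_pi_div_two_iff.2 (Or.inl hre)
    have := abs_lt.mp h4
    constructor <;> linarith [Real.pi_pos]

/-- The exponent of the main term in Stirling's formula for `Γ(w + it)`. -/
noncomputable def stirlingExp (w : ℂ) (t : ℝ) : ℂ :=
  Complex.I * (t * Real.log t - t) - Real.pi * t / 2 +
    (w - 1 / 2) * (Real.log t + Complex.I * (Real.pi / 2))

/-- Expand log(w + it) about it, with relative increment e = -iw/t. The contribution it·e = w
cancels the -w, and each remaining product contains e or the quadratic remainder, hence is O(1/t).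
-/
theorem norm_sub_stirlingExp_le {M t : ℝ} {w : ℂ} (hw : ‖w‖ ≤ M) (ht : 4 * M + 4 ≤ t) :
    ‖(w + t * Complex.I - 1 / 2) * Complex.log (w + t * Complex.I) - (w + t * Complex.I) -
      stirlingExp w t‖ ≤ (M + 1) * M * 3 / t := by
  have hM : 0 ≤ M := (norm_nonneg w).trans hw
  have ht0 : 0 < t := by linarith
  have htC : (t : ℂ) ≠ 0 := by exact_mod_cast ht0.ne'
  rw [log_add_mul_I ht0 (by linarith), stirlingExp]
  set e : ℂ := -Complex.I * w / t with he
  have hen' : ‖e‖ = ‖w‖ / t := by rw [he]; simp [abs_of_pos ht0]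
  have hen : ‖e‖ ≤ M / t := by rw [hen']; gcongr
  have hMt : M / t ≤ 1 / 2 := by rw [div_le_iff₀ ht0]; linarith
  have hr := Complex.norm_log_one_add_sub_self_le (z := e) (by linarith)
  set r := Complex.log (1 + e) - e with hrdef
  have hr' : ‖r‖ ≤ (M / t) ^ 2 := by
    refine hr.trans ?_
    have h2 : (1 - ‖e‖)⁻¹ ≤ 2 := by
      rw [inv_le_comm₀ (by linarith) (by norm_num)]; linarith
    calc ‖e‖ ^ 2 * (1 - ‖e‖)⁻¹ / 2 ≤ ‖e‖ ^ 2 * 2 / 2 := by gcongr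
      _ = ‖e‖ ^ 2 := by ring
      _ ≤ _ := by gcongr
  have hlog : Complex.log (1 + e) = e + r := by rw [hrdef]; ring
  rw [hlog]
  have hte : t * Complex.I * e = w := by
    rw [he]; field_simp; linear_combination (-w) * Complex.I_sq
  have hid : (w + t * Complex.I - 1 / 2) *
      (Real.log t + Complex.I * (Real.pi / 2) + (e + r)) - (w + t * Complex.I) -
      (Complex.I * (t * Real.log t - t) - Real.pi * t / 2 +
        (w - 1 / 2) * (Real.log t + Complex.I * (Real.pi / 2))) =
      (w - 1 / 2) * e + (w - 1 / 2) * r + t * Complex.I * r := by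
    linear_combination hte + (t * (Real.pi / 2)) * Complex.I_sq
  rw [hid]
  have hw2 : ‖w - 1 / 2‖ ≤ M + 1 := by
    refine (norm_sub_le _ _).trans ?_
    have : ‖(1 / 2 : ℂ)‖ = 1 / 2 := by norm_num
    linarith
  have n1 : ‖(w - 1 / 2) * e‖ ≤ (M + 1) * (M / t) := by rw [norm_mul]; gcongr
  have n2 : ‖(w - 1 / 2) * r‖ ≤ (M + 1) * (M / t) ^ 2 := by rw [norm_mul]; gcongr
  have n3 : ‖t * Complex.I * r‖ ≤ t * (M / t) ^ 2 := by
    rw [norm_mul, norm_mul, Complex.norm_I, Complex.norm_real, Real.norm_of_nonneg ht0.le, mul_one]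
    gcongr
  have h5 : (M + 1) * (M / t) ^ 2 ≤ (M + 1) * (M / t) := by
    have : 0 ≤ M / t := by positivity
    gcongr; nlinarith
  have h6 : t * (M / t) ^ 2 ≤ (M + 1) * (M / t) := by
    have : t * (M / t) ^ 2 = M * (M / t) := by field_simp
    rw [this]; gcongr; linarith
  have h7 : (M + 1) * M * 3 / t = 3 * ((M + 1) * (M / t)) := by ring
  rw [h7]
  refine (norm_add_le _ _).trans ?_
  have := norm_add_le ((w - 1 / 2) * e) ((w - 1 / 2) * r)
  linarith

/-- Stirling's formula on vertical lines, uniformly for `w` in a bounded set. -/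
theorem Gamma_stirling (M : ℝ) : ∃ C t₀ : ℝ, 0 < C ∧ 0 < t₀ ∧ ∀ w : ℂ, ‖w‖ ≤ M → ∀ t : ℝ, t₀ ≤ t →
    ‖Complex.Gamma (w + t * Complex.I) * Complex.exp (-stirlingExp w t) /
      (√(2 * Real.pi) : ℝ) - 1‖ ≤ C / t := by
  by_cases hM : 0 ≤ M
  swap
  · exact ⟨1, 1, one_pos, one_pos, fun w hw => absurd ((norm_nonneg w).trans hw) hM⟩
  set C₁ := (M + 1) * M * 3 with hC₁
  have hC₁0 : 0 ≤ C₁ := by positivity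
  -- The threshold makes both exponents 8/t and C₁/t at most 1, where |e^u - 1| ≤ 2|u|. The constant
  -- is 3·16 from the Gudermann sum, 3 bounding the other exponential, plus 2C₁ from the expansion
  -- of the exponent.
  refine ⟨48 + 2 * C₁, 4 * M + 16 + C₁, by positivity, by positivity, fun w hw t ht => ?_⟩
  have ht0 : 0 < t := by linarith
  have ht4 : 4 * M + 4 ≤ t := by linarith
  set z := w + t * Complex.I with hz
  have hzim : 0 < z.im := by
    have := (abs_le.mp ((Complex.abs_im_le_norm w).trans hw)).1
    simp [hz]; linarith
  have hlim := tendsto_exp_sum_gudermann hzim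
  set X := Complex.Gamma z * Complex.exp (-(z - 1 / 2) * Complex.log z + z) /
        (√(2 * Real.pi) : ℝ) with hX
  have hX1 : ‖X - 1‖ ≤ 16 / t := by
    refine le_of_tendsto (hlim.sub_const 1).norm (Eventually.of_forall fun N => ?_)
    have h8 := norm_sum_gudermann_le hw ht4 N
    have h81 : 8 / t ≤ 1 := by rw [div_le_one ht0]; linarith
    refine (Complex.norm_exp_sub_one_le (h8.trans h81)).trans ?_
    calc 2 * _ ≤ 2 * (8 / t) := by gcongr
      _ = _ := by ring
  set E := (z - 1 / 2) * Complex.log z - z - stirlingExp w t with hE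
  have hEn : ‖E‖ ≤ C₁ / t := norm_sub_stirlingExp_le hw ht4
  have hE1 : C₁ / t ≤ 1 := by rw [div_le_one ht0]; linarith
  have hE2 := Complex.norm_exp_sub_one_le (hEn.trans hE1)
  have hfac : Complex.Gamma z * Complex.exp (-stirlingExp w t) / (√(2 * Real.pi) : ℝ) =
      X * Complex.exp E := by
    rw [hX, div_mul_eq_mul_div, mul_assoc, ← Complex.exp_add]
    congr 3
    rw [hE]; ring
  rw [hfac, show X * Complex.exp E - 1 = (X - 1) * Complex.exp E + (Complex.exp E - 1) by ring]
  have hEe : ‖Complex.exp E‖ ≤ 3 := by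
    have := norm_add_le (Complex.exp E - 1) 1
    simp only [sub_add_cancel, norm_one] at this
    linarith [mul_le_mul_of_nonneg_left (hEn.trans hE1) (by norm_num : (0 : ℝ) ≤ 2)]
  refine (norm_add_le _ _).trans ?_
  rw [norm_mul]
  calc ‖X - 1‖ * ‖Complex.exp E‖ + ‖Complex.exp E - 1‖ ≤ 16 / t * 3 + 2 * (C₁ / t) := by
        gcongr; exact hE2.trans (by gcongr)
    _ = _ := by ring

end RieszSum

namespace RieszSum

/-! ### Asymptotics along vertical lines -/

/-- `f σ t = c · exp (E σ t) · (1 + O(1/t))` uniformly for `σ ∈ s`, where `c ≠ 0`. -/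
def ExpAsymp (s : Set ℝ) (f E : ℝ → ℝ → ℂ) : Prop :=
  ∃ c : ℂ, c ≠ 0 ∧ ∃ C t₀ : ℝ, 0 < C ∧ 0 < t₀ ∧ ∀ σ ∈ s, ∀ t, t₀ ≤ t →
    ‖f σ t * Complex.exp (-E σ t) - c‖ ≤ C / t

namespace ExpAsymp

variable {s : Set ℝ} {f g E F : ℝ → ℝ → ℂ}

theorem congr (h : ExpAsymp s f E) (hf : ∀ σ t, 0 < t → f σ t = g σ t)
    (hE : ∀ σ t, 0 < t → E σ t = F σ t) : ExpAsymp s g F := by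
  obtain ⟨c, hc, C, t₀, hC, ht₀, h⟩ := h
  refine ⟨c, hc, C, t₀, hC, ht₀, fun σ hσ t ht => ?_⟩
  rw [← hf σ t (ht₀.trans_le ht), ← hE σ t (ht₀.trans_le ht)]
  exact h σ hσ t ht

theorem one : ExpAsymp s (fun _ _ => 1) (fun _ _ => 0) :=
  ⟨1, one_ne_zero, 1, 1, one_pos, one_pos, fun σ _ t ht => by
    simp only [neg_zero, Complex.exp_zero, mul_one, sub_self, norm_zero]; positivity⟩

theorem mul (h : ExpAsymp s f E) (h' : ExpAsymp s g F) :
    ExpAsymp s (fun σ t => f σ t * g σ t) (fun σ t => E σ t + F σ t) := by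
  obtain ⟨c, hc, C, t₀, hC, ht₀, h⟩ := h
  obtain ⟨c', hc', C', t₀', hC', ht₀', h'⟩ := h'
  refine ⟨c * c', mul_ne_zero hc hc', C * (‖c'‖ + C') + ‖c‖ * C', max 1 (max t₀ t₀'),
    by positivity, by positivity, fun σ hσ t ht => ?_⟩
  simp only [max_le_iff] at ht
  obtain ⟨ht1, ht2, ht3⟩ := ht
  have a := h σ hσ t ht2
  have b := h' σ hσ t ht3
  set X := f σ t * Complex.exp (-E σ t)
  set Y := g σ t * Complex.exp (-F σ t)
  have hXY : f σ t * g σ t * Complex.exp (-(E σ t + F σ t)) = X * Y := by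
    rw [neg_add, Complex.exp_add]; ring
  rw [hXY, show X * Y - c * c' = (X - c) * Y + c * (Y - c') by ring]
  have ht : 0 < t := by linarith
  have hY : ‖Y‖ ≤ ‖c'‖ + C' := by
    have h1 := norm_add_le (Y - c') c'
    rw [sub_add_cancel] at h1
    have : C' / t ≤ C' := div_le_self hC'.le ht1
    linarith
  refine (norm_add_le _ _).trans ?_
  rw [norm_mul (X - c), norm_mul c]
  calc ‖X - c‖ * ‖Y‖ + ‖c‖ * ‖Y - c'‖ ≤ C / t * (‖c'‖ + C') + ‖c‖ * (C' / t) := by gcongr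
    _ = _ := by ring

theorem inv (h : ExpAsymp s f E) :
    ExpAsymp s (fun σ t => (f σ t)⁻¹) (fun σ t => -E σ t) := by
  obtain ⟨c, hc, C, t₀, hC, ht₀, h⟩ := h
  have hc0 : 0 < ‖c‖ := norm_pos_iff.2 hc
  refine ⟨c⁻¹, inv_ne_zero hc, C * (2 / ‖c‖ ^ 2), max t₀ (2 * C / ‖c‖), by positivity,
    by positivity, fun σ hσ t ht => ?_⟩
  simp only [max_le_iff] at ht
  obtain ⟨ht2, ht3⟩ := ht
  have a := h σ hσ t ht2
  have ht : 0 < t := by linarith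
  set X := f σ t * Complex.exp (-E σ t) with hX
  have hXi : (f σ t)⁻¹ * Complex.exp (- -E σ t) = X⁻¹ := by
    rw [hX, mul_inv, ← Complex.exp_neg]
  have hCt : C / t ≤ ‖c‖ / 2 := by
    rw [div_le_iff₀ hc0] at ht3
    rw [div_le_div_iff₀ ht (by norm_num)]
    linarith
  have hXn : ‖c‖ / 2 ≤ ‖X‖ := by
    have h1 := norm_sub_le X (X - c)
    rw [sub_sub_cancel] at h1
    linarith
  have hX0 : X ≠ 0 := by
    rw [← norm_pos_iff]; linarith
  rw [hXi, show X⁻¹ - c⁻¹ = -(X - c) * (X⁻¹ * c⁻¹) by field_simp; ring, norm_mul, norm_neg,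
    norm_mul, norm_inv, norm_inv]
  calc ‖X - c‖ * (‖X‖⁻¹ * ‖c‖⁻¹) ≤ C / t * ((‖c‖ / 2)⁻¹ * ‖c‖⁻¹) := by gcongr
    _ = _ := by field_simp

theorem prod {ι : Type*} (u : Finset ι) {f E : ι → ℝ → ℝ → ℂ}
    (h : ∀ i ∈ u, ExpAsymp s (f i) (E i)) :
    ExpAsymp s (fun σ t => ∏ i ∈ u, f i σ t) (fun σ t => ∑ i ∈ u, E i σ t) := by
  classical
  induction u using Finset.induction_on with
  | empty => simpa using one
  | insert i u hi ih =>
    simp only [Finset.prod_insert hi, Finset.sum_insert hi]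
    exact (h i (Finset.mem_insert_self i u)).mul
      (ih fun j hj => h j (Finset.mem_insert_of_mem hj))

theorem norm_le (h : ExpAsymp s f E) : ∃ C t₀ : ℝ, 0 < C ∧ 0 < t₀ ∧ ∀ σ ∈ s, ∀ t, t₀ ≤ t →
    ‖f σ t‖ ≤ C * Real.exp (E σ t).re := by
  obtain ⟨c, hc, C, t₀, hC, ht₀, h⟩ := h
  refine ⟨‖c‖ + C, max 1 t₀, by positivity, by positivity, fun σ hσ t ht => ?_⟩
  simp only [max_le_iff] at ht
  have a := h σ hσ t ht.2
  set X := f σ t * Complex.exp (-E σ t) with hX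
  have hX' : f σ t = X * Complex.exp (E σ t) := by
    rw [hX, mul_assoc, ← Complex.exp_add]; simp
  rw [hX', norm_mul, Complex.norm_exp]
  have h1 := norm_add_le (X - c) c
  rw [sub_add_cancel] at h1
  have : C / t ≤ C := div_le_self hC.le ht.1
  gcongr
  linarith

theorem exists_norm_sub_le (h : ExpAsymp s f E) : ∃ c : ℂ, ∃ C t₀ : ℝ, 0 < C ∧ 0 < t₀ ∧
    ∀ σ ∈ s, ∀ t, t₀ ≤ t →
      ‖f σ t - c * Complex.exp (E σ t)‖ ≤ C / t * Real.exp (E σ t).re := by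
  obtain ⟨c, hc, C, t₀, hC, ht₀, h⟩ := h
  refine ⟨c, C, t₀, hC, ht₀, fun σ hσ t ht => ?_⟩
  have a := h σ hσ t ht
  set X := f σ t * Complex.exp (-E σ t) with hX
  have hX' : f σ t = X * Complex.exp (E σ t) := by
    rw [hX, mul_assoc, ← Complex.exp_add]; simp
  rw [hX', ← sub_mul, norm_mul, Complex.norm_exp]
  gcongr

end ExpAsymp

/-- Exponents of the shape that occurs in quotients of Gamma functions. -/
noncomputable def lineExp (d l : ℝ) (a b c₀ c₁ : ℂ) (σ t : ℝ) : ℂ :=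
  Complex.I * (d * t * Real.log t + l * t) + (a + b * σ) * Real.log t + c₀ + c₁ * σ

/-- The parameters d and l contribute only to the phase. The modulus is a power of t whose exponent
is affine in σ. -/
theorem lineExp_re (d l : ℝ) (a b c₀ c₁ : ℂ) (σ t : ℝ) :
    (lineExp d l a b c₀ c₁ σ t).re =
      (a.re + b.re * σ) * Real.log t + c₀.re + c₁.re * σ := by
  simp [lineExp]

theorem ExpAsymp.Gamma_up {s : Set ℝ} {w : ℝ → ℂ} {α M : ℝ} (hα : 0 < α)
    (hw : ∀ σ ∈ s, ‖w σ‖ ≤ M) :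
    ExpAsymp s (fun σ t => Complex.Gamma (w σ + α * t * Complex.I))
      (fun σ t => stirlingExp (w σ) (α * t)) := by
  obtain ⟨C, t₀, hC, ht₀, h⟩ := Gamma_stirling M
  have hpi : 0 < √(2 * Real.pi) := by positivity
  refine ⟨((√(2 * Real.pi) : ℝ) : ℂ), by exact_mod_cast hpi.ne', √(2 * Real.pi) * (C / α), t₀ / α,
    by positivity, by positivity, fun σ hσ t ht => ?_⟩
  rw [div_le_iff₀ hα, mul_comm] at ht
  have := h (w σ) (hw σ hσ) (α * t) ht
  push_cast at this
  set c : ℂ := ((√(2 * Real.pi) : ℝ) : ℂ) with hc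
  have hc0 : c ≠ 0 := by rw [hc]; exact_mod_cast hpi.ne'
  set X := Complex.Gamma (w σ + α * t * Complex.I) * Complex.exp (-stirlingExp (w σ) (α * t))
  rw [show X - c = c * (X / c - 1) by field_simp, norm_mul, hc, Complex.norm_real,
    Real.norm_of_nonneg hpi.le]
  calc _ ≤ √(2 * Real.pi) * (C / (α * t)) := by gcongr
    _ = _ := by field_simp

theorem ExpAsymp.conj {s : Set ℝ} {f E : ℝ → ℝ → ℂ} (h : ExpAsymp s f E) :
    ExpAsymp s (fun σ t => starRingEnd ℂ (f σ t)) (fun σ t => starRingEnd ℂ (E σ t)) := by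
  obtain ⟨c, hc, C, t₀, hC, ht₀, h⟩ := h
  refine ⟨starRingEnd ℂ c, (map_ne_zero _).2 hc, C, t₀, hC, ht₀, fun σ hσ t ht => ?_⟩
  rw [← map_neg, Complex.exp_conj, ← map_mul, ← map_sub, Complex.norm_conj]
  exact h σ hσ t ht

/-- Reflection in the real axis, since Γ commutes with conjugation; it gives the lower half-plane
without a second Stirling formula. -/
theorem ExpAsymp.Gamma_down {s : Set ℝ} {w : ℝ → ℂ} {α M : ℝ} (hα : 0 < α)
    (hw : ∀ σ ∈ s, ‖w σ‖ ≤ M) :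
    ExpAsymp s (fun σ t => Complex.Gamma (w σ - α * t * Complex.I))
      (fun σ t => starRingEnd ℂ (stirlingExp (starRingEnd ℂ (w σ)) (α * t))) := by
  have := (ExpAsymp.Gamma_up (s := s) (w := fun σ => starRingEnd ℂ (w σ)) (M := M) hα
    (fun σ hσ => by simpa using hw σ hσ)).conj
  refine this.congr (fun σ t _ => ?_) (fun _ _ _ => rfl)
  rw [← Complex.Gamma_conj]
  simp [sub_eq_add_neg]

/-! ### Asymptotics of the Gamma quotients -/

theorem stirlingExp_sub (w w' : ℂ) (t : ℝ) :
    stirlingExp w t - stirlingExp w' t =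
      (w - w') * (Real.log t + Complex.I * (Real.pi / 2)) := by
  simp only [stirlingExp]; ring

/-- `Γ(s)/Γ(s+ρ+1)` on vertical lines. -/
theorem expAsymp_Gamma_div_up (ρ c₁ c₂ : ℝ) :
    ExpAsymp (Set.Icc c₁ c₂)
      (fun σ t => Complex.Gamma (σ + t * Complex.I) *
        (Complex.Gamma (σ + t * Complex.I + ρ + 1))⁻¹)
      (lineExp 0 0 (-(1 + ρ)) 0 (-(1 + ρ) * (Complex.I * (Real.pi / 2))) 0) := by
  have hb : ∀ σ ∈ Set.Icc c₁ c₂, |σ| ≤ max |c₁| |c₂| := fun σ hσ =>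
    abs_le_max_abs_abs hσ.1 hσ.2
  have h1 := ExpAsymp.Gamma_up (s := Set.Icc c₁ c₂) (w := fun σ => (σ : ℂ))
    (M := max |c₁| |c₂|) one_pos (fun σ hσ => by simpa using hb σ hσ)
  have h2 := ExpAsymp.Gamma_up (s := Set.Icc c₁ c₂) (w := fun σ => (σ : ℂ) + (ρ + 1 : ℝ))
    (M := max |c₁| |c₂| + |ρ + 1|) one_pos (fun σ hσ => by
      refine (norm_add_le _ _).trans ?_
      simp only [Complex.norm_real, Real.norm_eq_abs]
      have := hb σ hσ
      linarith)
  refine (h1.mul h2.inv).congr (fun σ t _ => ?_) (fun σ t _ => ?_)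
  · push_cast
    congr 3 <;> ring_nf
  · rw [← sub_eq_add_neg, stirlingExp_sub]
    simp [lineExp]
    ring

/-- `Γ(δ-s)/Γ(1+δ-s+ρ)` on vertical lines. -/
theorem expAsymp_Gamma_div_down (δ ρ c₁ c₂ : ℝ) :
    ExpAsymp (Set.Icc c₁ c₂)
      (fun σ t => Complex.Gamma (δ - (σ + t * Complex.I)) *
        (Complex.Gamma (1 + δ - (σ + t * Complex.I) + ρ))⁻¹)
      (lineExp 0 0 (-(1 + ρ)) 0 ((1 + ρ) * (Complex.I * (Real.pi / 2))) 0) := by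
  have h := (expAsymp_Gamma_div_up ρ (δ - c₂) (δ - c₁)).conj
  obtain ⟨c, hc, C, t₀, hC, ht₀, h⟩ := h
  refine ⟨c, hc, C, t₀, hC, ht₀, fun σ hσ t ht => ?_⟩
  have := h (δ - σ) ⟨by linarith [hσ.2], by linarith [hσ.1]⟩ t ht
  convert this using 4
  · beta_reduce
    rw [map_mul, map_inv₀, ← Complex.Gamma_conj, ← Complex.Gamma_conj]
    congr 2
    · simp; ring
    · congr 1; simp; ring
  · have h2 : starRingEnd ℂ 2 = 2 := Complex.conj_ofNat 2
    simp [lineExp, h2]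
    ring_nf

/-- The quotient of the products of Gamma functions in the Mellin--Barnes integrand. -/
noncomputable def factorRatio {r : ℕ} (δ : ℝ) (α : Fin r → ℝ) (β : Fin r → ℂ) (s : ℂ) : ℂ :=
  gammaFactor α (fun i => starRingEnd ℂ (β i)) s * (gammaFactor α β (δ - s))⁻¹

theorem gammaQuotient_eq {r : ℕ} (δ : ℝ) (α : Fin r → ℝ) (β : Fin r → ℂ) (ρ : ℝ) (s : ℂ) :
    gammaQuotient δ α β ρ s =
      Complex.Gamma (δ - s) * (Complex.Gamma (1 + δ - s + ρ))⁻¹ * factorRatio δ α β s := by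
  rw [gammaQuotient, factorRatio, div_eq_mul_inv, mul_inv]; ring

/-- The two arguments have opposite heights, up to a bounded amount. In the quotient the exponential
decays therefore cancel, while the phases αt log t add up. The resulting 2αt log t is the source of
all later oscillation. -/
theorem expAsymp_factor (δ α : ℝ) (hα : 0 < α) (β : ℂ) (c₁ c₂ : ℝ) :
    ExpAsymp (Set.Icc c₁ c₂)
      (fun σ t => Complex.Gamma (α * (σ + t * Complex.I) + starRingEnd ℂ β) *
        (Complex.Gamma (α * (δ - (σ + t * Complex.I)) + β))⁻¹)
      (lineExp (2 * α) (2 * α * Real.log α - 2 * α) (-α * δ - 2 * Complex.I * β.im) (2 * α)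
        ((-α * δ - 2 * Complex.I * β.im) * Real.log α +
          (α * δ + 2 * β.re - 1) * (Complex.I * (Real.pi / 2))) (2 * α * Real.log α)) := by
  have hb : ∀ σ ∈ Set.Icc c₁ c₂, |σ| ≤ max |c₁| |c₂| := fun σ hσ =>
    abs_le_max_abs_abs hσ.1 hσ.2
  have h1 := ExpAsymp.Gamma_up (s := Set.Icc c₁ c₂)
    (w := fun σ => (α * σ : ℝ) + starRingEnd ℂ β)
    (M := α * max |c₁| |c₂| + ‖β‖) hα (fun σ hσ => by
      refine (norm_add_le _ _).trans ?_
      simp only [Complex.norm_real, Real.norm_eq_abs, Complex.norm_conj, abs_mul, abs_of_pos hα]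
      have := hb σ hσ
      gcongr)
  have h2 := ExpAsymp.Gamma_down (s := Set.Icc c₁ c₂)
    (w := fun σ => (α * (δ - σ) : ℝ) + β)
    (M := α * (|δ| + max |c₁| |c₂|) + ‖β‖) hα (fun σ hσ => by
      refine (norm_add_le _ _).trans ?_
      simp only [Complex.norm_real, Real.norm_eq_abs, abs_mul, abs_of_pos hα]
      have := hb σ hσ
      have := abs_sub δ σ
      gcongr
      linarith)
  refine (h1.mul h2.inv).congr (fun σ t _ => ?_) (fun σ t ht => ?_)
  · push_cast
    congr 2
    · ring_nf
    · congr 2; ring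
  · have hlog : Real.log (α * t) = Real.log α + Real.log t := Real.log_mul hα.ne' ht.ne'
    have hβ := Complex.re_add_im β
    have hβ' : starRingEnd ℂ β = β.re - β.im * Complex.I := by
      apply Complex.ext <;> simp
    simp only [stirlingExp, lineExp, hlog]
    simp only [map_add, map_sub, map_mul, map_div₀, Complex.conj_I, Complex.conj_ofReal, map_one,
      map_ofNat, Complex.conj_conj]
    rw [hβ']
    nth_rewrite 3 [← hβ]
    push_cast
    ring_nf

theorem sum_lineExp {ι : Type*} (u : Finset ι) (d l : ι → ℝ) (a b c₀ c₁ : ι → ℂ) (σ t : ℝ) :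
    ∑ i ∈ u, lineExp (d i) (l i) (a i) (b i) (c₀ i) (c₁ i) σ t =
      lineExp (∑ i ∈ u, d i) (∑ i ∈ u, l i) (∑ i ∈ u, a i) (∑ i ∈ u, b i) (∑ i ∈ u, c₀ i)
        (∑ i ∈ u, c₁ i) σ t := by
  simp only [lineExp]
  push_cast
  simp only [Finset.sum_add_distrib, Finset.mul_sum, Finset.sum_mul, mul_add, add_mul]

theorem lineExp_add (d l d' l' : ℝ) (a b c₀ c₁ a' b' c₀' c₁' : ℂ) (σ t : ℝ) :
    lineExp d l a b c₀ c₁ σ t + lineExp d' l' a' b' c₀' c₁' σ t =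
      lineExp (d + d') (l + l') (a + a') (b + b') (c₀ + c₀') (c₁ + c₁') σ t := by
  simp only [lineExp]; push_cast; ring

theorem expAsymp_factorRatio {r : ℕ} (δ : ℝ) {α : Fin r → ℝ} (hα : ∀ i, 0 < α i)
    (β : Fin r → ℂ) : ∃ l : ℝ, ∃ a c₀ c₁ : ℂ, a.re = -δ * ∑ i, α i ∧ ∀ c₁' c₂' : ℝ,
    ExpAsymp (Set.Icc c₁' c₂') (fun σ t => factorRatio δ α β (σ + t * Complex.I))
      (lineExp (2 * ∑ i, α i) l a ((2 * ∑ i, α i : ℝ) : ℂ) c₀ c₁) := by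
  refine ⟨∑ i, (2 * α i * Real.log (α i) - 2 * α i),
    ∑ i, (-(α i : ℂ) * δ - 2 * Complex.I * (β i).im),
    ∑ i, ((-(α i : ℂ) * δ - 2 * Complex.I * (β i).im) * Real.log (α i) +
          (α i * δ + 2 * (β i).re - 1) * (Complex.I * (Real.pi / 2))),
    ∑ i, (2 * (α i : ℂ) * Real.log (α i)), ?_, fun c₁' c₂' => ?_⟩
  · rw [Complex.re_sum, Finset.mul_sum]
    refine Finset.sum_congr rfl fun i _ => ?_
    simp
    ring
  · refine (ExpAsymp.prod Finset.univ fun i _ =>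
      expAsymp_factor δ (α i) (hα i) (β i) c₁' c₂').congr (fun σ t _ => ?_) (fun σ t _ => ?_)
    · simp only [factorRatio, gammaFactor]
      rw [← Finset.prod_inv_distrib, ← Finset.prod_mul_distrib]
    · rw [sum_lineExp, Finset.mul_sum]
      push_cast
      rfl

theorem expAsymp_gammaQuotient {r : ℕ} (δ : ℝ) {α : Fin r → ℝ} (hα : ∀ i, 0 < α i)
    (β : Fin r → ℂ) (ρ : ℝ) : ∃ l : ℝ, ∃ a c₀ c₁ : ℂ, a.re = -δ * ∑ i, α i - 1 - ρ ∧
    ∀ c₁' c₂' : ℝ,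
    ExpAsymp (Set.Icc c₁' c₂') (fun σ t => gammaQuotient δ α β ρ (σ + t * Complex.I))
      (lineExp (2 * ∑ i, α i) l a ((2 * ∑ i, α i : ℝ) : ℂ) c₀ c₁) := by
  obtain ⟨l, a, c₀, c₁, ha, h⟩ := expAsymp_factorRatio δ hα β
  refine ⟨l, a - (1 + ρ), (1 + ρ) * (Complex.I * (Real.pi / 2)) + c₀, c₁, ?_, fun c₁' c₂' => ?_⟩
  · simp [ha]; ring
  · refine ((expAsymp_Gamma_div_down δ ρ c₁' c₂').mul (h c₁' c₂')).congr (fun σ t _ => ?_)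
      (fun σ t _ => ?_)
    · rw [gammaQuotient_eq]
    · rw [lineExp_add]
      congr 1 <;> ring

theorem ExpAsymp.norm_le_rpow {c₁ c₂ d l : ℝ} {a b k₀ k₁ : ℂ} {f : ℝ → ℝ → ℂ}
    (h : ExpAsymp (Set.Icc c₁ c₂) f (lineExp d l a b k₀ k₁)) :
    ∃ C t₀ : ℝ, 0 < C ∧ 0 < t₀ ∧ ∀ σ ∈ Set.Icc c₁ c₂, ∀ t, t₀ ≤ t →
      ‖f σ t‖ ≤ C * t ^ (a.re + b.re * σ) := by
  obtain ⟨C, t₀, hC, ht₀, h⟩ := h.norm_le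
  refine ⟨C * Real.exp (k₀.re + |k₁.re| * max |c₁| |c₂|), t₀, by positivity, ht₀,
    fun σ hσ t ht => (h σ hσ t ht).trans ?_⟩
  have hσ' : |σ| ≤ max |c₁| |c₂| := abs_le_max_abs_abs hσ.1 hσ.2
  rw [lineExp_re, Real.rpow_def_of_pos (ht₀.trans_le ht), mul_assoc, ← Real.exp_add]
  have : k₁.re * σ ≤ |k₁.re| * max |c₁| |c₂| := by
    refine (le_abs_self _).trans ?_
    rw [abs_mul]; gcongr
  gcongr C * Real.exp ?_
  linarith

theorem gammaFactor_conj {r : ℕ} (α : Fin r → ℝ) (β : Fin r → ℂ) (s : ℂ) :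
    starRingEnd ℂ (gammaFactor α β s) =
      gammaFactor α (fun i => starRingEnd ℂ (β i)) (starRingEnd ℂ s) := by
  simp only [gammaFactor, map_prod, ← Complex.Gamma_conj, map_add, map_mul, Complex.conj_ofReal]

theorem factorRatio_conj {r : ℕ} (δ : ℝ) (α : Fin r → ℝ) (β : Fin r → ℂ) (s : ℂ) :
    starRingEnd ℂ (factorRatio δ α β s) =
      factorRatio δ α (fun i => starRingEnd ℂ (β i)) (starRingEnd ℂ s) := by
  simp only [factorRatio, map_mul, map_inv₀, gammaFactor_conj, map_sub, Complex.conj_ofReal]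

theorem gammaQuotient_conj {r : ℕ} (δ : ℝ) (α : Fin r → ℝ) (β : Fin r → ℂ) (ρ : ℝ) (s : ℂ) :
    starRingEnd ℂ (gammaQuotient δ α β ρ s) =
      gammaQuotient δ α (fun i => starRingEnd ℂ (β i)) ρ (starRingEnd ℂ s) := by
  simp only [gammaQuotient_eq, map_mul, map_inv₀, ← Complex.Gamma_conj, factorRatio_conj, map_sub,
    map_add, map_one, Complex.conj_ofReal]

/-- The Gamma quotients are not real on the real axis: conjugation replaces β by its conjugate.
Bounds below the real axis are thus bounds above it for a companion function g. -/
theorem two_sided_bound {c₁ c₂ : ℝ} {f g : ℂ → ℂ} {e : ℝ → ℝ}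
    (hfg : ∀ s, starRingEnd ℂ (f s) = g (starRingEnd ℂ s))
    (hf : ∃ C t₀ : ℝ, 0 < C ∧ 0 < t₀ ∧ ∀ σ ∈ Set.Icc c₁ c₂, ∀ t, t₀ ≤ t →
      ‖f (σ + t * Complex.I)‖ ≤ C * t ^ e σ)
    (hg : ∃ C t₀ : ℝ, 0 < C ∧ 0 < t₀ ∧ ∀ σ ∈ Set.Icc c₁ c₂, ∀ t, t₀ ≤ t →
      ‖g (σ + t * Complex.I)‖ ≤ C * t ^ e σ) :
    ∃ C t₀ : ℝ, 0 < C ∧ 0 < t₀ ∧ ∀ s : ℂ, s.re ∈ Set.Icc c₁ c₂ → t₀ ≤ |s.im| →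
      ‖f s‖ ≤ C * |s.im| ^ e s.re := by
  obtain ⟨C, t₀, hC, ht₀, hf⟩ := hf
  obtain ⟨C', t₀', hC', ht₀', hg⟩ := hg
  refine ⟨max C C', max t₀ t₀', by positivity, by positivity, fun s hs ht => ?_⟩
  simp only [max_le_iff] at ht
  rcases le_total 0 s.im with h | h
  · rw [abs_of_nonneg h] at *
    have := hf s.re hs s.im ht.1
    rw [Complex.re_add_im] at this
    refine this.trans ?_
    gcongr
    exact le_max_left _ _
  · rw [abs_of_nonpos h] at *
    have := hg s.re hs (-s.im) ht.2
    have hs' : (s.re : ℂ) + ((-s.im : ℝ) : ℂ) * Complex.I = starRingEnd ℂ s := by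
      apply Complex.ext <;> simp
    rw [hs', ← hfg, Complex.norm_conj] at this
    refine this.trans ?_
    gcongr
    · exact Real.rpow_nonneg (by linarith) _
    · exact le_max_right _ _

theorem norm_factorRatio_le {r : ℕ} (δ : ℝ) {α : Fin r → ℝ} (hα : ∀ i, 0 < α i)
    (β : Fin r → ℂ) (c₁ c₂ : ℝ) : ∃ C t₀ : ℝ, 0 < C ∧ 0 < t₀ ∧ ∀ s : ℂ,
      s.re ∈ Set.Icc c₁ c₂ → t₀ ≤ |s.im| →
      ‖factorRatio δ α β s‖ ≤ C * |s.im| ^ ((2 * s.re - δ) * ∑ i, α i) := by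
  refine two_sided_bound (f := factorRatio δ α β) (e := fun σ => (2 * σ - δ) * ∑ i, α i)
    (factorRatio_conj δ α β) ?_ ?_
  · obtain ⟨l, a, k₀, k₁, ha, h⟩ := expAsymp_factorRatio δ hα β
    have h' := (h c₁ c₂).norm_le_rpow
    simp only [ha, Complex.ofReal_re] at h'
    have e : ∀ σ : ℝ, -δ * ∑ i, α i + (2 * ∑ i, α i) * σ =
        (2 * σ - δ) * ∑ i, α i := fun σ => by ring
    simp only [e] at h'
    exact h'
  · obtain ⟨l, a, k₀, k₁, ha, h⟩ := expAsymp_factorRatio δ hα (fun i => starRingEnd ℂ (β i))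
    have h' := (h c₁ c₂).norm_le_rpow
    simp only [ha, Complex.ofReal_re] at h'
    have e : ∀ σ : ℝ, -δ * ∑ i, α i + (2 * ∑ i, α i) * σ =
        (2 * σ - δ) * ∑ i, α i := fun σ => by ring
    simp only [e] at h'
    exact h'

theorem norm_gammaQuotient_le {r : ℕ} (δ : ℝ) {α : Fin r → ℝ} (hα : ∀ i, 0 < α i)
    (β : Fin r → ℂ) (ρ c₁ c₂ : ℝ) : ∃ C t₀ : ℝ, 0 < C ∧ 0 < t₀ ∧ ∀ s : ℂ,
      s.re ∈ Set.Icc c₁ c₂ → t₀ ≤ |s.im| →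
      ‖gammaQuotient δ α β ρ s‖ ≤ C * |s.im| ^ ((2 * s.re - δ) * ∑ i, α i - 1 - ρ) := by
  refine two_sided_bound (f := gammaQuotient δ α β ρ)
    (e := fun σ => (2 * σ - δ) * ∑ i, α i - 1 - ρ) (gammaQuotient_conj δ α β ρ) ?_ ?_
  · obtain ⟨l, a, k₀, k₁, ha, h⟩ := expAsymp_gammaQuotient δ hα β ρ
    have h' := (h c₁ c₂).norm_le_rpow
    simp only [ha, Complex.ofReal_re] at h'
    have e : ∀ σ : ℝ, -δ * ∑ i, α i - 1 - ρ + (2 * ∑ i, α i) * σ = (2 * σ - δ) * ∑ i, α i - 1 - ρ := fun σ => by ring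
    simp only [e] at h'
    exact h'
  · obtain ⟨l, a, k₀, k₁, ha, h⟩ := expAsymp_gammaQuotient δ hα (fun i => starRingEnd ℂ (β i)) ρ
    have h' := (h c₁ c₂).norm_le_rpow
    simp only [ha, Complex.ofReal_re] at h'
    have e : ∀ σ : ℝ, -δ * ∑ i, α i - 1 - ρ + (2 * ∑ i, α i) * σ = (2 * σ - δ) * ∑ i, α i - 1 - ρ := fun σ => by ring
    simp only [e] at h'
    exact h'

theorem norm_Gamma_div_le (ρ c₁ c₂ : ℝ) : ∃ C t₀ : ℝ, 0 < C ∧ 0 < t₀ ∧ ∀ s : ℂ,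
      s.re ∈ Set.Icc c₁ c₂ → t₀ ≤ |s.im| →
      ‖Complex.Gamma s * (Complex.Gamma (s + ρ + 1))⁻¹‖ ≤ C * |s.im| ^ (-1 - ρ) := by
  have h := (expAsymp_Gamma_div_up ρ c₁ c₂).norm_le_rpow
  have h' : ∃ C t₀ : ℝ, 0 < C ∧ 0 < t₀ ∧ ∀ σ ∈ Set.Icc c₁ c₂, ∀ t, t₀ ≤ t →
      ‖(fun s : ℂ => Complex.Gamma s * (Complex.Gamma (s + ρ + 1))⁻¹) (σ + t * Complex.I)‖ ≤
        C * t ^ (-1 - ρ) := by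
    have e : ∀ σ : ℝ, (-(1 + (ρ : ℂ))).re + (0 : ℂ).re * σ = -1 - ρ := fun σ => by simp; ring
    simp only [e] at h
    exact h
  refine two_sided_bound (f := fun s : ℂ => Complex.Gamma s * (Complex.Gamma (s + ρ + 1))⁻¹)
    (g := fun s : ℂ => Complex.Gamma s * (Complex.Gamma (s + ρ + 1))⁻¹)
    (e := fun _ => -1 - ρ) (fun s => ?_) h' h'
  simp [← Complex.Gamma_conj]

end RieszSum

namespace RieszSum

/-! ### Oscillating integrals -/

/-- The first derivative test. Integrating by parts against 1/(iF') leaves boundary terms of total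
size at most 2/m and the integral of F''/F'². As F'' ≥ 0, the latter is the exact derivative of
-1/F' with a sign, and contributes another 2/m at most. -/
theorem norm_integral_exp_le_of_le_abs_deriv {F F' F'' : ℝ → ℝ} {a b m : ℝ} (hab : a ≤ b)
    (hm : 0 < m) (hF : ∀ t ∈ Set.Icc a b, HasDerivAt F (F' t) t)
    (hF' : ∀ t ∈ Set.Icc a b, HasDerivAt F' (F'' t) t)
    (hc : ContinuousOn F'' (Set.Icc a b)) (h0 : ∀ t ∈ Set.Icc a b, 0 ≤ F'' t)
    (hb : ∀ t ∈ Set.Icc a b, m ≤ |F' t|) :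
    ‖∫ t in a..b, Complex.exp (Complex.I * F t)‖ ≤ 4 / m := by
  have hu : Set.uIcc a b = Set.Icc a b := Set.uIcc_of_le hab
  have hne : ∀ t ∈ Set.Icc a b, F' t ≠ 0 := fun t ht h => by
    have := hb t ht
    rw [h, abs_zero] at this
    linarith
  have hneC : ∀ t ∈ Set.Icc a b, (F' t : ℂ) ≠ 0 := fun t ht => by exact_mod_cast hne t ht
  have cF : ContinuousOn F (Set.Icc a b) := fun t ht => (hF t ht).continuousAt.continuousWithinAt
  have cF' : ContinuousOn F' (Set.Icc a b) := fun t ht => (hF' t ht).continuousAt.continuousWithinAt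
  have cexp : ContinuousOn (fun t => Complex.exp (Complex.I * F t)) (Set.Icc a b) := by
    have : ContinuousOn (fun t => (F t : ℂ)) (Set.Icc a b) :=
      Complex.continuous_ofReal.comp_continuousOn cF
    fun_prop
  have crat : ContinuousOn (fun t => F'' t / F' t ^ 2) (Set.Icc a b) :=
    hc.div (cF'.pow 2) fun t ht => pow_ne_zero 2 (hne t ht)
  have cratC : ContinuousOn (fun t => ((F'' t / F' t ^ 2 : ℝ) : ℂ)) (Set.Icc a b) :=
    Complex.continuous_ofReal.comp_continuousOn crat
  have hinv : ∀ t ∈ Set.Icc a b, ‖(F' t)⁻¹‖ ≤ 1 / m := fun t ht => by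
    rw [norm_inv, Real.norm_eq_abs, ← one_div]
    exact one_div_le_one_div_of_le hm (hb t ht)
  have hder : ∀ t ∈ Set.uIcc a b, HasDerivAt
      (fun t => Complex.exp (Complex.I * F t) * (Complex.I * F' t)⁻¹)
      (Complex.exp (Complex.I * F t) -
        Complex.exp (Complex.I * F t) * (-Complex.I * ((F'' t / F' t ^ 2 : ℝ) : ℂ))) t := by
    intro t ht
    rw [hu] at ht
    have h1 := (((hF t ht).ofReal_comp.const_mul Complex.I).cexp).mul
      (((hF' t ht).ofReal_comp.const_mul Complex.I).inv
        (mul_ne_zero Complex.I_ne_zero (hneC t ht)))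
    refine h1.congr_deriv ?_
    have := hneC t ht
    have hI := Complex.I_ne_zero
    simp only [Pi.inv_apply, mul_pow, Complex.I_sq]
    push_cast
    field_simp
    ring
  have hder2 : ∀ t ∈ Set.uIcc a b, HasDerivAt (fun t => -(F' t)⁻¹) (F'' t / F' t ^ 2) t := by
    intro t ht
    rw [hu] at ht
    exact ((hF' t ht).inv (hne t ht)).neg.congr_deriv (by ring)
  have i1 : IntervalIntegrable (fun t => Complex.exp (Complex.I * F t)) MeasureTheory.volume a b :=
    ContinuousOn.intervalIntegrable (by rwa [hu])
  have i2 : IntervalIntegrable (fun t => Complex.exp (Complex.I * F t) *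
      (-Complex.I * ((F'' t / F' t ^ 2 : ℝ) : ℂ))) MeasureTheory.volume a b :=
    ContinuousOn.intervalIntegrable (by rw [hu]; exact cexp.mul (continuousOn_const.mul cratC))
  have i3 : IntervalIntegrable (fun t => F'' t / F' t ^ 2) MeasureTheory.volume a b :=
    ContinuousOn.intervalIntegrable (by rwa [hu])
  have e1 := intervalIntegral.integral_eq_sub_of_hasDerivAt hder (i1.sub i2)
  rw [intervalIntegral.integral_sub i1 i2] at e1
  have e2 := intervalIntegral.integral_eq_sub_of_hasDerivAt hder2 i3
  have hexp1 : ∀ t, ‖Complex.exp (Complex.I * F t)‖ = 1 := fun t => by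
    rw [mul_comm, Complex.norm_exp_ofReal_mul_I]
  have n1 : ∀ t ∈ Set.Icc a b, ‖Complex.exp (Complex.I * F t) * (Complex.I * F' t)⁻¹‖ ≤ 1 / m := by
    intro t ht
    rw [norm_mul, hexp1, one_mul, mul_inv, norm_mul, norm_inv, Complex.norm_I, inv_one, one_mul,
      ← Complex.ofReal_inv, Complex.norm_real]
    exact hinv t ht
  have n2 : ‖∫ t in a..b, Complex.exp (Complex.I * F t) *
      (-Complex.I * ((F'' t / F' t ^ 2 : ℝ) : ℂ))‖ ≤ 2 / m := by
    have : ‖∫ t in a..b, Complex.exp (Complex.I * F t) *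
      (-Complex.I * ((F'' t / F' t ^ 2 : ℝ) : ℂ))‖ ≤ ∫ t in a..b, F'' t / F' t ^ 2 := by
      refine intervalIntegral.norm_integral_le_of_norm_le hab ?_ i3
      refine Eventually.of_forall fun t ht => ?_
      rw [norm_mul, hexp1, one_mul, norm_mul, norm_neg, Complex.norm_I, one_mul, Complex.norm_real,
        Real.norm_of_nonneg]
      exact div_nonneg (h0 t ⟨ht.1.le, ht.2⟩) (sq_nonneg _)
    refine this.trans ?_
    rw [e2]
    have ha := hinv a (Set.left_mem_Icc.2 hab)
    have hb' := hinv b (Set.right_mem_Icc.2 hab)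
    rw [Real.norm_eq_abs] at ha hb'
    have := neg_abs_le (F' b)⁻¹
    have := le_abs_self (F' a)⁻¹
    have : 2 / m = 1 / m + 1 / m := by ring
    linarith
  have e3 : ∫ t in a..b, Complex.exp (Complex.I * F t) =
      (Complex.exp (Complex.I * F b) * (Complex.I * F' b)⁻¹ -
        Complex.exp (Complex.I * F a) * (Complex.I * F' a)⁻¹) +
      ∫ t in a..b, Complex.exp (Complex.I * F t) *
      (-Complex.I * ((F'' t / F' t ^ 2 : ℝ) : ℂ)) := by rw [← e1]; ring
  rw [e3]
  refine (norm_add_le _ _).trans ((add_le_add (norm_sub_le _ _) n2).trans ?_)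
  have := n1 a (Set.left_mem_Icc.2 hab)
  have := n1 b (Set.right_mem_Icc.2 hab)
  have : 4 / m = 1 / m + 1 / m + 2 / m := by ring
  linarith

/-- The phase `D t log t + l t`. -/
noncomputable def stirlingPhase (D l t : ℝ) : ℝ := D * t * Real.log t + l * t

theorem hasDerivAt_stirlingPhase (D l : ℝ) {t : ℝ} (ht : 0 < t) :
    HasDerivAt (stirlingPhase D l) (D * Real.log t + D + l) t := by
  have h := (((hasDerivAt_id t).const_mul D).mul (Real.hasDerivAt_log ht.ne')).add
    ((hasDerivAt_id t).const_mul l)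
  refine h.congr_deriv ?_
  simp only [id]
  field_simp

theorem continuousOn_exp_stirlingPhase (D l : ℝ) :
    ContinuousOn (fun t : ℝ => Complex.exp (Complex.I * stirlingPhase D l t)) (Set.Ioi 0) := by
  have h1 : ContinuousOn (stirlingPhase D l) (Set.Ioi 0) := fun t ht =>
    (hasDerivAt_stirlingPhase D l ht).continuousAt.continuousWithinAt
  have : ContinuousOn (fun t => (stirlingPhase D l t : ℂ)) (Set.Ioi 0) :=
    Complex.continuous_ofReal.comp_continuousOn h1
  fun_prop

/-- A window of radius √b about the stationary point is estimated trivially. Outside it the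
derivative of the phase is at least D√b/(2b), and the first derivative test applies. The stationary
point moves with l, but the bound does not depend on l; this is what later gives uniformity in y. -/
theorem norm_integral_stirlingPhase_le {D : ℝ} (hD : 0 < D) (l : ℝ) {a b : ℝ} (ha : 1 ≤ a)
    (hab : a ≤ b) :
    ‖∫ t in a..b, Complex.exp (Complex.I * stirlingPhase D l t)‖ ≤ (16 / D + 2) * √b := by
  have hb1 : 1 ≤ b := ha.trans hab
  have hb0 : 0 < b := by linarith
  set h := √b with hh
  have hh0 : 0 < h := Real.sqrt_pos.2 hb0
  have hhb : h * h = b := Real.mul_self_sqrt hb0.le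
  have hhle : h ≤ b := by
    have : 1 ≤ h := Real.one_le_sqrt.2 hb1
    nlinarith
  -- The zero of the derivative of the phase, which equals D log(t/t₀).
  set t₀ := Real.exp (-(D + l) / D) with ht₀
  have ht₀p : 0 < t₀ := Real.exp_pos _
  have hF' : ∀ t, D * Real.log t + D + l = D * (Real.log t - Real.log t₀) := by
    intro t; rw [ht₀, Real.log_exp]; field_simp; ring
  have cont := continuousOn_exp_stirlingPhase D l
  have int : ∀ x y, 1 ≤ x → 1 ≤ y → IntervalIntegrable
      (fun t : ℝ => Complex.exp (Complex.I * stirlingPhase D l t)) MeasureTheory.volume x y := by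
    intro x y hx hy
    apply ContinuousOn.intervalIntegrable
    apply cont.mono
    intro t ht
    have := (le_min hx hy).trans ht.1
    exact lt_of_lt_of_le one_pos this
  have outer : ∀ x y, a ≤ x → x ≤ y → y ≤ b →
      (y ≤ t₀ - h ∨ t₀ + h ≤ x) →
      ‖∫ t in x..y, Complex.exp (Complex.I * stirlingPhase D l t)‖ ≤ 8 / D * h := by
    intro x y hax hxy hyb hc
    have hm : 0 < D * (h / (2 * b)) := by positivity
    refine (norm_integral_exp_le_of_le_abs_deriv (F := stirlingPhase D l)
      (F' := fun t => D * Real.log t + D + l) (F'' := fun t => D * t⁻¹) hxy hm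
      (fun t ht => hasDerivAt_stirlingPhase D l (by linarith [ht.1]))
      (fun t ht => ?_) ?_ (fun t ht => ?_) (fun t ht => ?_)).trans ?_
    · have : t ≠ 0 := by linarith [ht.1]
      exact (((Real.hasDerivAt_log this).const_mul D).add_const D).add_const l
    · apply ContinuousOn.mul continuousOn_const
      apply continuousOn_id.inv₀
      intro t ht
      simp only [id]; linarith [ht.1]
    · have : 0 < t := by linarith [ht.1]
      positivity
    · have htp : 0 < t := by linarith [ht.1]
      have htb : t ≤ b := ht.2.trans hyb
      rw [hF', abs_mul, abs_of_pos hD]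
      gcongr
      rcases hc with hc | hc
      · rw [abs_sub_comm]
        refine le_trans ?_ (le_abs_self _)
        rw [← Real.log_div ht₀p.ne' htp.ne']
        have hge : (t + h) / t ≤ t₀ / t := by gcongr; linarith [ht.2]
        have hpos : 0 < (t + h) / t := by positivity
        refine le_trans ?_ (Real.log_le_log hpos hge)
        have := Real.one_sub_inv_le_log_of_pos hpos
        refine le_trans ?_ this
        rw [inv_div, show 1 - t / (t + h) = h / (t + h) by field_simp; ring]
        gcongr; linarith
      · refine le_trans ?_ (le_abs_self _)
        rw [← Real.log_div htp.ne' ht₀p.ne']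
        have hpos : 0 < t / t₀ := by positivity
        refine le_trans ?_ (Real.one_sub_inv_le_log_of_pos hpos)
        rw [inv_div, show 1 - t₀ / t = (t - t₀) / t by field_simp]
        have : h ≤ t - t₀ := by linarith [ht.1]
        gcongr
        all_goals linarith
    · apply le_of_eq
      rw [← hhb]; field_simp; norm_num
  have triv : ∀ x y, 1 ≤ x → x ≤ y → ‖∫ t in x..y,
      Complex.exp (Complex.I * stirlingPhase D l t)‖ ≤ y - x := by
    intro x y _ hxy
    have := intervalIntegral.norm_integral_le_of_norm_le_const (a := x) (b := y) (C := 1)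
      (f := fun t : ℝ => Complex.exp (Complex.I * stirlingPhase D l t)) (fun t _ => by
        rw [mul_comm, Complex.norm_exp_ofReal_mul_I])
    rwa [one_mul, abs_of_nonneg (by linarith)] at this
  -- The ends of the window about t₀, clamped to [a, b]; the window or an outer piece may degenerate
  -- to a point.
  set u := max a (min b (t₀ - h)) with hu
  set v := max a (min b (t₀ + h)) with hv
  have hau : a ≤ u := le_max_left _ _
  have huv : u ≤ v := max_le_max le_rfl (min_le_min le_rfl (by linarith))
  have hvb : v ≤ b := max_le hab (min_le_left _ _)
  have B1 : ‖∫ t in a..u, Complex.exp (Complex.I * stirlingPhase D l t)‖ ≤ 8 / D * h := by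
    rcases le_total a (min b (t₀ - h)) with hc | hc
    · have : u = min b (t₀ - h) := max_eq_right hc
      exact outer a u le_rfl hau (huv.trans hvb) (Or.inl (this ▸ min_le_right _ _))
    · have : u = a := max_eq_left hc
      rw [this, intervalIntegral.integral_same, norm_zero]
      positivity
  have B2 : ‖∫ t in v..b, Complex.exp (Complex.I * stirlingPhase D l t)‖ ≤ 8 / D * h := by
    rcases le_total b (t₀ + h) with hc | hc
    · have : v = b := by rw [hv, min_eq_left hc, max_eq_right hab]
      rw [this, intervalIntegral.integral_same, norm_zero]
      positivity
    · have : t₀ + h ≤ v := by rw [hv, min_eq_right hc]; exact le_max_right _ _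
      exact outer v b (hau.trans huv) hvb le_rfl (Or.inr this)
  have B3 : ‖∫ t in u..v, Complex.exp (Complex.I * stirlingPhase D l t)‖ ≤ 2 * h := by
    refine (triv u v (ha.trans hau) huv).trans ?_
    have h1 : v ≤ max a (min b (t₀ - h)) + 2 * h := by
      apply max_le
      · linarith [le_max_left a (min b (t₀ - h))]
      · have h2 := le_max_right a (min b (t₀ - h))
        have h3 : min b (t₀ + h) ≤ min b (t₀ - h) + 2 * h := by
          rw [← min_add_add_right]
          apply min_le_min <;> linarith
        linarith
    linarith
  have split : ∫ t in a..b, Complex.exp (Complex.I * stirlingPhase D l t) =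
      (∫ t in a..u, Complex.exp (Complex.I * stirlingPhase D l t)) +
      (∫ t in u..v, Complex.exp (Complex.I * stirlingPhase D l t)) +
      ∫ t in v..b, Complex.exp (Complex.I * stirlingPhase D l t) := by
    have hu1 := ha.trans hau
    have hv1 := hu1.trans huv
    rw [intervalIntegral.integral_add_adjacent_intervals (int a u ha hu1) (int u v hu1 hv1),
      intervalIntegral.integral_add_adjacent_intervals (int a v ha hv1) (int v b hv1 hb1)]
  rw [split]
  refine (norm_add_le _ _).trans ((add_le_add (norm_add_le _ _) le_rfl).trans ?_)
  have : (16 / D + 2) * h = 8 / D * h + 2 * h + 8 / D * h := by ring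
  linarith

theorem integral_rpow_le {κ T X : ℝ} (hκ : κ < -1) (hT : 1 ≤ T) (hTX : T ≤ X) :
    ∫ t in T..X, t ^ κ ≤ 1 / (-1 - κ) := by
  rw [integral_rpow (Or.inr ⟨hκ.ne, fun h => by
    rw [Set.uIcc_of_le hTX] at h; linarith [h.1]⟩)]
  rw [show (X ^ (κ + 1) - T ^ (κ + 1)) / (κ + 1) = (T ^ (κ + 1) - X ^ (κ + 1)) / (-1 - κ) by
    rw [← neg_div_neg_eq]; congr 1 <;> ring]
  have : 0 < -1 - κ := by linarith
  gcongr
  have h1 : T ^ (κ + 1) ≤ 1 := Real.rpow_le_one_of_one_le_of_nonpos hT (by linarith)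
  have h2 : 0 ≤ X ^ (κ + 1) := Real.rpow_nonneg (by linarith) _
  linarith

/-- Integrate by parts against the primitive of the oscillating factor, which is O(√x). The
condition Re z < -1/2 makes the boundary term bounded and the remaining integrand, of size t^{Re z -
1/2}, absolutely integrable. Absolute convergence of the original integral would require Re z < -1.
-/
theorem exists_norm_integral_cpow_mul_stirlingPhase_le {D : ℝ} (hD : 0 < D) {z : ℂ}
    (hz : z.re < -1 / 2) : ∃ C : ℝ, 0 ≤ C ∧ ∀ l T X : ℝ, 1 ≤ T → T ≤ X →
      ‖∫ t in T..X, (t : ℂ) ^ z * Complex.exp (Complex.I * stirlingPhase D l t)‖ ≤ C := by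
  set A := 16 / D + 2 with hA
  have hA0 : 0 < A := by positivity
  refine ⟨A + ‖z‖ * A * (1 / (-1 - (z.re - 1 / 2))), ?_, fun l T X hT hTX => ?_⟩
  · have : 0 < -1 - (z.re - 1 / 2) := by linarith
    positivity
  have hu : Set.uIcc T X = Set.Icc T X := Set.uIcc_of_le hTX
  set g := fun t : ℝ => Complex.exp (Complex.I * stirlingPhase D l t) with hg
  have gc := continuousOn_exp_stirlingPhase D l
  set G := fun x : ℝ => ∫ t in T..x, g t with hG
  have gint : ∀ x, T ≤ x → IntervalIntegrable g MeasureTheory.volume T x := fun x hx =>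
    (gc.mono (fun t ht => by
      rw [Set.uIcc_of_le hx] at ht; exact lt_of_lt_of_le one_pos (hT.trans ht.1))).intervalIntegrable
  have hGd : ∀ x ∈ Set.uIcc T X, HasDerivAt G (g x) x := by
    intro x hx
    rw [hu] at hx
    have hx0 : x ∈ Set.Ioi (0 : ℝ) := lt_of_lt_of_le one_pos (hT.trans hx.1)
    refine intervalIntegral.integral_hasDerivAt_right (gint x hx.1) ?_
      (gc.continuousAt (Ioi_mem_nhds hx0))
    exact gc.stronglyMeasurableAtFilter isOpen_Ioi x hx0
  have hud : ∀ x ∈ Set.uIcc T X, HasDerivAt (fun t : ℝ => (t : ℂ) ^ z)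
      (z * (x : ℂ) ^ (z - 1)) x := by
    intro x hx
    rw [hu] at hx
    have hx0 : 0 < x := by linarith [hx.1]
    have := (hasDerivAt_id (x : ℂ)).cpow_const (c := z) (Or.inl (by simpa using hx0))
    simpa using this.comp_ofReal
  have hpc : ContinuousOn (fun t : ℝ => z * (t : ℂ) ^ (z - 1)) (Set.uIcc T X) := by
    rw [hu]
    apply ContinuousOn.mul continuousOn_const
    apply ContinuousOn.cpow_const
    · exact Complex.continuous_ofReal.continuousOn
    · intro t ht; simp only [Complex.ofReal_mem_slitPlane]; linarith [ht.1]
  have ibp := intervalIntegral.integral_mul_deriv_eq_deriv_mul hud hGd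
    hpc.intervalIntegrable (gint X hTX)
  have hGb : ∀ x, T ≤ x → ‖G x‖ ≤ A * √x := fun x hx =>
    norm_integral_stirlingPhase_le hD l hT hx
  have hGT : G T = 0 := intervalIntegral.integral_same
  change ‖∫ t in T..X, (t : ℂ) ^ z * g t‖ ≤ _
  rw [ibp, hGT, mul_zero, sub_zero]
  have hX0 : 0 < X := by linarith
  have n1 : ‖(X : ℂ) ^ z * G X‖ ≤ A := by
    rw [norm_mul, Complex.norm_cpow_eq_rpow_re_of_pos hX0]
    calc X ^ z.re * ‖G X‖ ≤ X ^ z.re * (A * √X) := by gcongr; exact hGb X hTX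
      _ = A * X ^ (z.re + 1 / 2) := by
        rw [Real.sqrt_eq_rpow, Real.rpow_add hX0]; ring
      _ ≤ A * 1 := by
        gcongr
        exact Real.rpow_le_one_of_one_le_of_nonpos (hT.trans hTX) (by linarith)
      _ = A := mul_one A
  have n2 : ‖∫ t in T..X, z * (t : ℂ) ^ (z - 1) * G t‖ ≤
      ‖z‖ * A * (1 / (-1 - (z.re - 1 / 2))) := by
    have hi : IntervalIntegrable (fun t : ℝ => ‖z‖ * A * t ^ (z.re - 1 / 2))
        MeasureTheory.volume T X := by
      apply ContinuousOn.intervalIntegrable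
      rw [hu]
      apply ContinuousOn.mul continuousOn_const
      intro t ht
      exact (Real.continuousAt_rpow_const t _
        (Or.inl (by linarith [ht.1]))).continuousWithinAt
    refine (intervalIntegral.norm_integral_le_of_norm_le hTX
      (Eventually.of_forall fun t ht => ?_) hi).trans ?_
    · have ht0 : 0 < t := by linarith [ht.1]
      rw [norm_mul, norm_mul, Complex.norm_cpow_eq_rpow_re_of_pos ht0]
      calc ‖z‖ * t ^ (z - 1).re * ‖G t‖ ≤ ‖z‖ * t ^ (z - 1).re * (A * √t) := by
            gcongr; exact hGb t ht.1.le
        _ = ‖z‖ * A * (t ^ (z - 1).re * t ^ (1 / 2 : ℝ)) := by rw [Real.sqrt_eq_rpow]; ring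
        _ = _ := by
          rw [← Real.rpow_add ht0]; congr 2; simp; ring
    · rw [intervalIntegral.integral_const_mul]
      gcongr
      exact integral_rpow_le (by linarith) hT hTX
  exact (norm_sub_le _ _).trans (add_le_add n1 n2)

/-! ### The Gamma quotient off its poles -/

/-- Since 1/Γ is entire, only the Gamma functions in the numerator can produce poles. -/
theorem differentiableAt_gammaQuotient {r : ℕ} {δ : ℝ} {α : Fin r → ℝ} {β : Fin r → ℂ} {ρ : ℝ}
    {s : ℂ} (h1 : ∀ k : ℕ, (δ : ℂ) - s ≠ -k)
    (h2 : IsRegularPoint α (fun i => starRingEnd ℂ (β i)) s) :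
    DifferentiableAt ℂ (gammaQuotient δ α β ρ) s := by
  have : gammaQuotient δ α β ρ = fun s => Complex.Gamma (δ - s) *
      (Complex.Gamma (1 + δ - s + ρ))⁻¹ * ((∏ i, Complex.Gamma (α i * s + starRingEnd ℂ (β i))) *
        ∏ i, (Complex.Gamma (α i * (δ - s) + β i))⁻¹) := by
    funext s
    rw [gammaQuotient_eq, factorRatio, gammaFactor, gammaFactor, Finset.prod_inv_distrib]
  rw [this]
  have hΓinv : ∀ g : ℂ → ℂ, DifferentiableAt ℂ g s →
      DifferentiableAt ℂ (fun s => (Complex.Gamma (g s))⁻¹) s := fun g hg =>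
    (Complex.differentiable_one_div_Gamma (g s)).comp s hg
  refine ((DifferentiableAt.mul ?_ (hΓinv _ (by fun_prop)))).mul (DifferentiableAt.mul ?_ ?_)
  · exact (Complex.differentiableAt_Gamma _ h1).comp s (by fun_prop)
  · apply DifferentiableAt.fun_finsetProd
    intro i _
    exact (Complex.differentiableAt_Gamma _ (h2 i)).comp s (by fun_prop)
  · apply DifferentiableAt.fun_finsetProd
    intro i _
    exact hΓinv _ (by fun_prop)

/-- The height `|Im s|` of `s` exceeds that of all poles of the Gamma quotient. -/
def AbovePoles {r : ℕ} (α : Fin r → ℝ) (β : Fin r → ℂ) (t : ℝ) : Prop :=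
  0 < t ∧ ∀ i, |(β i).im| / α i < t

theorem AbovePoles.mono {r : ℕ} {α : Fin r → ℝ} {β : Fin r → ℂ} {t t' : ℝ}
    (h : AbovePoles α β t) (htt' : t ≤ t') : AbovePoles α β t' :=
  ⟨h.1.trans_le htt', fun i => (h.2 i).trans_le htt'⟩

theorem exists_abovePoles {r : ℕ} (α : Fin r → ℝ) (β : Fin r → ℂ) :
    ∃ t, AbovePoles α β t := by
  obtain ⟨B, hB⟩ := (Set.finite_range fun i => |(β i).im| / α i).bddAbove
  refine ⟨max 0 B + 1, by positivity, fun i => ?_⟩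
  have := hB (Set.mem_range_self i)
  have := le_max_right 0 B
  linarith

theorem differentiableAt_gammaQuotient_of_abovePoles {r : ℕ} {δ : ℝ} {α : Fin r → ℝ}
    (hα : ∀ i, 0 < α i) {β : Fin r → ℂ} (ρ : ℝ) {s : ℂ} (h : AbovePoles α β |s.im|) :
    DifferentiableAt ℂ (gammaQuotient δ α β ρ) s := by
  apply differentiableAt_gammaQuotient
  · intro k hk
    have := congrArg Complex.im hk
    simp at this
    exact absurd this (abs_pos.1 h.1)
  · intro i k hk
    have := congrArg Complex.im hk
    simp at this
    have h2 := h.2 i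
    have h3 : (β i).im = α i * s.im := by linarith
    rw [h3, abs_mul, abs_of_pos (hα i), mul_div_cancel_left₀ _ (hα i).ne'] at h2
    exact lt_irrefl _ h2

theorem differentiableAt_integrand_of {r : ℕ} {δ : ℝ} {α : Fin r → ℝ} {β : Fin r → ℂ}
    {ρ y : ℝ} (hy : 0 < y) {s : ℂ} (h : DifferentiableAt ℂ (gammaQuotient δ α β ρ) s) :
    DifferentiableAt ℂ (integrand δ α β ρ y) s := by
  apply DifferentiableAt.mul h
  apply DifferentiableAt.const_cpow (by fun_prop)
  left; exact_mod_cast hy.ne'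

theorem norm_integrand {r : ℕ} {δ : ℝ} {α : Fin r → ℝ} {β : Fin r → ℂ}
    {ρ y : ℝ} (hy : 0 < y) (s : ℂ) :
    ‖integrand δ α β ρ y s‖ = ‖gammaQuotient δ α β ρ s‖ * y ^ (-s.re) := by
  rw [integrand, norm_mul, Complex.norm_cpow_eq_rpow_re_of_pos hy, Complex.neg_re]

/-- The Stirling main term is t^z times the phase 2d t log t + lt with Re z = (2σ-δ)d - 1 - ρ <
-1/2, so the oscillatory bound covers it. The relative error O(1/t) leaves an absolutely integrable
remainder. The constant depends neither on y nor on the endpoints. -/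
theorem exists_norm_integral_integrand_le {r : ℕ} (δ : ℝ) {α : Fin r → ℝ} (hα : ∀ i, 0 < α i)
    (hd : 0 < ∑ i, α i) (β : Fin r → ℂ) (ρ : ℝ) {σ : ℝ}
    (hσ : (2 * σ - δ) * ∑ i, α i - 1 / 2 < ρ) :
    ∃ C t₀ : ℝ, 0 ≤ C ∧ AbovePoles α β t₀ ∧ ∀ y T X : ℝ, 0 < y → t₀ ≤ T → T ≤ X →
      ‖∫ t in T..X, integrand δ α β ρ y (σ + t * Complex.I)‖ ≤ C * y ^ (-σ) := by
  obtain ⟨l, a, k₀, k₁, ha, h⟩ := expAsymp_gammaQuotient δ hα β ρ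
  obtain ⟨c, C, t₀, hC, ht₀, h⟩ := (h σ σ).exists_norm_sub_le
  obtain ⟨t₁, ht₁⟩ := exists_abovePoles α β
  set d := ∑ i, α i
  set z : ℂ := a + ((2 * d : ℝ) : ℂ) * σ with hz
  have hzre : z.re = (2 * σ - δ) * d - 1 - ρ := by simp [hz, ha]; ring
  obtain ⟨B, hB0, hB⟩ := exists_norm_integral_cpow_mul_stirlingPhase_le (D := 2 * d)
    (by positivity) (z := z) (by rw [hzre]; linarith)
  set e₀ : ℂ := Complex.exp (k₀ + k₁ * σ) with he₀
  have hmain : ∀ t : ℝ, 0 < t → Complex.exp (lineExp (2 * d) l a ((2 * d : ℝ) : ℂ) k₀ k₁ σ t) =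
      e₀ * ((t : ℂ) ^ z * Complex.exp (Complex.I * stirlingPhase (2 * d) l t)) := by
    intro t ht
    rw [he₀, Complex.cpow_def_of_ne_zero (by exact_mod_cast ht.ne'), ← Complex.exp_add,
      ← Complex.exp_add, ← Complex.ofReal_log ht.le, lineExp, stirlingPhase, hz]
    congr 1
    push_cast
    ring
  refine ⟨‖c * e₀‖ * B + C * ‖e₀‖ * (1 / (-1 - (z.re - 1))), max 1 (max t₀ t₁), ?_,
    ht₁.mono ((le_max_right _ _).trans (le_max_right _ _)), fun y T X hy hT hTX => ?_⟩
  · have : 0 < -1 - (z.re - 1) := by linarith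
    positivity
  simp only [max_le_iff] at hT
  obtain ⟨hT1, hT2, hT3⟩ := hT
  have hu : Set.uIcc T X = Set.Icc T X := Set.uIcc_of_le hTX
  have hyC : (y : ℂ) ≠ 0 := by exact_mod_cast hy.ne'
  have hyp : ∀ t : ℝ, (y : ℂ) ^ (-((σ : ℂ) + t * Complex.I)) =
      ((y ^ (-σ) : ℝ) : ℂ) * Complex.exp (Complex.I * (-Real.log y * t)) := by
    intro t
    rw [Complex.cpow_def_of_ne_zero hyC, ← Complex.ofReal_log hy.le, Real.rpow_def_of_pos hy]
    push_cast
    rw [← Complex.exp_add]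
    congr 1; ring
  set m := fun t : ℝ => ((y ^ (-σ) : ℝ) : ℂ) * (c * e₀) *
    ((t : ℂ) ^ z * Complex.exp (Complex.I * stirlingPhase (2 * d) (l - Real.log y) t)) with hm
  -- The oscillation of y^{-it} is absorbed into the linear part of the phase, on which the bound B
  -- does not depend.
  have hphase : ∀ t : ℝ, Complex.exp (Complex.I * stirlingPhase (2 * d) l t) *
      Complex.exp (Complex.I * (-Real.log y * t)) =
      Complex.exp (Complex.I * stirlingPhase (2 * d) (l - Real.log y) t) := by
    intro t
    rw [← Complex.exp_add]
    congr 1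
    simp only [stirlingPhase]; push_cast; ring
  have hyn : ∀ t : ℝ, ‖Complex.exp (Complex.I * (-Real.log y * t))‖ = 1 := by
    intro t
    have : Complex.I * (-Real.log y * t) = ((-Real.log y * t : ℝ) : ℂ) * Complex.I := by
      push_cast; ring
    rw [this, Complex.norm_exp_ofReal_mul_I]
  have herr : ∀ t ∈ Set.Icc T X, ‖integrand δ α β ρ y (σ + t * Complex.I) - m t‖ ≤
      y ^ (-σ) * (C * ‖e₀‖) * t ^ (z.re - 1) := by
    intro t ht
    have htp : 0 < t := by linarith [ht.1]
    have h1 := h σ ⟨le_rfl, le_rfl⟩ t (hT2.trans ht.1)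
    have : integrand δ α β ρ y (σ + t * Complex.I) - m t =
        (gammaQuotient δ α β ρ (σ + t * Complex.I) -
          c * Complex.exp (lineExp (2 * d) l a ((2 * d : ℝ) : ℂ) k₀ k₁ σ t)) *
        (((y ^ (-σ) : ℝ) : ℂ) * Complex.exp (Complex.I * (-Real.log y * t))) := by
      rw [hmain t htp, integrand, hyp, hm]
      simp only
      rw [← hphase]
      ring
    rw [this, norm_mul, norm_mul, hyn, mul_one, Complex.norm_real,
      Real.norm_of_nonneg (Real.rpow_nonneg hy.le _)]
    have h3 : Real.exp (lineExp (2 * d) l a ((2 * d : ℝ) : ℂ) k₀ k₁ σ t).re = ‖e₀‖ * t ^ z.re := by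
      rw [← Complex.norm_exp, hmain t htp, norm_mul, norm_mul,
        Complex.norm_cpow_eq_rpow_re_of_pos htp, mul_comm Complex.I, Complex.norm_exp_ofReal_mul_I,
        mul_one]
    rw [h3] at h1
    calc _ ≤ C / t * (‖e₀‖ * t ^ z.re) * y ^ (-σ) := by gcongr
      _ = _ := by
        rw [Real.rpow_sub htp, Real.rpow_one]; ring
  have hmc : ContinuousOn m (Set.uIcc T X) := by
    rw [hu]
    apply ContinuousOn.mul continuousOn_const
    apply ContinuousOn.mul
    · apply ContinuousOn.cpow_const
      · exact Complex.continuous_ofReal.continuousOn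
      · intro t ht; simp only [Complex.ofReal_mem_slitPlane]; linarith [ht.1]
    · exact (continuousOn_exp_stirlingPhase _ _).mono fun t ht => by
        have := ht.1
        simp only [Set.mem_Ioi]; linarith
  have hfc : ContinuousOn (fun t : ℝ => integrand δ α β ρ y (σ + t * Complex.I))
      (Set.uIcc T X) := by
    rw [hu]
    intro t ht
    have ht' : AbovePoles α β |((σ : ℂ) + t * Complex.I).im| := by
      apply ht₁.mono
      simp only [Complex.add_im, Complex.ofReal_im, Complex.mul_im, Complex.ofReal_re,
        Complex.I_im, mul_one, Complex.I_re, mul_zero, add_zero, zero_add]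
      exact (hT3.trans ht.1).trans (le_abs_self t)
    have h1 := (differentiableAt_integrand_of hy
      (differentiableAt_gammaQuotient_of_abovePoles (δ := δ) hα ρ ht')).continuousAt
    have h2 : ContinuousAt (fun t : ℝ => (σ : ℂ) + t * Complex.I) t := by fun_prop
    exact (ContinuousAt.comp (f := fun t : ℝ => (σ : ℂ) + t * Complex.I) h1 h2).continuousWithinAt
  have split : ∫ t in T..X, integrand δ α β ρ y (σ + t * Complex.I) =
      (∫ t in T..X, (integrand δ α β ρ y (σ + t * Complex.I) - m t)) + ∫ t in T..X, m t := by
    rw [intervalIntegral.integral_sub hfc.intervalIntegrable hmc.intervalIntegrable]; ring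
  have n1 : ‖∫ t in T..X, (integrand δ α β ρ y (σ + t * Complex.I) - m t)‖ ≤
      y ^ (-σ) * (C * ‖e₀‖) * (1 / (-1 - (z.re - 1))) := by
    refine (intervalIntegral.norm_integral_le_of_norm_le hTX (Eventually.of_forall fun t ht =>
      herr t ⟨ht.1.le, ht.2⟩) ?_).trans ?_
    · apply ContinuousOn.intervalIntegrable
      rw [hu]
      apply ContinuousOn.mul continuousOn_const
      intro t ht
      exact (Real.continuousAt_rpow_const t _
        (Or.inl (by linarith [ht.1]))).continuousWithinAt
    · rw [intervalIntegral.integral_const_mul]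
      have : 0 ≤ y ^ (-σ) := Real.rpow_nonneg hy.le _
      gcongr
      exact integral_rpow_le (by linarith) hT1 hTX
  have n2 : ‖∫ t in T..X, m t‖ ≤ y ^ (-σ) * (‖c * e₀‖ * B) := by
    rw [hm, intervalIntegral.integral_const_mul, norm_mul, norm_mul, Complex.norm_real,
      Real.norm_of_nonneg (Real.rpow_nonneg hy.le _), mul_assoc]
    have : 0 ≤ y ^ (-σ) := Real.rpow_nonneg hy.le _
    gcongr
    exact hB _ T X hT1 hTX
  rw [split]
  refine (norm_add_le _ _).trans ((add_le_add n1 n2).trans (le_of_eq ?_))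
  ring

end RieszSum

namespace RieszSum

/-! ### The bent contours -/

/-- The part of `2πi · bentIntegral f p c T` above the height `T`. -/
noncomputable def upperTail (f : ℂ → ℂ) (p c T : ℝ) : ℂ :=
  Complex.I * (∫ t in Set.Ioi T, f (c + t * Complex.I)) - ∫ u in c..p, f (u + T * Complex.I)

theorem abovePoles_conj {r : ℕ} {α : Fin r → ℝ} {β : Fin r → ℂ} {T : ℝ} (h : AbovePoles α β T) :
    AbovePoles α (fun i => starRingEnd ℂ (β i)) T :=
  ⟨h.1, fun i => by simpa using h.2 i⟩

theorem integrand_conj {r : ℕ} (δ : ℝ) (α : Fin r → ℝ) (β : Fin r → ℂ) (ρ : ℝ) {y : ℝ}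
    (hy : 0 < y) (s : ℂ) : integrand δ α β ρ y (starRingEnd ℂ s) =
      starRingEnd ℂ (integrand δ α (fun i => starRingEnd ℂ (β i)) ρ y s) := by
  rw [integrand, integrand, map_mul, gammaQuotient_conj]
  congr 1
  · simp
  · rw [← map_neg, Complex.cpow_conj, Complex.conj_ofReal]
    rw [Complex.arg_ofReal_of_nonneg hy.le]
    exact Real.pi_pos.ne

/-- The lower end of the contour is the mirror image of the upper end for the conjugate parameters,
so only upper tails need to be studied. -/
theorem bentIntegral_eq {r : ℕ} (δ : ℝ) (α : Fin r → ℝ) (β : Fin r → ℂ) (ρ : ℝ) {y : ℝ}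
    (hy : 0 < y) (p c T : ℝ) :
    bentIntegral (integrand δ α β ρ y) p c T = (2 * (Real.pi : ℂ) * Complex.I)⁻¹ *
      (Complex.I * (∫ t in (-T)..T, integrand δ α β ρ y (p + t * Complex.I)) +
        upperTail (integrand δ α β ρ y) p c T -
        starRingEnd ℂ (upperTail (integrand δ α (fun i => starRingEnd ℂ (β i)) ρ y) p c T)) := by
  have h1 : starRingEnd ℂ (∫ t in Set.Ioi T,
      integrand δ α (fun i => starRingEnd ℂ (β i)) ρ y (c + t * Complex.I)) =
      ∫ t in Set.Iic (-T), integrand δ α β ρ y (c + t * Complex.I) := by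
    rw [← integral_conj, ← neg_neg T, ← integral_comp_neg_Iic, neg_neg]
    congr 1
    funext t
    rw [← integrand_conj δ α β ρ hy]
    simp
  have h2 : starRingEnd ℂ (∫ u in c..p,
      integrand δ α (fun i => starRingEnd ℂ (β i)) ρ y (u + T * Complex.I)) =
      ∫ u in c..p, integrand δ α β ρ y (u - T * Complex.I) := by
    simp only [intervalIntegral, map_sub, ← integral_conj]
    simp only [← integrand_conj δ α β ρ hy]
    simp [sub_eq_add_neg]
  rw [bentIntegral, upperTail, upperTail, map_sub, map_mul, h1, h2, Complex.conj_I]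
  ring

section

variable {r : ℕ} {δ : ℝ} {α : Fin r → ℝ} {β : Fin r → ℂ} {ρ y : ℝ}

theorem continuousAt_integrand_line (hα : ∀ i, 0 < α i) (hy : 0 < y) (c : ℝ) {t : ℝ}
    (ht : AbovePoles α β t) :
    ContinuousAt (fun t : ℝ => integrand δ α β ρ y (c + t * Complex.I)) t := by
  have ht' : AbovePoles α β |((c : ℂ) + t * Complex.I).im| := by
    apply ht.mono
    simpa using le_abs_self t
  have h1 := (differentiableAt_integrand_of hy
    (differentiableAt_gammaQuotient_of_abovePoles (δ := δ) hα ρ ht')).continuousAt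
  have h2 : ContinuousAt (fun t : ℝ => (c : ℂ) + t * Complex.I) t := by fun_prop
  exact ContinuousAt.comp (f := fun t : ℝ => (c : ℂ) + t * Complex.I) h1 h2

theorem continuous_integrand_horizontal (hα : ∀ i, 0 < α i) (hy : 0 < y) {T : ℝ}
    (hT : AbovePoles α β T) :
    Continuous (fun u : ℝ => integrand δ α β ρ y (u + T * Complex.I)) := by
  rw [continuous_iff_continuousAt]
  intro u
  have ht' : AbovePoles α β |((u : ℂ) + T * Complex.I).im| := by
    apply hT.mono
    simpa using le_abs_self T
  have h1 := (differentiableAt_integrand_of hy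
    (differentiableAt_gammaQuotient_of_abovePoles (δ := δ) hα ρ ht')).continuousAt
  have h2 : ContinuousAt (fun u : ℝ => (u : ℂ) + T * Complex.I) u := by fun_prop
  exact ContinuousAt.comp (f := fun u : ℝ => (u : ℂ) + T * Complex.I) h1 h2

theorem integrableOn_gammaQuotient_line (hα : ∀ i, 0 < α i) {c T : ℝ}
    (hc : (2 * c - δ) * ∑ i, α i < ρ) (hT : AbovePoles α β T) :
    MeasureTheory.IntegrableOn (fun t : ℝ => gammaQuotient δ α β ρ (c + t * Complex.I))
      (Set.Ioi T) := by
  obtain ⟨C, t₀, hC, ht₀, h⟩ := norm_gammaQuotient_le δ hα β ρ c c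
  have hcont : ContinuousOn (fun t : ℝ => gammaQuotient δ α β ρ (c + t * Complex.I))
      (Set.Ici T) := fun t ht => by
    have := continuousAt_integrand_line (δ := δ) (ρ := ρ) hα one_pos c (hT.mono ht)
    simp only [integrand, Complex.ofReal_one, Complex.one_cpow, mul_one] at this
    exact this.continuousWithinAt
  refine MeasureTheory.IntegrableOn.mono_set ?_ Set.Ioi_subset_Ici_self
  refine (hcont.locallyIntegrableOn measurableSet_Ici).integrableOn_of_isBigO_atTop
    (g := fun t : ℝ => t ^ ((2 * c - δ) * ∑ i, α i - 1 - ρ)) ?_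
    (integrableAtFilter_rpow_atTop_iff.2 (by linarith))
  apply Asymptotics.IsBigO.of_bound C
  filter_upwards [eventually_ge_atTop t₀] with t ht
  have htp : 0 < t := ht₀.trans_le ht
  have := h (c + t * Complex.I) (by simp) (by simpa [abs_of_pos htp] using ht)
  rw [Real.norm_of_nonneg (Real.rpow_nonneg htp.le _)]
  simpa [abs_of_pos htp] using this

theorem aestronglyMeasurable_cpow_line {y : ℝ} (hy : 0 < y) (c : ℝ) :
    Continuous (fun t : ℝ => (y : ℂ) ^ (-((c : ℂ) + t * Complex.I))) := by
  apply Continuous.const_cpow (by fun_prop)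
  left; exact_mod_cast hy.ne'

theorem integrableOn_integrand_line (hα : ∀ i, 0 < α i) (hy : 0 < y) {c T : ℝ}
    (hc : (2 * c - δ) * ∑ i, α i < ρ) (hT : AbovePoles α β T) :
    MeasureTheory.IntegrableOn (fun t : ℝ => integrand δ α β ρ y (c + t * Complex.I))
      (Set.Ioi T) := by
  refine (integrableOn_gammaQuotient_line hα hc hT).mul_bdd (c := y ^ (-c)) ?_ ?_
  · exact (aestronglyMeasurable_cpow_line hy c).aestronglyMeasurable
  · refine Eventually.of_forall fun t => ?_
    rw [Complex.norm_cpow_eq_rpow_re_of_pos hy]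
    simp

/-- In the limiting case (2q-δ)d - 1 = ρ the integrand is merely bounded at u = q, and no uniform
decay is available. For each u < q it is O(T^{2(u-q)d}), so dominated convergence gives the limit
off a null set. -/
theorem tendsto_horizontal (hα : ∀ i, 0 < α i) (hd : 0 < ∑ i, α i) (hy : 0 < y) {c q : ℝ}
    (hcq : c ≤ q) (hq : (2 * q - δ) * ∑ i, α i - 1 ≤ ρ) :
    Tendsto (fun T : ℝ => ∫ u in c..q, integrand δ α β ρ y (u + T * Complex.I)) atTop (𝓝 0) := by
  obtain ⟨C, t₀, hC, ht₀, h⟩ := norm_gammaQuotient_le δ hα β ρ c q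
  obtain ⟨t₁, ht₁⟩ := exists_abovePoles α β
  have hyc : Continuous fun u : ℝ => y ^ (-u) :=
    (Real.continuous_const_rpow hy.ne').comp continuous_neg
  have hbd : ∀ T, max 1 t₀ ≤ T → ∀ u ∈ Set.Icc c q,
      ‖integrand δ α β ρ y (u + T * Complex.I)‖ ≤
        C * y ^ (-u) * T ^ (2 * (u - q) * ∑ i, α i) := by
    intro T hT u hu
    simp only [max_le_iff] at hT
    have hTp : 0 < T := by linarith
    have := h (u + T * Complex.I) (by simpa using hu) (by simpa [abs_of_pos hTp] using hT.2)
    rw [norm_integrand hy]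
    simp only [Complex.add_re, Complex.ofReal_re, Complex.mul_re, Complex.I_re, mul_zero,
      Complex.ofReal_im, Complex.I_im, mul_one, sub_self, add_zero, Complex.add_im, Complex.mul_im,
      zero_add, abs_of_pos hTp] at this ⊢
    have h2 : T ^ ((2 * u - δ) * ∑ i, α i - 1 - ρ) ≤ T ^ (2 * (u - q) * ∑ i, α i) :=
      Real.rpow_le_rpow_of_exponent_le hT.1 (by linarith)
    calc _ ≤ C * T ^ (2 * (u - q) * ∑ i, α i) * y ^ (-u) := by
          gcongr
          exact this.trans (by gcongr)
      _ = _ := by ring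
  have := intervalIntegral.tendsto_integral_filter_of_dominated_convergence (μ := MeasureTheory.volume)
    (a := c) (b := q)
    (F := fun (T : ℝ) (u : ℝ) => integrand δ α β ρ y (u + T * Complex.I)) (f := fun _ => 0)
    (l := atTop) (fun u => C * y ^ (-u)) ?_ ?_ ?_ ?_
  · simpa using this
  · filter_upwards [eventually_ge_atTop t₁] with T hT
    exact (continuous_integrand_horizontal hα hy (ht₁.mono hT)).aestronglyMeasurable
  · filter_upwards [eventually_ge_atTop (max 1 t₀)] with T hT
    refine Eventually.of_forall fun u hu => ?_
    rw [Set.uIoc_of_le hcq] at hu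
    refine (hbd T hT u ⟨hu.1.le, hu.2⟩).trans ?_
    have hT1 : 1 ≤ T := (le_max_left _ _).trans hT
    have : T ^ (2 * (u - q) * ∑ i, α i) ≤ 1 :=
      Real.rpow_le_one_of_one_le_of_nonpos hT1 (by nlinarith [hu.2])
    have h0 : 0 ≤ C * y ^ (-u) := by positivity
    nlinarith
  · exact (continuous_const.mul hyc).intervalIntegrable _ _
  · have hne : ∀ᵐ u : ℝ, u ≠ q := by
      simp [MeasureTheory.ae_iff]
    filter_upwards [hne] with u huq hu
    rw [Set.uIoc_of_le hcq] at hu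
    have huq' : u < q := lt_of_le_of_ne hu.2 huq
    have hlim : Tendsto (fun T : ℝ => C * y ^ (-u) * T ^ (2 * (u - q) * ∑ i, α i)) atTop
        (𝓝 0) := by
      have := (tendsto_rpow_neg_atTop (y := 2 * (q - u) * ∑ i, α i) (by
        have : 0 < q - u := by linarith
        positivity)).const_mul (C * y ^ (-u))
      rw [mul_zero] at this
      refine this.congr fun T => ?_
      congr 2; ring
    refine squeeze_zero_norm' ?_ hlim
    filter_upwards [eventually_ge_atTop (max 1 t₀)] with T hT
    exact hbd T hT u ⟨hu.1.le, hu.2⟩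

theorem rectangle_integrand (hα : ∀ i, 0 < α i) (hy : 0 < y) {c q T X : ℝ}
    (hT : AbovePoles α β T) (hTX : T ≤ X) :
    (∫ u in c..q, integrand δ α β ρ y (u + T * Complex.I)) -
      (∫ u in c..q, integrand δ α β ρ y (u + X * Complex.I)) +
      Complex.I * (∫ t in T..X, integrand δ α β ρ y (q + t * Complex.I)) -
      Complex.I * (∫ t in T..X, integrand δ α β ρ y (c + t * Complex.I)) = 0 := by
  have := Complex.integral_boundary_rect_eq_zero_of_differentiableOn (integrand δ α β ρ y)
    ⟨c, T⟩ ⟨q, X⟩ (fun s hs => ?_)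
  · simpa using this
  · have him : s.im ∈ Set.uIcc T X := hs.2
    rw [Set.uIcc_of_le hTX] at him
    exact (differentiableAt_integrand_of hy (differentiableAt_gammaQuotient_of_abovePoles hα ρ
      (hT.mono (him.1.trans (le_abs_self _))))).differentiableWithinAt

/-- Cauchy's theorem for the rectangle between heights T and X, which lies above all poles: bending
the line later exchanges a piece of the line Re s = c for a piece of Re s = p. -/
theorem upperTail_sub (hα : ∀ i, 0 < α i) (hy : 0 < y) {p c T X : ℝ}
    (hc : (2 * c - δ) * ∑ i, α i < ρ) (hT : AbovePoles α β T) (hTX : T ≤ X) :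
    upperTail (integrand δ α β ρ y) p c T = upperTail (integrand δ α β ρ y) p c X +
      Complex.I * ∫ t in T..X, integrand δ α β ρ y (p + t * Complex.I) := by
  have h := rectangle_integrand (δ := δ) (ρ := ρ) (c := c) (q := p) hα hy hT hTX
  have h2 := intervalIntegral.integral_interval_add_Ioi
    (integrableOn_integrand_line (δ := δ) hα hy hc hT)
    (integrableOn_integrand_line (δ := δ) hα hy hc (hT.mono hTX))
  rw [upperTail, upperTail, ← h2]
  linear_combination -h

theorem tendsto_upperTail (hα : ∀ i, 0 < α i) (hd : 0 < ∑ i, α i) (hy : 0 < y) {c q : ℝ}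
    (hcq : c ≤ q) (hc : (2 * c - δ) * ∑ i, α i < ρ) (hq : (2 * q - δ) * ∑ i, α i - 1 ≤ ρ) :
    Tendsto (fun T : ℝ => upperTail (integrand δ α β ρ y) q c T) atTop (𝓝 0) := by
  obtain ⟨t₁, ht₁⟩ := exists_abovePoles α β
  have h1 := tendsto_horizontal (β := β) hα hd hy hcq hq
  have hi := integrableOn_integrand_line (δ := δ) hα hy hc ht₁
  have h2 := MeasureTheory.intervalIntegral_tendsto_integral_Ioi t₁ hi tendsto_id
  have h3 : Tendsto (fun T : ℝ => ∫ t in Set.Ioi T, integrand δ α β ρ y (c + t * Complex.I))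
      atTop (𝓝 0) := by
    have := (h2.const_sub (∫ t in Set.Ioi t₁, integrand δ α β ρ y (c + t * Complex.I)))
    rw [sub_self] at this
    refine this.congr' ?_
    filter_upwards [eventually_ge_atTop t₁] with T hT
    rw [← intervalIntegral.integral_interval_add_Ioi hi
      (integrableOn_integrand_line hα hy hc (ht₁.mono hT))]
    simp
  have := (h3.const_mul Complex.I).sub h1
  simpa [upperTail] using this

/-- Where the line Re s = c already converges absolutely, bending it further to c' changes nothing:
the difference of the contours closes up at infinity. -/
theorem upperTail_left_eq (hα : ∀ i, 0 < α i) (hd : 0 < ∑ i, α i) (hy : 0 < y) {p c c' T : ℝ}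
    (hcc : c' ≤ c) (hc : (2 * c - δ) * ∑ i, α i < ρ) (hT : AbovePoles α β T) :
    upperTail (integrand δ α β ρ y) p c T = upperTail (integrand δ α β ρ y) p c' T := by
  have hc' : (2 * c' - δ) * ∑ i, α i < ρ := by nlinarith
  have key : upperTail (integrand δ α β ρ y) c c' T -
      Complex.I * (∫ t in Set.Ioi T, integrand δ α β ρ y (c + t * Complex.I)) = 0 := by
    have hi := integrableOn_integrand_line (δ := δ) hα hy hc hT
    have h1 := tendsto_upperTail (β := β) hα hd hy hcc hc' (by linarith)
    have h2 := (MeasureTheory.intervalIntegral_tendsto_integral_Ioi T hi tendsto_id).const_mul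
      Complex.I
    have h3 := (h1.add h2).sub_const (Complex.I *
      (∫ t in Set.Ioi T, integrand δ α β ρ y (c + t * Complex.I)))
    rw [zero_add, sub_self] at h3
    refine tendsto_nhds_unique (tendsto_const_nhds.congr' ?_) h3
    filter_upwards [eventually_ge_atTop T] with X hX
    rw [upperTail_sub hα hy hc' hT hX]
    simp
  have hcont := continuous_integrand_horizontal (δ := δ) (ρ := ρ) hα hy hT
  have hadd := intervalIntegral.integral_add_adjacent_intervals
    (hcont.intervalIntegrable (μ := MeasureTheory.volume) c' c) (hcont.intervalIntegrable c p)
  rw [upperTail] at key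
  rw [upperTail, upperTail, ← hadd]
  linear_combination -key

theorem upperTail_right_sub (hα : ∀ i, 0 < α i) (hy : 0 < y) {p q c T : ℝ}
    (hT : AbovePoles α β T) :
    upperTail (integrand δ α β ρ y) p c T = upperTail (integrand δ α β ρ y) q c T -
      ∫ u in q..p, integrand δ α β ρ y (u + T * Complex.I) := by
  have hcont := continuous_integrand_horizontal (δ := δ) (ρ := ρ) hα hy hT
  have hadd := intervalIntegral.integral_add_adjacent_intervals
    (hcont.intervalIntegrable (μ := MeasureTheory.volume) c q) (hcont.intervalIntegrable q p)
  rw [upperTail, upperTail, ← hadd]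
  ring

/-- The upper part of the bent contour, with the sharp exponent. -/
theorem exists_norm_upperTail_le (δ : ℝ) (hα : ∀ i, 0 < α i) (hd : 0 < ∑ i, α i)
    (β : Fin r → ℂ) (ρ : ℝ) {σ : ℝ} (hσ : (2 * σ - δ) * ∑ i, α i - 1 / 2 < ρ) {p : ℝ}
    (hσp : σ ≤ p) {y₀ : ℝ} (hy₀ : 0 < y₀) :
    ∃ t₀, AbovePoles α β t₀ ∧ ∀ T, t₀ ≤ T → ∃ C, 0 ≤ C ∧ ∀ c, c ≤ σ →
      (2 * c - δ) * ∑ i, α i < ρ → ∀ y, y₀ ≤ y →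
        ‖upperTail (integrand δ α β ρ y) p c T‖ ≤ C * y ^ (-σ) := by
  obtain ⟨C, t₀, hC, ht₀, h⟩ := exists_norm_integral_integrand_le δ hα hd β ρ hσ
  refine ⟨t₀, ht₀, fun T hT => ?_⟩
  have hTa := ht₀.mono hT
  have hcont := continuous_integrand_horizontal (δ := δ) (ρ := ρ) hα one_pos hTa
  obtain ⟨B, hB⟩ := (isCompact_Icc (a := σ) (b := p)).exists_bound_of_continuousOn
    hcont.continuousOn
  have hB' : ∀ u ∈ Set.Icc σ p, ‖gammaQuotient δ α β ρ (u + T * Complex.I)‖ ≤ max B 0 := by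
    intro u hu
    have := hB u hu
    simp only [integrand, Complex.ofReal_one, Complex.one_cpow, mul_one] at this
    exact this.trans (le_max_left _ _)
  -- On the horizontal segment, y^{-u} = y^{-σ} y^{σ-u}, and the last factor is largest at y = y₀;
  -- its bound depends on whether y₀ exceeds 1.
  have hE : ∀ u ∈ Set.Icc σ p, y₀ ^ (σ - u) ≤ max 1 (y₀ ^ (σ - p)) := by
    intro u hu
    rcases le_total 1 y₀ with h1 | h1
    · exact (Real.rpow_le_one_of_one_le_of_nonpos h1 (by linarith [hu.1])).trans (le_max_left _ _)
    · exact (Real.rpow_le_rpow_of_exponent_ge hy₀ h1 (by linarith [hu.2])).trans (le_max_right _ _)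
  refine ⟨C + max B 0 * max 1 (y₀ ^ (σ - p)) * |p - σ|, by positivity,
    fun c hcσ hc y hy => ?_⟩
  have hyp : 0 < y := hy₀.trans_le hy
  -- Straighten the tail onto Re s = σ up to height X. The remaining tail vanishes as X → ∞, so the
  -- bound for the oscillating integrals over [T, X], uniform in X, passes to the limit.
  have hU1 : ‖upperTail (integrand δ α β ρ y) σ c T‖ ≤ C * y ^ (-σ) := by
    have hlim := (tendsto_upperTail (β := β) hα hd hyp hcσ hc (by linarith)).norm.add_const
      (C * y ^ (-σ))
    rw [norm_zero, zero_add] at hlim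
    refine ge_of_tendsto hlim ?_
    filter_upwards [eventually_ge_atTop T] with X hX
    rw [upperTail_sub hα hyp hc hTa hX]
    refine (norm_add_le _ _).trans ?_
    rw [norm_mul, Complex.norm_I, one_mul]
    gcongr
    exact h y T X hyp hT hX
  have hU2 : ‖∫ u in σ..p, integrand δ α β ρ y (u + T * Complex.I)‖ ≤
      max B 0 * max 1 (y₀ ^ (σ - p)) * y ^ (-σ) * |p - σ| := by
    refine intervalIntegral.norm_integral_le_of_norm_le_const fun u hu => ?_
    rw [Set.uIoc_of_le hσp] at hu
    have hu' : u ∈ Set.Icc σ p := ⟨hu.1.le, hu.2⟩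
    rw [norm_integrand hyp]
    have hre : (-((u : ℂ) + T * Complex.I).re) = -σ + (σ - u) := by simp; ring
    rw [hre, Real.rpow_add hyp]
    have h3 : y ^ (σ - u) ≤ y₀ ^ (σ - u) :=
      Real.rpow_le_rpow_of_nonpos hy₀ hy (by linarith [hu.1])
    calc _ ≤ max B 0 * (y ^ (-σ) * max 1 (y₀ ^ (σ - p))) := by
          gcongr
          · exact hB' u hu'
          · exact h3.trans (hE u hu')
      _ = _ := by ring
  rw [upperTail_right_sub (q := σ) hα hyp hTa]
  refine (norm_sub_le _ _).trans ((add_le_add hU1 hU2).trans (le_of_eq ?_))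
  ring

end

end RieszSum

/-! ### Deformation and size of the Mellin–Barnes integral -/

namespace RieszSum

section

variable {r : ℕ} {δ : ℝ} {α : Fin r → ℝ} {β : Fin r → ℂ} {ρ y : ℝ}

/-- In the right half-plane the factors Γ(α_i s + conj β_i) have no poles because Re β_i ≥ 0; only
the poles δ + k of Γ(δ - s) remain. -/
theorem differentiableAt_gammaQuotient_of_re_pos (hα : ∀ i, 0 < α i) (hβ : ∀ i, 0 ≤ (β i).re)
    (ρ : ℝ) {s : ℂ} (hs : 0 < s.re) (h : ∀ k : ℕ, s ≠ ((δ + k : ℝ) : ℂ)) :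
    DifferentiableAt ℂ (gammaQuotient δ α β ρ) s := by
  apply differentiableAt_gammaQuotient
  · intro k hk
    apply h k
    push_cast
    linear_combination -hk
  · intro i k hk
    have := congrArg Complex.re hk
    simp at this
    have h1 := mul_pos (hα i) hs
    have h2 := hβ i
    have h3 : (0 : ℝ) ≤ k := k.cast_nonneg
    linarith

theorem continuous_gammaQuotient_line (hα : ∀ i, 0 < α i) (hβ : ∀ i, 0 ≤ (β i).re)
    (ρ : ℝ) {q : ℝ} (hq : 0 < q) (h : ∀ k : ℕ, q ≠ δ + k) :
    Continuous (fun t : ℝ => gammaQuotient δ α β ρ (q + t * Complex.I)) := by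
  rw [continuous_iff_continuousAt]
  intro t
  have h1 := (differentiableAt_gammaQuotient_of_re_pos (δ := δ) hα hβ ρ
    (s := q + t * Complex.I) (by simpa using hq) (fun k hk => h k (by
      have := congrArg Complex.re hk
      simpa using this))).continuousAt
  have h2 : ContinuousAt (fun t : ℝ => (q : ℂ) + t * Complex.I) t := by fun_prop
  exact ContinuousAt.comp (f := fun t : ℝ => (q : ℂ) + t * Complex.I) h1 h2

theorem continuous_integrand_line (hα : ∀ i, 0 < α i) (hβ : ∀ i, 0 ≤ (β i).re)
    (ρ : ℝ) {q : ℝ} (hq : 0 < q) (h : ∀ k : ℕ, q ≠ δ + k) (hy : 0 < y) :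
    Continuous (fun t : ℝ => integrand δ α β ρ y (q + t * Complex.I)) :=
  (continuous_gammaQuotient_line hα hβ ρ hq h).mul (aestronglyMeasurable_cpow_line hy q)

theorem bentIntegral_mono_height (hα : ∀ i, 0 < α i) (hy : 0 < y) {p c T T' : ℝ}
    (hint : ∀ T, IntervalIntegrable (fun t : ℝ => integrand δ α β ρ y (p + t * Complex.I))
      MeasureTheory.volume (-T) T)
    (hc : (2 * c - δ) * ∑ i, α i < ρ) (hT : AbovePoles α β T) (hTT : T ≤ T') :
    bentIntegral (integrand δ α β ρ y) p c T = bentIntegral (integrand δ α β ρ y) p c T' := by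
  rw [bentIntegral_eq δ α β ρ hy, bentIntegral_eq δ α β ρ hy,
    upperTail_sub (p := p) hα hy hc hT hTT,
    upperTail_sub (β := fun i => starRingEnd ℂ (β i)) (p := p) hα hy hc (abovePoles_conj hT) hTT]
  have hconj : starRingEnd ℂ (∫ t in T..T',
      integrand δ α (fun i => starRingEnd ℂ (β i)) ρ y (p + t * Complex.I)) =
      ∫ t in (-T')..(-T), integrand δ α β ρ y (p + t * Complex.I) := by
    rw [← intervalIntegral.integral_comp_neg]
    simp only [intervalIntegral, map_sub, ← integral_conj, ← integrand_conj δ α β ρ hy]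
    simp
  rw [map_add, map_mul, hconj, Complex.conj_I]
  have hT0 := hT.1
  have i0 := hint T'
  have i1 : IntervalIntegrable (fun t : ℝ => integrand δ α β ρ y (p + t * Complex.I))
      MeasureTheory.volume (-T') (-T) := i0.mono_set (by
    rw [Set.uIcc_of_le (by linarith), Set.uIcc_of_le (by linarith)]
    exact Set.Icc_subset_Icc le_rfl (by linarith))
  have i2 : IntervalIntegrable (fun t : ℝ => integrand δ α β ρ y (p + t * Complex.I))
      MeasureTheory.volume T T' := i0.mono_set (by
    rw [Set.uIcc_of_le (by linarith), Set.uIcc_of_le (by linarith)]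
    exact Set.Icc_subset_Icc (by linarith) le_rfl)
  have e1 := intervalIntegral.integral_add_adjacent_intervals i1 (hint T)
  have e2 := intervalIntegral.integral_add_adjacent_intervals (i1.trans (hint T)) i2
  rw [← e2, ← e1]
  ring

theorem bentIntegral_left_eq (hα : ∀ i, 0 < α i) (hd : 0 < ∑ i, α i) (hy : 0 < y)
    {p c c' T : ℝ} (hcc : c' ≤ c) (hc : (2 * c - δ) * ∑ i, α i < ρ) (hT : AbovePoles α β T) :
    bentIntegral (integrand δ α β ρ y) p c T = bentIntegral (integrand δ α β ρ y) p c' T := by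
  rw [bentIntegral_eq δ α β ρ hy, bentIntegral_eq δ α β ρ hy,
    upperTail_left_eq hα hd hy hcc hc hT,
    upperTail_left_eq hα hd hy hcc hc (abovePoles_conj hT)]

theorem bentIntegral_indep (hα : ∀ i, 0 < α i) (hd : 0 < ∑ i, α i) (hy : 0 < y)
    {p c c' T T' : ℝ}
    (hint : ∀ T, IntervalIntegrable (fun t : ℝ => integrand δ α β ρ y (p + t * Complex.I))
      MeasureTheory.volume (-T) T)
    (hc : (2 * c - δ) * ∑ i, α i < ρ) (hc' : (2 * c' - δ) * ∑ i, α i < ρ)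
    (hT : AbovePoles α β T) (hT' : AbovePoles α β T') :
    bentIntegral (integrand δ α β ρ y) p c T = bentIntegral (integrand δ α β ρ y) p c' T' := by
  have h1 : bentIntegral (integrand δ α β ρ y) p c T =
      bentIntegral (integrand δ α β ρ y) p c' T := by
    rcases le_total c' c with h | h
    · exact bentIntegral_left_eq hα hd hy h hc hT
    · exact (bentIntegral_left_eq hα hd hy h hc' hT).symm
  rw [h1]
  rcases le_total T T' with h | h
  · exact bentIntegral_mono_height hα hy hint hc' hT h
  · exact (bentIntegral_mono_height hα hy hint hc' hT' h).symm

/-- The Gamma quotient with a removable singularity at `p` removed. -/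
theorem exists_differentiable_extension (hα : ∀ i, 0 < α i) (hβ : ∀ i, 0 ≤ (β i).re)
    {p q : ℝ} (hq : 0 < q) (hk : ∀ k : ℕ, ¬ (q ≤ δ + k ∧ δ + k < p))
    (hline : ¬ IsSingularity (gammaQuotient δ α β ρ) (p : ℂ)) :
    ∃ K : ℂ → ℂ, (∀ s, s ≠ (p : ℂ) → K s = gammaQuotient δ α β ρ s) ∧
      ∀ s : ℂ, q ≤ s.re → s.re ≤ p → DifferentiableAt ℂ K s := by
  classical
  rw [IsSingularity, not_not] at hline
  obtain ⟨g, hg, hgK⟩ := hline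
  refine ⟨Function.update (gammaQuotient δ α β ρ) p (g p), fun s hs =>
    Function.update_of_ne hs _ _, fun s hs1 hs2 => ?_⟩
  rcases eq_or_ne s (p : ℂ) with rfl | hsp
  · refine hg.differentiableAt.congr_of_eventuallyEq ?_
    rw [eventuallyEq_nhdsWithin_iff] at hgK
    filter_upwards [hgK] with z hz
    rcases eq_or_ne z (p : ℂ) with rfl | hzp
    · rw [Function.update_self]
    · rw [Function.update_of_ne hzp]; exact hz hzp
  · have h1 : DifferentiableAt ℂ (gammaQuotient δ α β ρ) s := by
      apply differentiableAt_gammaQuotient_of_re_pos hα hβ ρ (hq.trans_le hs1)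
      intro k hsk
      have hre : s.re = δ + k := by rw [hsk, Complex.ofReal_re]
      rcases hs2.lt_or_eq with h2 | h2
      · exact hk k ⟨hre ▸ hs1, hre ▸ h2⟩
      · apply hsp
        rw [hsk, ← hre, h2]
    refine h1.congr_of_eventuallyEq ?_
    filter_upwards [isOpen_ne.mem_nhds hsp] with z hz
    exact Function.update_of_ne hz _ _

theorem intervalIntegrable_integrand_of_removable (hα : ∀ i, 0 < α i) (hβ : ∀ i, 0 ≤ (β i).re)
    {p q : ℝ} (hq : 0 < q) (hqp : q < p) (hk : ∀ k : ℕ, ¬ (q ≤ δ + k ∧ δ + k < p))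
    (hline : ¬ IsSingularity (gammaQuotient δ α β ρ) (p : ℂ)) (hy : 0 < y) (T : ℝ) :
    IntervalIntegrable (fun t : ℝ => integrand δ α β ρ y (p + t * Complex.I))
      MeasureTheory.volume (-T) T := by
  obtain ⟨K, hK, hKd⟩ := exists_differentiable_extension hα hβ hq hk hline
  have hc : Continuous (fun t : ℝ => K (p + t * Complex.I) *
      (y : ℂ) ^ (-((p : ℂ) + t * Complex.I))) := by
    refine Continuous.mul ?_ (aestronglyMeasurable_cpow_line hy p)
    rw [continuous_iff_continuousAt]
    intro t
    have h2 : ContinuousAt (fun t : ℝ => (p : ℂ) + t * Complex.I) t := by fun_prop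
    exact ContinuousAt.comp (f := fun t : ℝ => (p : ℂ) + t * Complex.I)
      (hKd _ (by simpa using hqp.le) (by simp)).continuousAt h2
  refine (hc.intervalIntegrable (-T) T).congr_ae ?_
  have hne : ∀ᵐ t : ℝ, t ≠ 0 := by simp [MeasureTheory.ae_iff]
  refine MeasureTheory.ae_restrict_of_ae ?_
  filter_upwards [hne] with t ht
  rw [integrand, hK]
  intro h
  have := congrArg Complex.im h
  simp at this
  exact ht this

theorem continuous_integrand_horizontal_neg (hα : ∀ i, 0 < α i) (hy : 0 < y) {T : ℝ}
    (hT : AbovePoles α β T) :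
    Continuous (fun u : ℝ => integrand δ α β ρ y (u - T * Complex.I)) := by
  have := (continuous_integrand_horizontal (δ := δ) (ρ := ρ) hα hy (abovePoles_conj hT))
  have h2 := Complex.continuous_conj.comp this
  refine h2.congr fun u => ?_
  simp only [Function.comp]
  rw [← integrand_conj δ α β ρ hy]
  simp [sub_eq_add_neg]

/-- The given abscissa p may be one of the points δ + k, as long as the singularity there cancels.
Moving the middle segment to a nearby q gives a line on which the integrand is continuous without
modification. -/
theorem bentIntegral_right_eq (hα : ∀ i, 0 < α i) (hβ : ∀ i, 0 ≤ (β i).re)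
    {p q c T : ℝ} (hq : 0 < q) (hqp : q < p) (hk : ∀ k : ℕ, ¬ (q ≤ δ + k ∧ δ + k < p))
    (hline : ¬ IsSingularity (gammaQuotient δ α β ρ) (p : ℂ)) (hy : 0 < y)
    (hT : AbovePoles α β T) :
    bentIntegral (integrand δ α β ρ y) p c T = bentIntegral (integrand δ α β ρ y) q c T := by
  obtain ⟨K, hK, hKd⟩ := exists_differentiable_extension hα hβ hq hk hline
  set f : ℂ → ℂ := fun s => K s * (y : ℂ) ^ (-s) with hf
  have hff : ∀ s, s ≠ (p : ℂ) → f s = integrand δ α β ρ y s := fun s hs => by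
    rw [hf, integrand, ← hK s hs]
  have hT0 := hT.1
  have hrect := Complex.integral_boundary_rect_eq_zero_of_differentiableOn f
    ⟨q, -T⟩ ⟨p, T⟩ (fun s hs => by
      have hre : s.re ∈ Set.uIcc q p := hs.1
      rw [Set.uIcc_of_le hqp.le] at hre
      refine ((hKd s hre.1 hre.2).mul ?_).differentiableWithinAt
      apply DifferentiableAt.const_cpow (by fun_prop)
      left; exact_mod_cast hy.ne')
  simp only [smul_eq_mul] at hrect
  have e1 : ∀ u : ℝ, f (u + ((-T : ℝ) : ℂ) * Complex.I) =
      integrand δ α β ρ y (u - T * Complex.I) := by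
    intro u
    rw [hff]
    · push_cast; congr 1; ring
    · intro h
      have := congrArg Complex.im h
      simp at this
      exact hT0.ne' this
  have e2 : ∀ u : ℝ, f (u + T * Complex.I) = integrand δ α β ρ y (u + T * Complex.I) := by
    intro u
    rw [hff]
    intro h
    have := congrArg Complex.im h
    simp at this
    exact hT0.ne' this
  have e3 : ∀ t : ℝ, f (q + t * Complex.I) = integrand δ α β ρ y (q + t * Complex.I) := by
    intro u
    rw [hff]
    intro h
    have := congrArg Complex.re h
    simp at this
    exact hqp.ne this
  -- At s = p the written quotient may have a default value instead of its limit. This single point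
  -- does not affect the integral.
  have e4 : ∫ t in (-T)..T, f (p + t * Complex.I) =
      ∫ t in (-T)..T, integrand δ α β ρ y (p + t * Complex.I) := by
    have hne : ∀ᵐ t : ℝ, t ≠ 0 := by simp [MeasureTheory.ae_iff]
    apply intervalIntegral.integral_congr_ae
    filter_upwards [hne] with t ht _
    rw [hff]
    intro h
    have := congrArg Complex.im h
    simp at this
    exact ht this
  simp only [e1, e2, e3, e4] at hrect
  have hc2 := continuous_integrand_horizontal (δ := δ) (ρ := ρ) hα hy hT
  have hc1 := continuous_integrand_horizontal_neg (δ := δ) (ρ := ρ) hα hy hT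
  have a1 := intervalIntegral.integral_add_adjacent_intervals
    (hc1.intervalIntegrable (μ := MeasureTheory.volume) c q) (hc1.intervalIntegrable q p)
  have a2 := intervalIntegral.integral_add_adjacent_intervals
    (hc2.intervalIntegrable (μ := MeasureTheory.volume) c q) (hc2.intervalIntegrable q p)
  rw [bentIntegral, bentIntegral, ← a1, ← a2]
  congr 1
  linear_combination hrect

theorem bentIntegrable_integrand (hα : ∀ i, 0 < α i) (hy : 0 < y) {p c T : ℝ}
    (hint : ∀ T, IntervalIntegrable (fun t : ℝ => integrand δ α β ρ y (p + t * Complex.I))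
      MeasureTheory.volume (-T) T)
    (hc : (2 * c - δ) * ∑ i, α i < ρ) (hT : AbovePoles α β T) :
    BentIntegrable (integrand δ α β ρ y) p c T := by
  refine ⟨?_, (continuous_integrand_horizontal_neg hα hy hT).intervalIntegrable _ _, hint T,
    (continuous_integrand_horizontal hα hy hT).intervalIntegrable _ _,
    integrableOn_integrand_line hα hy hc hT⟩
  have h := integrableOn_integrand_line (δ := δ) hα hy hc (abovePoles_conj hT)
  have h2 := Complex.conjCLE.toContinuousLinearMap.integrable_comp h.comp_neg
  rw [Set.neg_Ioi] at h2
  rw [integrableOn_Iic_iff_integrableOn_Iio]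
  refine h2.congr (Eventually.of_forall fun t => ?_)
  change starRingEnd ℂ _ = _
  rw [← integrand_conj δ α β ρ hy]
  simp

/-- The Mellin--Barnes integral along the line `Re s = p` can be evaluated on a contour with
middle part on the line `Re s = q`. -/
theorem hasBarnesIntegral_bentIntegral (hα : ∀ i, 0 < α i) (hd : 0 < ∑ i, α i)
    (hβ : ∀ i, 0 ≤ (β i).re)
    {p q c T : ℝ} (hq : 0 < q) (hqp : q < p) (hk : ∀ k : ℕ, ¬ (q ≤ δ + k ∧ δ + k < p))
    (hline : ¬ IsSingularity (gammaQuotient δ α β ρ) (p : ℂ)) (hy : 0 < y)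
    (hc : (2 * c - δ) * ∑ i, α i < ρ) (hT : AbovePoles α β T) :
    HasBarnesIntegral δ α β ρ p y (bentIntegral (integrand δ α β ρ y) q c T) := by
  have hint := intervalIntegrable_integrand_of_removable hα hβ hq hqp hk hline hy
  intro c' T' _ hc' hT'0 hT'
  refine ⟨bentIntegrable_integrand hα hy hint hc' ⟨hT'0, hT'⟩, ?_⟩
  rw [bentIntegral_indep hα hd hy hint hc' hc ⟨hT'0, hT'⟩ hT]
  exact bentIntegral_right_eq hα hβ hq hqp hk hline hy hT

/-- The symmetric segment of height X differs from the bent integral only by the two tails at height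
X, which vanish as X → ∞ precisely by the estimate for horizontal segments. -/
theorem hasLineIntegral_bentIntegral (hα : ∀ i, 0 < α i) (hd : 0 < ∑ i, α i) (hy : 0 < y)
    {p c T : ℝ}
    (hint : ∀ T, IntervalIntegrable (fun t : ℝ => integrand δ α β ρ y (p + t * Complex.I))
      MeasureTheory.volume (-T) T)
    (hc : (2 * c - δ) * ∑ i, α i < ρ) (hT : AbovePoles α β T)
    (hp : (2 * p - δ) * ∑ i, α i - 1 ≤ ρ) :
    HasLineIntegral (integrand δ α β ρ y) p (bentIntegral (integrand δ α β ρ y) p c T) := by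
  -- The tail estimate bends the contour to the left of p, so c is replaced by a smaller admissible
  -- abscissa if necessary.
  set c' := min c p with hc'
  have hcc : (2 * c' - δ) * ∑ i, α i < ρ := by
    have : c' ≤ c := min_le_left _ _
    nlinarith
  have h1 := tendsto_upperTail (β := β) hα hd hy (min_le_right c p) hcc hp
  have h2 := tendsto_upperTail (β := fun i => starRingEnd ℂ (β i)) hα hd hy (min_le_right c p)
    hcc hp
  have h3 := ((Complex.continuous_conj.tendsto 0).comp h2)
  have h4 := (((h1.sub h3).const_mul (2 * (Real.pi : ℂ) * Complex.I)⁻¹).const_sub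
    (bentIntegral (integrand δ α β ρ y) p c T))
  simp only [map_zero, sub_zero, mul_zero] at h4
  refine h4.congr' ?_
  filter_upwards [eventually_ge_atTop T] with X hX
  rw [bentIntegral_indep hα hd hy hint hc hcc hT (hT.mono hX), bentIntegral_eq δ α β ρ hy,
    segmentIntegral]
  simp only [Function.comp]
  ring

/-- This is the estimate that makes the dual series converge. The tails are controlled by
oscillation up to the abscissa σ. On the middle segment, which is compact, y^{-q} is at most a
constant times y^{-σ} for y ≥ y₀, since σ ≤ q. -/
theorem exists_norm_bentIntegral_le (hα : ∀ i, 0 < α i) (hd : 0 < ∑ i, α i)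
    (hβ : ∀ i, 0 ≤ (β i).re) {q c T σ : ℝ} (hq : 0 < q) (hk : ∀ k : ℕ, q ≠ δ + k)
    (hσ : (2 * σ - δ) * ∑ i, α i - 1 / 2 < ρ) (hσq : σ ≤ q)
    (hc : (2 * c - δ) * ∑ i, α i < ρ) (hT : AbovePoles α β T) {y₀ : ℝ} (hy₀ : 0 < y₀) :
    ∃ C, 0 ≤ C ∧ ∀ y, y₀ ≤ y →
      ‖bentIntegral (integrand δ α β ρ y) q c T‖ ≤ C * y ^ (-σ) := by
  obtain ⟨t₁, ht₁, h1⟩ := exists_norm_upperTail_le δ hα hd β ρ hσ hσq hy₀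
  obtain ⟨t₂, ht₂, h2⟩ := exists_norm_upperTail_le δ hα hd (fun i => starRingEnd ℂ (β i)) ρ hσ
    hσq hy₀
  set X := max t₁ t₂ with hX
  obtain ⟨C₁, hC₁, h1⟩ := h1 X (le_max_left _ _)
  obtain ⟨C₂, hC₂, h2⟩ := h2 X (le_max_right _ _)
  have hXa := ht₁.mono (le_max_left t₁ t₂)
  have hcontK := continuous_gammaQuotient_line (δ := δ) hα hβ ρ hq hk
  obtain ⟨B, hB⟩ := (isCompact_Icc (a := -X) (b := X)).exists_bound_of_continuousOn
    hcontK.continuousOn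
  have hX0 : 0 < X := hXa.1
  set c' := min c σ with hc'
  have hcc : (2 * c' - δ) * ∑ i, α i < ρ := by
    have : c' ≤ c := min_le_left _ _
    nlinarith
  have hB0 : 0 ≤ B := (norm_nonneg _).trans (hB 0 ⟨by linarith, by linarith⟩)
  refine ⟨‖(2 * (Real.pi : ℂ) * Complex.I)⁻¹‖ *
    (B * y₀ ^ (σ - q) * (2 * X) + C₁ + C₂), by positivity, fun y hy => ?_⟩
  have hyp : 0 < y := hy₀.trans_le hy
  have hint : ∀ T, IntervalIntegrable (fun t : ℝ => integrand δ α β ρ y (q + t * Complex.I))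
      MeasureTheory.volume (-T) T := fun T =>
    (continuous_integrand_line hα hβ ρ hq hk hyp).intervalIntegrable _ _
  rw [bentIntegral_indep hα hd hyp hint hc hcc hT hXa, bentIntegral_eq δ α β ρ hyp, norm_mul,
    mul_assoc ‖_‖]
  have n1 := h1 c' (min_le_right _ _) hcc y hy
  have n2 := h2 c' (min_le_right _ _) hcc y hy
  have n3 : ‖∫ t in (-X)..X, integrand δ α β ρ y (q + t * Complex.I)‖ ≤
      B * y₀ ^ (σ - q) * y ^ (-σ) * (2 * X) := by
    have := intervalIntegral.norm_integral_le_of_norm_le_const (a := -X) (b := X)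
      (f := fun t : ℝ => integrand δ α β ρ y (q + t * Complex.I))
      (C := B * y₀ ^ (σ - q) * y ^ (-σ)) (fun t ht => ?_)
    · rwa [show X - -X = 2 * X by ring, abs_of_pos (by linarith)] at this
    · rw [Set.uIoc_of_le (by linarith)] at ht
      rw [norm_integrand hyp]
      have hre : (-((q : ℂ) + t * Complex.I).re) = (σ - q) + -σ := by simp; ring
      rw [hre, Real.rpow_add hyp, mul_assoc]
      have h3 : y ^ (σ - q) ≤ y₀ ^ (σ - q) :=
        Real.rpow_le_rpow_of_nonpos hy₀ hy (by linarith)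
      gcongr
      exact hB t ⟨ht.1.le, ht.2⟩
  refine mul_le_mul_of_nonneg_left ?_ (norm_nonneg _)
  refine (norm_sub_le _ _).trans ((add_le_add (norm_add_le _ _) le_rfl).trans ?_)
  rw [norm_mul, Complex.norm_I, one_mul, Complex.norm_conj]
  linarith

end

end RieszSum

namespace RieszSum

/-! ### Differentiation with respect to the parameter -/

/-- A majorant for all exponents in [c₁, c₂] that is valid for bases below and above 1 alike. -/
theorem rpow_le_rpow_add_rpow {a e c₁ c₂ : ℝ} (ha : 0 < a) (h1 : c₁ ≤ e) (h2 : e ≤ c₂) :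
    a ^ e ≤ a ^ c₁ + a ^ c₂ := by
  have p1 : 0 < a ^ c₁ := by positivity
  have p2 : 0 < a ^ c₂ := by positivity
  rcases le_total 1 a with h | h
  · have := Real.rpow_le_rpow_of_exponent_le h h2
    linarith
  · have := Real.rpow_le_rpow_of_exponent_ge ha h h1
    linarith

theorem hasDerivAt_ofReal_cpow_mul (k : ℂ) {x : ℝ} (hx : 0 < x) :
    HasDerivAt (fun y : ℝ => (y : ℂ) ^ k) (k * (x : ℂ) ^ (k - 1)) x := by
  rcases eq_or_ne k 0 with rfl | hk
  · simp only [Complex.cpow_zero, zero_mul]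
    exact hasDerivAt_const x 1
  · exact hasDerivAt_ofReal_cpow_const hx.ne' hk

theorem hasDerivAt_integral_cpow {ν : MeasureTheory.Measure ℝ} {A k : ℝ → ℂ} {c₁ c₂ : ℝ}
    (hA : MeasureTheory.Integrable A ν) (hAk : MeasureTheory.Integrable (fun t => A t * k t) ν)
    (hk : Continuous k) (hre : ∀ᵐ t ∂ν, (k t).re ∈ Set.Icc c₁ c₂) {x : ℝ} (hx : 0 < x) :
    HasDerivAt (fun x : ℝ => ∫ t, A t * (x : ℂ) ^ k t ∂ν)
      (∫ t, A t * k t * (x : ℂ) ^ (k t - 1) ∂ν) x := by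
  have hnhds : Set.Icc (x / 2) (2 * x) ∈ 𝓝 x := Icc_mem_nhds (by linarith) (by linarith)
  have hcont : ContinuousOn (fun z : ℝ => z ^ c₁ + z ^ c₂) (Set.Icc (x / 2) (2 * x)) := by
    intro z hz
    have : z ≠ 0 := (lt_of_lt_of_le (by positivity) hz.1).ne'
    exact ((Real.continuousAt_rpow_const z _ (Or.inl this)).add
      (Real.continuousAt_rpow_const z _ (Or.inl this))).continuousWithinAt
  have hcont' : ContinuousOn (fun z : ℝ => z ^ (c₁ - 1) + z ^ (c₂ - 1))
      (Set.Icc (x / 2) (2 * x)) := by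
    intro z hz
    have : z ≠ 0 := (lt_of_lt_of_le (by positivity) hz.1).ne'
    exact ((Real.continuousAt_rpow_const z _ (Or.inl this)).add
      (Real.continuousAt_rpow_const z _ (Or.inl this))).continuousWithinAt
  obtain ⟨B, hB⟩ := isCompact_Icc.exists_bound_of_continuousOn hcont
  obtain ⟨B', hB'⟩ := isCompact_Icc.exists_bound_of_continuousOn hcont'
  have hpos : ∀ z ∈ Set.Icc (x / 2) (2 * x), 0 < z := fun z hz => by
    have := hz.1; linarith
  have hcpow : ∀ z : ℝ, 0 < z → ∀ w : ℂ, Continuous fun t => (z : ℂ) ^ (k t - w) := by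
    intro z hz w
    apply Continuous.const_cpow (by fun_prop)
    left; exact_mod_cast hz.ne'
  refine (hasDerivAt_integral_of_dominated_loc_of_deriv_le (bound := fun t => ‖A t * k t‖ * B')
    (F := fun (x : ℝ) t => A t * (x : ℂ) ^ k t)
    (F' := fun (x : ℝ) t => A t * k t * (x : ℂ) ^ (k t - 1)) hnhds ?_ ?_ ?_ ?_ ?_ ?_).2
  · filter_upwards [hnhds] with z hz
    have := hcpow z (hpos z hz) 0
    simp only [sub_zero] at this
    exact hA.aestronglyMeasurable.mul this.aestronglyMeasurable
  · have := hcpow x hx 0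
    simp only [sub_zero] at this
    refine hA.mul_bdd (c := B) this.aestronglyMeasurable ?_
    filter_upwards [hre] with t ht
    rw [Complex.norm_cpow_eq_rpow_re_of_pos hx]
    have h1 := hB x ⟨by linarith, by linarith⟩
    exact (rpow_le_rpow_add_rpow hx ht.1 ht.2).trans ((le_abs_self _).trans h1)
  · exact hAk.aestronglyMeasurable.mul (hcpow x hx 1).aestronglyMeasurable
  · filter_upwards [hre] with t ht z hz
    rw [norm_mul, Complex.norm_cpow_eq_rpow_re_of_pos (hpos z hz)]
    have h1 := hB' z hz
    gcongr
    refine (rpow_le_rpow_add_rpow (c₁ := c₁ - 1) (c₂ := c₂ - 1) (hpos z hz) ?_ ?_).trans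
      ((le_abs_self _).trans h1)
    · simp only [Complex.sub_re, Complex.one_re]; linarith [ht.1]
    · simp only [Complex.sub_re, Complex.one_re]; linarith [ht.2]
  · exact hAk.norm.mul_const B'
  · refine Eventually.of_forall fun t z hz => ?_
    have := (hasDerivAt_ofReal_cpow_mul (k t) (hpos z hz)).const_mul (A t)
    rwa [← mul_assoc] at this

section

variable {r : ℕ} {δ : ℝ} {α : Fin r → ℝ} {β : Fin r → ℂ} {ρ y : ℝ}

/-- The factor δ + ρ + 1 - s is exactly the one produced by differentiating x^{δ+ρ+1-s}. Hence d/dx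
takes x^{δ+ρ+1} J_{ρ+1} to x^{δ+ρ} J_ρ under the integral sign. -/
theorem gammaQuotient_add_one (δ : ℝ) (α : Fin r → ℝ) (β : Fin r → ℂ) (ρ : ℝ) (s : ℂ) :
    gammaQuotient δ α β (ρ + 1) s * (δ + ρ + 1 - s) = gammaQuotient δ α β ρ s := by
  rw [gammaQuotient_eq, gammaQuotient_eq,
    Complex.one_div_Gamma_eq_self_mul_one_div_Gamma_add_one (1 + δ - s + ρ)]
  push_cast
  rw [show (1 : ℂ) + δ - s + (ρ + 1) = 1 + δ - s + ρ + 1 by ring]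
  ring

theorem cpow_mul_integrand (δ : ℝ) (α : Fin r → ℝ) (β : Fin r → ℂ) (ρ : ℝ) {m x : ℝ} (hm : 0 < m)
    (hx : 0 < x) (s : ℂ) :
    (x : ℂ) ^ ((δ : ℂ) + ρ) * integrand δ α β ρ (m * x) s =
      gammaQuotient δ α β ρ s * (m : ℂ) ^ (-s) * (x : ℂ) ^ (δ + ρ - s) := by
  have hxC : (x : ℂ) ≠ 0 := by exact_mod_cast hx.ne'
  rw [integrand, Complex.ofReal_mul, Complex.mul_cpow_ofReal_nonneg hm.le hx.le,
    sub_eq_add_neg ((δ : ℂ) + ρ) s, Complex.cpow_add ((δ : ℂ) + ρ) (-s) hxC]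
  ring

/-- The derivative of one piece of the Mellin--Barnes integral. -/
theorem hasDerivAt_integral_integrand {ν : MeasureTheory.Measure ℝ} {γ : ℝ → ℂ} {c₁ c₂ m : ℝ}
    (hm : 0 < m) (hγ : Continuous γ) (hre : ∀ᵐ t ∂ν, (γ t).re ∈ Set.Icc c₁ c₂)
    (h1 : MeasureTheory.Integrable (fun t => integrand δ α β (ρ + 1) m (γ t)) ν)
    (h0 : MeasureTheory.Integrable (fun t => integrand δ α β ρ m (γ t)) ν) {x : ℝ} (hx : 0 < x) :
    HasDerivAt (fun x : ℝ => (x : ℂ) ^ ((δ : ℂ) + (ρ + 1 : ℝ)) *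
        ∫ t, integrand δ α β (ρ + 1) (m * x) (γ t) ∂ν)
      ((x : ℂ) ^ ((δ : ℂ) + ρ) * ∫ t, integrand δ α β ρ (m * x) (γ t) ∂ν) x := by
  have hd := hasDerivAt_integral_cpow (ν := ν)
    (A := fun t => integrand δ α β (ρ + 1) m (γ t)) (k := fun t => δ + (ρ + 1 : ℝ) - γ t)
    (c₁ := δ + (ρ + 1) - c₂) (c₂ := δ + (ρ + 1) - c₁) h1 ?_ (by fun_prop) ?_ hx
  · have e1 : ∫ t, integrand δ α β (ρ + 1) m (γ t) * (δ + (ρ + 1 : ℝ) - γ t) *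
        (x : ℂ) ^ ((δ : ℂ) + (ρ + 1 : ℝ) - γ t - 1) ∂ν =
        (x : ℂ) ^ ((δ : ℂ) + ρ) * ∫ t, integrand δ α β ρ (m * x) (γ t) ∂ν := by
      rw [← MeasureTheory.integral_const_mul]
      congr 1
      funext t
      rw [cpow_mul_integrand δ α β ρ hm hx, ← gammaQuotient_add_one, integrand]
      push_cast
      rw [show (δ : ℂ) + (ρ + 1) - γ t - 1 = δ + ρ - γ t by ring]
      ring
    rw [e1] at hd
    refine hd.congr_of_eventuallyEq ?_
    filter_upwards [Ioi_mem_nhds hx] with z hz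
    rw [← MeasureTheory.integral_const_mul]
    congr 1
    funext t
    rw [cpow_mul_integrand δ α β (ρ + 1) hm hz, integrand]
  · refine h0.congr (Eventually.of_forall fun t => ?_)
    simp only [integrand]
    rw [← gammaQuotient_add_one]
    push_cast
    ring
  · filter_upwards [hre] with t ht
    simp only [Complex.sub_re, Complex.add_re, Complex.ofReal_re, Set.mem_Icc]
    constructor <;> linarith [ht.1, ht.2]

theorem hasDerivAt_bentIntegral (hα : ∀ i, 0 < α i) (hβ : ∀ i, 0 ≤ (β i).re)
    {q c T m : ℝ} (hq : 0 < q) (hk : ∀ k : ℕ, q ≠ δ + k) (hcq : c ≤ q)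
    (hc : (2 * c - δ) * ∑ i, α i < ρ) (hT : AbovePoles α β T) (hm : 0 < m) {x : ℝ} (hx : 0 < x) :
    HasDerivAt (fun x : ℝ => (x : ℂ) ^ ((δ : ℂ) + (ρ + 1 : ℝ)) *
        bentIntegral (integrand δ α β (ρ + 1) (m * x)) q c T)
      ((x : ℂ) ^ ((δ : ℂ) + ρ) * bentIntegral (integrand δ α β ρ (m * x)) q c T) x := by
  have hint : ∀ ρ, ∀ T, IntervalIntegrable (fun t : ℝ => integrand δ α β ρ m (q + t * Complex.I))
      MeasureTheory.volume (-T) T := fun ρ T =>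
    (continuous_integrand_line hα hβ ρ hq hk hm).intervalIntegrable _ _
  have b0 := bentIntegrable_integrand (δ := δ) hα hm (hint ρ) hc hT
  have b1 := bentIntegrable_integrand (δ := δ) (c := c) (ρ := ρ + 1) hα hm (hint (ρ + 1))
    (by linarith) hT
  have hT0 := hT.1
  have hTT : -T ≤ T := by linarith
  obtain ⟨i1, i2, i3, i4, i5⟩ := b0
  obtain ⟨j1, j2, j3, j4, j5⟩ := b1
  rw [intervalIntegrable_iff_integrableOn_Ioc_of_le hcq] at i2 i4 j2 j4
  rw [intervalIntegrable_iff_integrableOn_Ioc_of_le hTT] at i3 j3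
  have hIoc : ∀ᵐ u ∂(MeasureTheory.volume.restrict (Set.Ioc c q)), u ∈ Set.Icc c q := by
    filter_upwards [MeasureTheory.ae_restrict_mem measurableSet_Ioc] with u hu
    exact ⟨hu.1.le, hu.2⟩
  have d1 := hasDerivAt_integral_integrand (c₁ := c) (c₂ := c) hm
    (γ := fun t : ℝ => (c : ℂ) + t * Complex.I) (by fun_prop)
    (Eventually.of_forall fun t => by simp) j1 i1 hx
  have d2 := hasDerivAt_integral_integrand (c₁ := c) (c₂ := q) hm
    (γ := fun u : ℝ => (u : ℂ) - T * Complex.I) (by fun_prop)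
    (by filter_upwards [hIoc] with u hu; simpa using hu) j2 i2 hx
  have d3 := hasDerivAt_integral_integrand (c₁ := q) (c₂ := q) hm
    (γ := fun t : ℝ => (q : ℂ) + t * Complex.I) (by fun_prop)
    (Eventually.of_forall fun t => by simp) j3 i3 hx
  have d4 := hasDerivAt_integral_integrand (c₁ := c) (c₂ := q) hm
    (γ := fun u : ℝ => (u : ℂ) + T * Complex.I) (by fun_prop)
    (by filter_upwards [hIoc] with u hu; simpa using hu) j4 i4 hx
  have d5 := hasDerivAt_integral_integrand (c₁ := c) (c₂ := c) hm
    (γ := fun t : ℝ => (c : ℂ) + t * Complex.I) (by fun_prop)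
    (Eventually.of_forall fun t => by simp) j5 i5 hx
  have d := (((((d1.const_mul Complex.I).add d2).add (d3.const_mul Complex.I)).sub d4).add
    (d5.const_mul Complex.I)).const_mul (2 * (Real.pi : ℂ) * Complex.I)⁻¹
  simp only [bentIntegral, intervalIntegral.integral_of_le hcq,
    intervalIntegral.integral_of_le hTT]
  refine (d.congr_of_eventuallyEq (Eventually.of_forall fun z => ?_)).congr_deriv ?_
  · simp only [Pi.add_apply, Pi.sub_apply]; ring
  · ring

end

/-! ### Differentiation of Riesz sums -/

/-- For p > 1 the truncated power has both one-sided derivatives equal to 0 at the origin, so the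
pieces join differentiably. -/
theorem hasDerivAt_max_rpow {p : ℝ} (hp : 1 < p) (u : ℝ) :
    HasDerivAt (fun u : ℝ => max u 0 ^ p) (p * max u 0 ^ (p - 1)) u := by
  rcases lt_trichotomy u 0 with h | h | h
  · rw [max_eq_right h.le, Real.zero_rpow (by linarith), mul_zero]
    refine (hasDerivAt_const u (0 : ℝ)).congr_of_eventuallyEq ?_
    filter_upwards [Iio_mem_nhds h] with v hv
    rw [max_eq_right (le_of_lt hv), Real.zero_rpow (by linarith)]
  · subst h
    rw [max_self, Real.zero_rpow (by linarith), mul_zero]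
    have h1 : HasDerivWithinAt (fun u : ℝ => max u 0 ^ p) 0 (Set.Ici 0) 0 := by
      have := (Real.hasDerivAt_rpow_const (x := 0) (p := p) (Or.inr hp.le)).hasDerivWithinAt
        (s := Set.Ici 0)
      rw [Real.zero_rpow (by linarith), mul_zero] at this
      exact this.congr (fun v hv => by rw [max_eq_left hv]) (by simp)
    have h2 : HasDerivWithinAt (fun u : ℝ => max u 0 ^ p) 0 (Set.Iic 0) 0 := by
      refine (hasDerivWithinAt_const (0 : ℝ) (Set.Iic 0) (0 : ℝ)).congr (fun v hv => ?_) ?_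
      · rw [max_eq_right hv, Real.zero_rpow (by linarith)]
      · rw [max_self, Real.zero_rpow (by linarith)]
    have := h2.union h1
    rwa [Set.Iic_union_Ici, hasDerivWithinAt_univ] at this
  · rw [max_eq_left h.le]
    refine (Real.hasDerivAt_rpow_const (Or.inl h.ne')).congr_of_eventuallyEq ?_
    filter_upwards [Ioi_mem_nhds h] with v hv
    rw [max_eq_left (le_of_lt hv)]

/-- For ρ > 0 the condition λ_n ≤ x can be absorbed into a truncated power, because 0^ρ = 0. With N
fixed, the finite sum represents the Riesz mean at all smaller x, so it can be differentiated. -/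
theorem rieszSum_eq {a : ℕ → ℂ} {lam : ℕ → ℝ} {ρ : ℝ} (hρ : 0 < ρ) {N : ℕ} {x : ℝ}
    (hN : ∀ n, N ≤ n → x ≤ lam n) :
    rieszSum a lam ρ x = (Complex.Gamma ((ρ : ℂ) + 1))⁻¹ *
      ∑ n ∈ Finset.range N, a n * ((max (x - lam n) 0 ^ ρ : ℝ) : ℂ) := by
  rw [rieszSum]
  congr 1
  have h : ∀ n, (if lam n ≤ x then
      (if ρ = 0 ∧ lam n = x then (1 / 2 : ℂ) else 1) * a n * (((x - lam n) ^ ρ : ℝ) : ℂ) else 0) =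
      a n * ((max (x - lam n) 0 ^ ρ : ℝ) : ℂ) := by
    intro n
    rw [if_neg (show ¬(ρ = 0 ∧ lam n = x) from fun h => hρ.ne' h.1), one_mul]
    split_ifs with hn
    · rw [max_eq_left (by linarith)]
    · rw [max_eq_right (by linarith), Real.zero_rpow hρ.ne']; simp
  simp_rw [h]
  refine tsum_eq_sum fun n hn => ?_
  have := hN n (by simpa using hn)
  rw [max_eq_right (by linarith), Real.zero_rpow hρ.ne']; simp

theorem hasDerivAt_rieszSum {a : ℕ → ℂ} {lam : ℕ → ℝ} (hlam : IsFrequencySequence lam) {ρ : ℝ}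
    (hρ : 0 < ρ) (x : ℝ) :
    HasDerivAt (rieszSum a lam (ρ + 1)) (rieszSum a lam ρ x) x := by
  obtain ⟨N, hN⟩ := eventually_atTop.1 (hlam.2.2.eventually_ge_atTop (x + 1))
  rw [rieszSum_eq hρ (N := N) fun n hn => by linarith [hN n hn]]
  have hd : HasDerivAt (fun x : ℝ => (Complex.Gamma (((ρ + 1 : ℝ) : ℂ) + 1))⁻¹ *
      ∑ n ∈ Finset.range N, a n * ((max (x - lam n) 0 ^ (ρ + 1) : ℝ) : ℂ))
      ((Complex.Gamma (((ρ + 1 : ℝ) : ℂ) + 1))⁻¹ * ∑ n ∈ Finset.range N,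
        a n * (((ρ + 1) * max (x - lam n) 0 ^ ρ : ℝ) : ℂ)) x := by
    refine HasDerivAt.const_mul _ (HasDerivAt.fun_sum fun n _ => HasDerivAt.const_mul _ ?_)
    have h1 := (hasDerivAt_max_rpow (p := ρ + 1) (by linarith) (x - lam n)).comp_sub_const x (lam n)
    rw [add_sub_cancel_right] at h1
    exact h1.ofReal_comp
  refine (hd.congr_of_eventuallyEq ?_).congr_deriv ?_
  · filter_upwards [Iio_mem_nhds (show x < x + 1 by linarith)] with z hz
    exact rieszSum_eq (by linarith) fun n hn => (le_of_lt hz).trans (hN n hn)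
  · have hne : (ρ : ℂ) + 1 ≠ 0 := by
      have : (ρ + 1 : ℝ) ≠ 0 := by linarith
      exact_mod_cast this
    rw [Complex.ofReal_add, Complex.ofReal_one, Complex.Gamma_add_one _ hne, mul_inv,
      Finset.mul_sum, Finset.mul_sum]
    refine Finset.sum_congr rfl fun n _ => ?_
    push_cast
    field_simp

/-- The Riesz mean of order 1 is piecewise linear, and its slope jumps by a_k at λ_k. If a_k ≠ 0,
subtracting the other terms, which are differentiable there, would make max(x - λ_k, 0), and hence
|u| at 0, differentiable. -/
theorem eq_zero_of_differentiableAt_rieszSum_one {a : ℕ → ℂ} {lam : ℕ → ℝ}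
    (hlam : IsFrequencySequence lam) (h : ∀ x, 0 < x → DifferentiableAt ℝ (rieszSum a lam 1) x)
    (k : ℕ) : a k = 0 := by
  by_contra hk
  set x := lam k with hx
  obtain ⟨N, hN⟩ := eventually_atTop.1 (hlam.2.2.eventually_ge_atTop (x + 1))
  have hkN : k < N := by
    by_contra hkN
    have := hN k (not_lt.1 hkN)
    linarith
  have hmax : ∀ n, n ≠ k → DifferentiableAt ℝ (fun x => ((max (x - lam n) 0 : ℝ) : ℂ)) x := by
    intro n hn
    have hne : x - lam n ≠ 0 := by
      rw [hx, sub_ne_zero]; exact fun h => hn (hlam.2.1.injective h).symm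
    rcases hne.lt_or_gt with h1 | h1
    · refine (differentiableAt_const (0 : ℂ)).congr_of_eventuallyEq ?_
      filter_upwards [Iio_mem_nhds (show x < lam n by linarith)] with z hz
      rw [max_eq_right (by linarith [Set.mem_Iio.1 hz]), Complex.ofReal_zero]
    · have h2 : DifferentiableAt ℝ (fun z : ℝ => ((z - lam n : ℝ) : ℂ)) x :=
        (((hasDerivAt_id x).sub_const (lam n)).ofReal_comp).differentiableAt
      refine h2.congr_of_eventuallyEq ?_
      filter_upwards [Ioi_mem_nhds (show lam n < x by linarith)] with z hz
      rw [max_eq_left (by linarith [Set.mem_Ioi.1 hz])]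
  have hk' : DifferentiableAt ℝ (fun x => ((max (x - lam k) 0 : ℝ) : ℂ)) x := by
    have h1 := h x (hlam.1 k)
    have h2 : DifferentiableAt ℝ (fun x : ℝ => ∑ n ∈ (Finset.range N).erase k,
        a n * ((max (x - lam n) 0 : ℝ) : ℂ)) x :=
      DifferentiableAt.fun_sum fun n hn => (hmax n (Finset.ne_of_mem_erase hn)).const_mul _
    have h3 := (h1.sub h2).const_mul (a k)⁻¹
    refine h3.congr_of_eventuallyEq ?_
    filter_upwards [Iio_mem_nhds (show x < x + 1 by linarith)] with z hz
    have hg : (Complex.Gamma (((1 : ℝ) : ℂ) + 1))⁻¹ = 1 := by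
      rw [Complex.ofReal_one, Complex.Gamma_add_one 1 one_ne_zero, Complex.Gamma_one]; simp
    simp only [Pi.sub_apply]
    rw [rieszSum_eq one_pos fun n hn => (le_of_lt hz).trans (hN n hn), hg, one_mul,
      ← Finset.add_sum_erase _ _ (Finset.mem_range.2 hkN)]
    simp only [Real.rpow_one]
    rw [add_sub_cancel_right, inv_mul_cancel_left₀ hk]
  have habs : DifferentiableAt ℝ (fun u : ℝ => |u|) 0 := by
    have h1 : DifferentiableAt ℝ (fun z : ℝ => max (z - lam k) 0) x := by
      have := Complex.reCLM.differentiableAt.comp x hk'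
      exact this
    have h2 : DifferentiableAt ℝ (fun u : ℝ => max u 0) 0 := by
      have h3 : DifferentiableAt ℝ (fun u : ℝ => u + x) 0 := by fun_prop
      have h4 : DifferentiableAt ℝ (fun z : ℝ => max (z - lam k) 0) ((fun u : ℝ => u + x) 0) := by
        simpa using h1
      have := h4.comp (0 : ℝ) h3
      refine this.congr_of_eventuallyEq (Eventually.of_forall fun u => ?_)
      simp [hx]
    refine ((h2.const_mul 2).sub differentiableAt_id).congr_of_eventuallyEq
      (Eventually.of_forall fun u => ?_)
    simp only [Pi.sub_apply, id]
    rcases le_total 0 u with hu | hu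
    · rw [abs_of_nonneg hu, max_eq_left hu]; ring
    · rw [abs_of_nonpos hu, max_eq_right hu]; ring
  exact not_differentiableAt_abs_zero habs

end RieszSum

namespace RieszSum

/-! ### The Cauchy transform of a function on a circle -/

/-- The Cauchy transform `(1/2πi) ∮ f(w)/(z - w) dw` over the circle with centre `z₀` and
radius `R`. -/
noncomputable def cauchyTransform (f : ℂ → ℂ) (z₀ : ℂ) (R : ℝ) (z : ℂ) : ℂ :=
  (2 * (Real.pi : ℂ) * Complex.I)⁻¹ * ∮ w in C(z₀, R), f w * (z - w)⁻¹

theorem continuous_comp_circleMap {f : ℂ → ℂ} {z₀ : ℂ} {R : ℝ} (hR : 0 < R)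
    (hf : ContinuousOn f (Metric.sphere z₀ R)) : Continuous fun θ => f (circleMap z₀ R θ) :=
  hf.comp_continuous (continuous_circleMap z₀ R) fun θ => circleMap_mem_sphere z₀ hR.le θ

theorem continuous_deriv_circleMap (z₀ : ℂ) (R : ℝ) : Continuous (deriv (circleMap z₀ R)) := by
  rw [show deriv (circleMap z₀ R) = fun θ => circleMap 0 R θ * Complex.I from
    funext (deriv_circleMap z₀ R)]
  exact (continuous_circleMap 0 R).mul continuous_const

theorem dist_circleMap_ge {z₀ z : ℂ} {R : ℝ} (hR : 0 < R) (θ : ℝ) :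
    ‖z - z₀‖ - R ≤ ‖z - circleMap z₀ R θ‖ := by
  have h : ‖circleMap z₀ R θ - z₀‖ = R := by
    have := circleMap_mem_sphere z₀ hR.le θ
    rwa [mem_sphere_iff_norm] at this
  have := norm_add_le (z - circleMap z₀ R θ) (circleMap z₀ R θ - z₀)
  rw [sub_add_sub_cancel, h] at this
  linarith

theorem differentiableAt_cauchyTransform {f : ℂ → ℂ} {z₀ : ℂ} {R : ℝ} (hR : 0 < R)
    (hf : ContinuousOn f (Metric.sphere z₀ R)) {z : ℂ} (hz : z ∉ Metric.closedBall z₀ R) :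
    DifferentiableAt ℂ (cauchyTransform f z₀ R) z := by
  refine DifferentiableAt.const_mul ?_ _
  have hz' : R < ‖z - z₀‖ := by simpa [dist_eq_norm] using hz
  obtain ⟨ε, hε, hεz⟩ : ∃ ε, 0 < ε ∧ R + 2 * ε = ‖z - z₀‖ :=
    ⟨(‖z - z₀‖ - R) / 2, by linarith, by ring⟩
  have hlow : ∀ x ∈ Metric.ball z ε, ∀ θ, ε ≤ ‖x - circleMap z₀ R θ‖ := fun x hx θ => by
    have h1 := dist_circleMap_ge (z₀ := z₀) (z := x) hR θ
    have h2 : ‖z - z₀‖ ≤ ‖z - x‖ + ‖x - z₀‖ := norm_sub_le_norm_sub_add_norm_sub _ _ _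
    have h3 : ‖z - x‖ < ε := by rw [norm_sub_rev]; simpa [dist_eq_norm] using hx
    linarith
  have hne : ∀ x ∈ Metric.ball z ε, ∀ θ, x - circleMap z₀ R θ ≠ 0 := fun x hx θ h0 => by
    have := hlow x hx θ
    rw [h0, norm_zero] at this; linarith
  have hfc := continuous_comp_circleMap hR hf
  have hcont : ∀ x ∈ Metric.ball z ε, Continuous fun θ =>
      deriv (circleMap z₀ R) θ • (f (circleMap z₀ R θ) * (x - circleMap z₀ R θ)⁻¹) :=
    fun x hx => (continuous_deriv_circleMap z₀ R).smul (hfc.mul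
      ((continuous_const.sub (continuous_circleMap z₀ R)).inv₀ (hne x hx)))
  have hcont' : Continuous fun θ => deriv (circleMap z₀ R) θ •
      (f (circleMap z₀ R θ) * (-((z - circleMap z₀ R θ) ^ 2)⁻¹)) :=
    (continuous_deriv_circleMap z₀ R).smul (hfc.mul
      ((((continuous_const.sub (continuous_circleMap z₀ R)).pow 2).inv₀ fun θ =>
        pow_ne_zero 2 (hne z (Metric.mem_ball_self hε) θ)).neg))
  refine (intervalIntegral.hasDerivAt_integral_of_dominated_loc_of_deriv_le
    (F' := fun x θ => deriv (circleMap z₀ R) θ •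
      (f (circleMap z₀ R θ) * (-((x - circleMap z₀ R θ) ^ 2)⁻¹)))
    (bound := fun θ => ‖deriv (circleMap z₀ R) θ‖ * (‖f (circleMap z₀ R θ)‖ * (ε ^ 2)⁻¹))
    (Metric.ball_mem_nhds z hε) ?_ ?_ ?_ ?_ ?_ ?_).2.differentiableAt
  · filter_upwards [Metric.ball_mem_nhds z hε] with x hx
    exact (hcont x hx).aestronglyMeasurable
  · exact (hcont z (Metric.mem_ball_self hε)).intervalIntegrable _ _
  · exact hcont'.aestronglyMeasurable
  · refine Eventually.of_forall fun θ _ x hx => ?_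
    rw [norm_smul, norm_mul, norm_neg, norm_inv, norm_pow]
    have := hlow x hx θ
    gcongr
  · exact ((continuous_deriv_circleMap z₀ R).norm.mul
      (hfc.norm.mul continuous_const)).intervalIntegrable _ _
  · refine Eventually.of_forall fun θ _ x hx => ?_
    have h := ((((hasDerivAt_id x).sub_const (circleMap z₀ R θ)).inv (hne x hx θ)).const_mul
      (f (circleMap z₀ R θ))).const_mul (deriv (circleMap z₀ R) θ)
    simpa [div_eq_mul_inv] using h

theorem exists_norm_cauchyTransform_le {f : ℂ → ℂ} {z₀ : ℂ} {R : ℝ} (hR : 0 < R)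
    (hf : ContinuousOn f (Metric.sphere z₀ R)) : ∃ C, 0 ≤ C ∧ ∀ z, R < ‖z - z₀‖ →
      ‖cauchyTransform f z₀ R z‖ ≤ C * (‖z - z₀‖ - R)⁻¹ := by
  obtain ⟨C, hC⟩ := (isCompact_sphere z₀ R).exists_bound_of_continuousOn hf
  refine ⟨R * |C|, by positivity, fun z hz => ?_⟩
  rw [mul_assoc]
  have := circleIntegral.norm_two_pi_i_inv_smul_integral_le_of_norm_le_const (c := z₀) (R := R)
    (f := fun w => f w * (z - w)⁻¹) (C := |C| * (‖z - z₀‖ - R)⁻¹) hR.le (fun w hw => ?_)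
  · simpa [cauchyTransform] using this
  · rw [norm_mul, norm_inv]
    have h1 : ‖z - z₀‖ - R ≤ ‖z - w‖ := by
      have h := norm_sub_le_norm_sub_add_norm_sub z w z₀
      rw [mem_sphere_iff_norm] at hw
      linarith
    have h2 := (hC w hw).trans (le_abs_self C)
    have h3 : 0 < ‖z - z₀‖ - R := by linarith
    gcongr

/-- A function which is analytic in a closed vertical strip outside a disc is the sum of a
function analytic in the closed strip and of its Cauchy transform. -/
theorem exists_cauchy_decomposition {f : ℂ → ℂ} {z₀ : ℂ} {R A B : ℝ} (hR : 0 < R)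
    (hA : A < z₀.re - R) (hB : z₀.re + R < B)
    (hf : ∀ s : ℂ, s.re ∈ Set.Icc A B → s ∉ Metric.ball z₀ R → DifferentiableAt ℂ f s) :
    ∃ g : ℂ → ℂ, (∀ s : ℂ, s.re ∈ Set.Icc A B → DifferentiableAt ℂ g s) ∧
      ∀ s ∉ Metric.closedBall z₀ R, s.re ∈ Set.Icc A B →
        f s = g s + cauchyTransform f z₀ R s := by
  classical
  -- A slightly larger disc inside the strip: between the two circles both descriptions of the
  -- analytic part are available.
  obtain ⟨R', hRR', hR'⟩ := exists_between (show R < min (z₀.re - A) (B - z₀.re) from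
    lt_min (by linarith) (by linarith))
  lift R' to NNReal using (hR.trans hRR').le
  have hR'A := hR'.trans_le (min_le_left _ _)
  have hR'B := hR'.trans_le (min_le_right _ _)
  have hmem : ∀ s ∈ Metric.closedBall z₀ R', s.re ∈ Set.Icc A B := fun s hs => by
    have h1 := (Complex.abs_re_le_norm (s - z₀)).trans (by simpa [dist_eq_norm] using hs)
    rw [Complex.sub_re, abs_le] at h1
    constructor <;> linarith
  have hfd : ∀ s ∈ Metric.closedBall z₀ R', s ∉ Metric.ball z₀ R → DifferentiableAt ℂ f s :=
    fun s hs => hf s (hmem s hs)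
  have hfR : ContinuousOn f (Metric.sphere z₀ R) := fun s hs =>
    (hfd s (Metric.closedBall_subset_closedBall hRR'.le (Metric.sphere_subset_closedBall hs))
      (by simp [Metric.mem_sphere.1 hs])).continuousAt.continuousWithinAt
  have hfR' : ContinuousOn f (Metric.sphere z₀ R') := fun s hs =>
    (hfd s (Metric.sphere_subset_closedBall hs)
      (by simp [Metric.mem_sphere.1 hs, hRR'.le])).continuousAt.continuousWithinAt
  set G : ℂ → ℂ := fun z => (2 * (Real.pi : ℂ) * Complex.I)⁻¹ * ∮ w in C(z₀, R'), f w * (w - z)⁻¹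
  have hGd : ∀ z ∈ Metric.ball z₀ R', DifferentiableAt ℂ G z := fun z hz => by
    have h := hasFPowerSeriesOn_cauchy_integral (R := R') (f := f) (c := z₀)
      (hfR'.circleIntegrable R'.coe_nonneg) (by exact_mod_cast hR.trans hRR')
    have h2 := h.differentiableOn.differentiableAt (x := z)
      (Metric.isOpen_eball.mem_nhds (by
        rw [Metric.mem_eball]; exact edist_lt_coe.2 (NNReal.coe_lt_coe.1 (by rw [coe_nndist]; exact hz))))
    refine h2.congr_of_eventuallyEq (Eventually.of_forall fun z => ?_)
    simp [G, mul_comm]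
  have hann : ∀ z ∈ Metric.ball z₀ R', z ∉ Metric.closedBall z₀ R →
      f z = G z + cauchyTransform f z₀ R z := by
    intro z hz hz'
    have hzf : DifferentiableAt ℂ f z := hfd z (Metric.ball_subset_closedBall hz)
      (fun h => hz' (Metric.ball_subset_closedBall h))
    -- Cauchy's formula for the annulus. The difference quotient of f at z has a removable
    -- singularity, so its integrals over the two circles agree. Subtracting f(z)∮(w - z)⁻¹, which
    -- is 2πi f(z) on the outer circle and 0 on the inner one, leaves the formula.
    have key := Complex.circleIntegral_eq_of_differentiable_on_annulus_off_countable (c := z₀)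
      hR hRR'.le (f := dslope f z) (Set.countable_singleton z) ?_ ?_
    · have hz1 : ∀ ρ : ℝ, 0 ≤ ρ → ContinuousOn f (Metric.sphere z₀ ρ) → z ∉ Metric.sphere z₀ ρ →
          (∮ w in C(z₀, ρ), dslope f z w) = (∮ w in C(z₀, ρ), f w * (w - z)⁻¹) -
            f z * ∮ w in C(z₀, ρ), (w - z)⁻¹ := by
        intro ρ hρ hfρ hzρ
        have hne : ∀ w ∈ Metric.sphere z₀ ρ, w - z ≠ 0 := fun w hw h =>
          hzρ (sub_eq_zero.1 h ▸ hw)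
        have hc : ContinuousOn (fun w => (w - z)⁻¹) (Metric.sphere z₀ ρ) :=
          (continuousOn_id.sub continuousOn_const).inv₀ hne
        have h2 : (f z * ∮ w in C(z₀, ρ), (w - z)⁻¹) = ∮ w in C(z₀, ρ), f z * (w - z)⁻¹ := by
          simp
        rw [h2, ← circleIntegral.integral_sub (f := fun w => f w * (w - z)⁻¹)
          (g := fun w => f z * (w - z)⁻¹) ((hfρ.mul hc).circleIntegrable hρ)
          ((continuousOn_const.mul hc).circleIntegrable hρ)]
        refine circleIntegral.integral_congr hρ fun w hw => ?_
        rw [dslope_of_ne _ (sub_ne_zero.1 (hne w hw)), slope_def_field]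
        ring
      have hzlt : dist z z₀ < R' := hz
      have hzgt : R < dist z z₀ := by simpa using hz'
      have hout : (∮ w in C(z₀, R), (w - z)⁻¹) = 0 := by
        have hne : ∀ w ∈ Metric.closedBall z₀ R, w - z ≠ 0 := fun w hw h =>
          hz' (sub_eq_zero.1 h ▸ hw)
        refine Complex.circleIntegral_eq_zero_of_differentiable_on_off_countable hR.le
          Set.countable_empty ((continuousOn_id.sub continuousOn_const).inv₀ hne) fun w hw => ?_
        exact (differentiableAt_id.sub_const z).inv (hne w (Metric.ball_subset_closedBall hw.1))
      rw [hz1 R' (hR.trans hRR').le hfR' (fun h => hzlt.ne h), hz1 R hR.le hfR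
        (fun h => hzgt.ne' h), hout, circleIntegral.integral_sub_inv_of_mem_ball hz] at key
      have hct : cauchyTransform f z₀ R z =
          -((2 * (Real.pi : ℂ) * Complex.I)⁻¹ * ∮ w in C(z₀, R), f w * (w - z)⁻¹) := by
        rw [cauchyTransform, ← mul_neg]
        congr 1
        have : (fun w => f w * (z - w)⁻¹) = fun w => (-1 : ℂ) * (f w * (w - z)⁻¹) := by
          funext w
          rw [← neg_sub w z, inv_neg]; ring
        rw [this, circleIntegral.integral_const_mul]
        ring
      simp only [G]
      rw [hct, ← mul_neg, ← mul_add, eq_inv_mul_iff_mul_eq₀ Complex.two_pi_I_ne_zero]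
      linear_combination -key
    · intro w hw
      have hwd := hfd w hw.1 hw.2
      refine ContinuousAt.continuousWithinAt ?_
      by_cases h : w = z
      · rw [h]; exact continuousAt_dslope_same.2 hzf
      · exact (continuousAt_dslope_of_ne h).2 hwd.continuousAt
    · intro w hw
      have hwd := hfd w (Metric.ball_subset_closedBall hw.1.1)
        (fun h => hw.1.2 (Metric.ball_subset_closedBall h))
      exact (differentiableAt_dslope_of_ne hw.2).2 hwd
  -- The two definitions coincide on the annulus, hence near every point one of them can be used
  -- throughout.
  refine ⟨fun z => if z ∈ Metric.ball z₀ R' then G z else f z - cauchyTransform f z₀ R z, ?_, ?_⟩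
  · intro s hs
    by_cases h : s ∈ Metric.ball z₀ R'
    · refine (hGd s h).congr_of_eventuallyEq ?_
      filter_upwards [Metric.isOpen_ball.mem_nhds h] with z hz
      rw [if_pos hz]
    · have hs' : s ∉ Metric.closedBall z₀ R := fun h' =>
        h (Metric.closedBall_subset_ball hRR' h')
      refine ((hf s hs fun h' => hs' (Metric.ball_subset_closedBall h')).sub
        (differentiableAt_cauchyTransform hR hfR hs')).congr_of_eventuallyEq ?_
      filter_upwards [Metric.isClosed_closedBall.isOpen_compl.mem_nhds hs'] with z hz
      split_ifs with hz2
      · rw [Pi.sub_apply, hann z hz2 hz]; ring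
      · rfl
  · intro s hs _
    dsimp only
    split_ifs with hz2
    · exact hann s hz2 hs
    · ring

end RieszSum

namespace RieszSum

/-! ### Shifting a vertical line of integration across a circle -/

theorem tendsto_log_sub_log (u v : ℝ) :
    Tendsto (fun t : ℝ => Complex.log (u + t * Complex.I) - Complex.log (v - t * Complex.I))
      atTop (𝓝 (Real.pi * Complex.I)) := by
  have h1 : Tendsto (fun t : ℝ => Complex.log ((u / t : ℝ) + Complex.I)) atTop
      (𝓝 (Complex.log Complex.I)) := by
    refine (continuousAt_clog (x := Complex.I) (by rw [Complex.mem_slitPlane_iff]; simp)).tendsto.comp ?_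
    have : Tendsto (fun t : ℝ => u / t) atTop (𝓝 0) := tendsto_const_nhds.div_atTop tendsto_id
    simpa using ((Complex.continuous_ofReal.tendsto 0).comp this).add_const Complex.I
  have h2 : Tendsto (fun t : ℝ => Complex.log ((v / t : ℝ) - Complex.I)) atTop
      (𝓝 (Complex.log (-Complex.I))) := by
    refine (continuousAt_clog (x := -Complex.I) (by rw [Complex.mem_slitPlane_iff]; simp)).tendsto.comp ?_
    have : Tendsto (fun t : ℝ => v / t) atTop (𝓝 0) := tendsto_const_nhds.div_atTop tendsto_id
    simpa using ((Complex.continuous_ofReal.tendsto 0).comp this).sub_const Complex.I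
  have h3 := h1.sub h2
  rw [Complex.log_I, Complex.log_neg_I] at h3
  convert h3.congr' ?_ using 2
  · ring
  · filter_upwards [eventually_gt_atTop 0] with t ht
    have ht' : (t : ℂ) ≠ 0 := by exact_mod_cast ht.ne'
    have e1 : (u : ℂ) + t * Complex.I = t * ((u / t : ℝ) + Complex.I) := by
      push_cast; field_simp
    have e2 : (v : ℂ) - t * Complex.I = t * ((v / t : ℝ) - Complex.I) := by
      push_cast; field_simp
    have n1 : ((u / t : ℝ) : ℂ) + Complex.I ≠ 0 := fun h => by
      have := congrArg Complex.im h; simp at this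
    have n2 : ((v / t : ℝ) : ℂ) - Complex.I ≠ 0 := fun h => by
      have := congrArg Complex.im h; simp at this
    rw [e1, e2, Complex.log_ofReal_mul ht n1, Complex.log_ofReal_mul ht n2]
    ring

theorem one_add_sq_le_mul {u v V t u₀ : ℝ} (hu₀ : 0 < u₀) (hu : u₀ ≤ |u|) (hv : |v| ≤ V) :
    ‖((u : ℂ) + (t - v : ℝ) * Complex.I)‖⁻¹ ^ 2 ≤ ((1 + 2 * V ^ 2) / u₀ ^ 2 + 2) * (1 + t ^ 2)⁻¹ := by
  have hV : 0 ≤ V := (abs_nonneg v).trans hv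
  have h1 : ‖((u : ℂ) + (t - v : ℝ) * Complex.I)‖ ^ 2 = u ^ 2 + (t - v) ^ 2 := by
    rw [← Complex.normSq_eq_norm_sq, Complex.normSq_add_mul_I]
  have h2 : u₀ ^ 2 ≤ u ^ 2 := by rw [← sq_abs u]; gcongr
  have h3 : v ^ 2 ≤ V ^ 2 := by rw [← sq_abs v]; gcongr
  have hu2 : 0 < u ^ 2 := lt_of_lt_of_le (by positivity) h2
  rw [inv_pow, h1, ← div_eq_mul_inv, inv_eq_one_div, div_le_div_iff₀ (by positivity) (by positivity)]
  have h4 : (1 + 2 * V ^ 2) ≤ (1 + 2 * V ^ 2) / u₀ ^ 2 * u ^ 2 := by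
    rw [div_mul_eq_mul_div, le_div_iff₀ (by positivity)]; gcongr
  have h5 : 0 ≤ (1 + 2 * V ^ 2) / u₀ ^ 2 * (t - v) ^ 2 := by positivity
  nlinarith [sq_nonneg (t - 2 * v)]

/-- Each Cauchy kernel decays only like 1/|t| along its line, but the difference across the strip
decays like 1/t². The bound is uniform in w, as needed for Fubini. -/
theorem norm_inv_sub_inv_le {A B V u₀ t : ℝ} {w : ℂ} (hu₀ : 0 < u₀) (hA : A + u₀ ≤ w.re)
    (hB : w.re + u₀ ≤ B) (hV : |w.im| ≤ V) :
    ‖(B + t * Complex.I - w)⁻¹ - (A + t * Complex.I - w)⁻¹‖ ≤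
      (B - A) * (((1 + 2 * V ^ 2) / u₀ ^ 2 + 2) * (1 + t ^ 2)⁻¹) := by
  have e : ∀ D : ℝ, (D : ℂ) + t * Complex.I - w = (D - w.re : ℝ) + (t - w.im : ℝ) * Complex.I :=
    fun D => by apply Complex.ext <;> simp
  have hne : ∀ D : ℝ, D - w.re ≠ 0 → (D : ℂ) + t * Complex.I - w ≠ 0 := fun D hD h => hD (by
    have := congrArg Complex.re h; simpa using this)
  have hB' : B - w.re ≠ 0 := by linarith
  have hA' : A - w.re ≠ 0 := by linarith
  have h1 := one_add_sq_le_mul (t := t) hu₀ (u := B - w.re) (by rw [abs_of_nonneg] <;> linarith) hV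
  have h2 := one_add_sq_le_mul (t := t) hu₀ (u := A - w.re)
    (by rw [abs_of_nonpos] <;> linarith) hV
  rw [← e] at h1 h2
  rw [inv_sub_inv (hne B hB') (hne A hA'), norm_div, norm_mul, div_eq_mul_inv, mul_inv]
  have h3 : ‖(A : ℂ) + t * Complex.I - w - (B + t * Complex.I - w)‖ = B - A := by
    rw [show (A : ℂ) + t * Complex.I - w - (B + t * Complex.I - w) = ((-(B - A) : ℝ) : ℂ) by
      push_cast; ring, Complex.norm_real, norm_neg, Real.norm_of_nonneg (by linarith)]
  rw [h3]
  refine mul_le_mul_of_nonneg_left ?_ (by linarith)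
  nlinarith [sq_nonneg (‖(B : ℂ) + t * Complex.I - w‖⁻¹ - ‖(A : ℂ) + t * Complex.I - w‖⁻¹)]

theorem integrable_inv_sub_inv {A B : ℝ} {w : ℂ} (hA : A < w.re) (hB : w.re < B) :
    MeasureTheory.Integrable
      fun t : ℝ => (B + t * Complex.I - w)⁻¹ - (A + t * Complex.I - w)⁻¹ := by
  obtain ⟨u₀, h0, h1⟩ := exists_between (show 0 < min (w.re - A) (B - w.re) from
    lt_min (by linarith) (by linarith))
  have h2 := h1.trans_le (min_le_left _ _)
  have h3 := h1.trans_le (min_le_right _ _)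
  refine ((integrable_inv_one_add_sq.const_mul ((1 + 2 * |w.im| ^ 2) / u₀ ^ 2 + 2)).const_mul
    (B - A)).mono' ?_ (Eventually.of_forall fun t =>
      norm_inv_sub_inv_le h0 (by linarith) (by linarith) le_rfl)
  exact (Measurable.sub (by fun_prop) (by fun_prop)).aestronglyMeasurable

/-- The residue theorem for a single simple pole, computed from a primitive: both logarithms have
arguments in the right half-plane, and the combined argument increases from -π to π. -/
theorem integral_inv_sub_inv {A B : ℝ} {w : ℂ} (hA : A < w.re) (hB : w.re < B) :
    ∫ t : ℝ, ((B + t * Complex.I - w)⁻¹ - (A + t * Complex.I - w)⁻¹) = 2 * Real.pi := by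
  set u := B - w.re with hu
  set v := w.re - A with hv
  have hu0 : 0 < u := by linarith
  have hv0 : 0 < v := by linarith
  have e : ∀ t : ℝ, (B + t * Complex.I - w)⁻¹ - (A + t * Complex.I - w)⁻¹ =
      (u + (t - w.im : ℝ) * Complex.I)⁻¹ + (v - (t - w.im : ℝ) * Complex.I)⁻¹ := fun t => by
    rw [← neg_neg ((v : ℂ) - (t - w.im : ℝ) * Complex.I), inv_neg, ← sub_eq_add_neg]
    congr 2 <;> apply Complex.ext <;> simp [hu, hv]
  have hint := integrable_inv_sub_inv hA hB
  simp only [e] at hint ⊢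
  have hint' : MeasureTheory.Integrable fun t : ℝ => 
      ((u : ℂ) + t * Complex.I)⁻¹ + (v - t * Complex.I)⁻¹ := by
    have := hint.comp_add_right w.im
    simpa using this
  rw [MeasureTheory.integral_sub_right_eq_self
    (fun t : ℝ => ((u : ℂ) + t * Complex.I)⁻¹ + (v - t * Complex.I)⁻¹) w.im]
  have key := MeasureTheory.integral_of_hasDerivAt_of_tendsto
    (f := fun t : ℝ => -Complex.I *
      (Complex.log (u + t * Complex.I) - Complex.log (v - t * Complex.I)))
    (m := -Complex.I * (-(Real.pi * Complex.I))) (n := -Complex.I * (Real.pi * Complex.I))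
    (fun t => ?_) hint' ?_ ?_
  · rw [key]
    linear_combination (-2 * Real.pi : ℂ) * Complex.I_mul_I
  · have h0 : HasDerivAt (fun t : ℝ => (t : ℂ) * Complex.I) Complex.I t := by
      simpa using (Complex.ofRealCLM.hasDerivAt (x := t)).mul_const Complex.I
    have h1 := (h0.const_add (u : ℂ)).clog_real (by left; simpa using hu0)
    have h2 := (h0.const_sub (v : ℂ)).clog_real (by left; simpa using hv0)
    refine ((h1.sub h2).const_mul (-Complex.I)).congr_deriv ?_
    linear_combination (-(1 : ℂ) * ((u : ℂ) + (t : ℂ) * Complex.I)⁻¹ -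
      ((v : ℂ) - (t : ℂ) * Complex.I)⁻¹) * Complex.I_mul_I
  · have := (tendsto_log_sub_log v u).comp tendsto_neg_atBot_atTop
    refine (this.neg.const_mul (-Complex.I)).congr fun t => ?_
    simp only [Function.comp_apply, Complex.ofReal_neg]
    ring_nf
  · exact (tendsto_log_sub_log u v).const_mul _

theorem continuous_re_add_mul_I (A : ℝ) : Continuous fun t : ℝ => (A : ℂ) + t * Complex.I := by
  fun_prop

/-- Fubini: every point w of the circle contributes 2π to the difference of the line integrals
wherever it lies, so the total is 2π times the normalised circle integral. No information on the
singularities inside is required. -/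
theorem integral_cauchyTransform_sub {f : ℂ → ℂ} {z₀ : ℂ} {R A B : ℝ} (hR : 0 < R)
    (hA : A < z₀.re - R) (hB : z₀.re + R < B) (hf : ContinuousOn f (Metric.sphere z₀ R)) :
    MeasureTheory.Integrable (fun t : ℝ => cauchyTransform f z₀ R (B + t * Complex.I) -
      cauchyTransform f z₀ R (A + t * Complex.I)) ∧
    ∫ t : ℝ, (cauchyTransform f z₀ R (B + t * Complex.I) -
      cauchyTransform f z₀ R (A + t * Complex.I)) =
      2 * Real.pi * ((2 * (Real.pi : ℂ) * Complex.I)⁻¹ * ∮ w in C(z₀, R), f w) := by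
  obtain ⟨u₀, h0, h1⟩ := exists_between (show 0 < min (z₀.re - R - A) (B - (z₀.re + R)) from
    lt_min (by linarith) (by linarith))
  have hu1 := h1.trans_le (min_le_left _ _)
  have hu2 := h1.trans_le (min_le_right _ _)
  have hfc := continuous_comp_circleMap hR hf
  have hcirc : ∀ θ, ‖circleMap z₀ R θ - z₀‖ = R := fun θ => by
    have := circleMap_mem_sphere z₀ hR.le θ
    rwa [mem_sphere_iff_norm] at this
  have hre : ∀ θ, |(circleMap z₀ R θ).re - z₀.re| ≤ R := fun θ => by
    have h := Complex.abs_re_le_norm (circleMap z₀ R θ - z₀)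
    rwa [hcirc, Complex.sub_re] at h
  have him : ∀ θ, |(circleMap z₀ R θ).im| ≤ |z₀.im| + R := fun θ => by
    have h := Complex.abs_im_le_norm (circleMap z₀ R θ - z₀)
    rw [hcirc, Complex.sub_im] at h
    have := abs_add_le ((circleMap z₀ R θ).im - z₀.im) z₀.im
    rw [sub_add_cancel] at this
    linarith
  have hAw : ∀ θ, A + u₀ ≤ (circleMap z₀ R θ).re := fun θ => by
    have := abs_le.1 (hre θ); linarith
  have hBw : ∀ θ, (circleMap z₀ R θ).re + u₀ ≤ B := fun θ => by
    have := abs_le.1 (hre θ); linarith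
  have hne : ∀ D : ℝ, (∀ θ, D ≠ (circleMap z₀ R θ).re) → ∀ (t θ : ℝ),
      (D : ℂ) + t * Complex.I - circleMap z₀ R θ ≠ 0 := fun D hD t θ h => hD θ (by
    have := congrArg Complex.re h
    simp only [Complex.sub_re, Complex.add_re, Complex.ofReal_re, Complex.mul_re, Complex.I_re,
      mul_zero, Complex.ofReal_im, Complex.I_im, mul_one, sub_self, add_zero,
      Complex.zero_re] at this
    linarith)
  have hneA := hne A fun θ => by have := hAw θ; linarith
  have hneB := hne B fun θ => by have := hBw θ; linarith
  set k : ℝ → ℝ → ℂ := fun θ t => deriv (circleMap z₀ R) θ * f (circleMap z₀ R θ) *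
    ((B + t * Complex.I - circleMap z₀ R θ)⁻¹ - (A + t * Complex.I - circleMap z₀ R θ)⁻¹) with hk
  have hk1 : ∀ t : ℝ, cauchyTransform f z₀ R (B + t * Complex.I) -
      cauchyTransform f z₀ R (A + t * Complex.I) =
      (2 * (Real.pi : ℂ) * Complex.I)⁻¹ * ∫ θ in Set.Ioc 0 (2 * Real.pi), k θ t := fun t => by
    have hi : ∀ D : ℝ, (∀ θ : ℝ, (D : ℂ) + t * Complex.I - circleMap z₀ R θ ≠ 0) →
        IntervalIntegrable (fun θ => deriv (circleMap z₀ R) θ • (f (circleMap z₀ R θ) *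
          (D + t * Complex.I - circleMap z₀ R θ)⁻¹)) MeasureTheory.volume 0 (2 * Real.pi) :=
      fun D hD => (Continuous.smul (continuous_deriv_circleMap z₀ R) (hfc.mul
        ((continuous_const.sub (continuous_circleMap z₀ R)).inv₀ hD))).intervalIntegrable _ _
    rw [cauchyTransform, cauchyTransform, ← mul_sub, circleIntegral, circleIntegral,
      ← intervalIntegral.integral_sub (hi B (hneB t)) (hi A (hneA t)),
      intervalIntegral.integral_of_le Real.two_pi_pos.le]
    congr 2
    funext θ
    simp only [hk, smul_eq_mul]
    ring
  have hkint : MeasureTheory.Integrable (Function.uncurry k)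
      ((MeasureTheory.volume.restrict (Set.Ioc 0 (2 * Real.pi))).prod MeasureTheory.volume) := by
    obtain ⟨M, hM⟩ := (isCompact_sphere z₀ R).exists_bound_of_continuousOn hf
    have hb := ((integrable_inv_one_add_sq.const_mul
      ((1 + 2 * (|z₀.im| + R) ^ 2) / u₀ ^ 2 + 2)).const_mul (B - A)).const_mul (R * M)
    refine (hb.comp_snd (MeasureTheory.volume.restrict (Set.Ioc 0 (2 * Real.pi)))).mono' ?_ ?_
    · refine Continuous.aestronglyMeasurable ?_
      simp only [hk, Function.uncurry_def]
      refine (((continuous_deriv_circleMap z₀ R).comp continuous_fst).mul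
        (hfc.comp continuous_fst)).mul (Continuous.sub (Continuous.inv₀ ?_ fun x => hneB x.2 x.1)
        (Continuous.inv₀ ?_ fun x => hneA x.2 x.1))
      · have := (continuous_circleMap z₀ R).comp (continuous_fst (X := ℝ) (Y := ℝ))
        exact Continuous.sub (by fun_prop) this
      · have := (continuous_circleMap z₀ R).comp (continuous_fst (X := ℝ) (Y := ℝ))
        exact Continuous.sub (by fun_prop) this
    · refine Eventually.of_forall fun x => ?_
      have hM' := hM _ (circleMap_mem_sphere z₀ hR.le x.1)
      simp only [hk, Function.uncurry_def, norm_mul, deriv_circleMap, circleMap_zero,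
        Complex.norm_real, Complex.norm_exp_ofReal_mul_I, Complex.norm_I, mul_one,
        Real.norm_of_nonneg hR.le]
      exact mul_le_mul (mul_le_mul_of_nonneg_left hM' hR.le)
        (norm_inv_sub_inv_le h0 (hAw _) (hBw _) (him _)) (norm_nonneg _)
        (mul_nonneg hR.le ((norm_nonneg _).trans hM'))
  have hswap := MeasureTheory.integral_integral_swap hkint
  simp only [hk1]
  refine ⟨(hkint.integral_prod_right).const_mul _, ?_⟩
  rw [MeasureTheory.integral_const_mul, ← hswap]
  have : ∀ θ, ∫ t, k θ t = deriv (circleMap z₀ R) θ * f (circleMap z₀ R θ) * (2 * Real.pi) :=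
    fun θ => by
      simp only [hk]
      rw [MeasureTheory.integral_const_mul, integral_inv_sub_inv]
      · linarith [hAw θ]
      · linarith [hBw θ]
  simp only [this]
  rw [MeasureTheory.integral_mul_const, circleIntegral,
    intervalIntegral.integral_of_le Real.two_pi_pos.le]
  simp only [smul_eq_mul]
  ring

theorem integrable_of_decay {f : ℂ → ℂ} {A C t₀ : ℝ} (hc : Continuous fun t : ℝ => f (A + t * Complex.I))
    (h : ∀ t : ℝ, t₀ ≤ |t| → ‖f (A + t * Complex.I)‖ ≤ C * |t| ^ (-2 : ℝ)) :
    MeasureTheory.Integrable fun t : ℝ => f (A + t * Complex.I) := by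
  have hO : (fun t : ℝ => f (A + t * Complex.I)) =O[cocompact ℝ] fun t : ℝ => |t| ^ (-2 : ℝ) := by
    refine Asymptotics.IsBigO.of_bound C ?_
    filter_upwards [tendsto_norm_cocompact_atTop.eventually_ge_atTop t₀] with t ht
    rw [Real.norm_of_nonneg (by positivity)]
    exact h t ht
  refine (hc.locallyIntegrable (μ := MeasureTheory.volume)).integrable_of_isBigO_cocompact hO ?_
  -- The comparison function is singular at 0, so its integrability is asserted near infinity only,
  -- where it is at most 2/(1 + t²).
  refine ⟨{t | 1 ≤ |t|}, ?_, ?_⟩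
  · exact tendsto_norm_cocompact_atTop.eventually_ge_atTop 1
  · refine ((integrable_inv_one_add_sq.const_mul 2).integrableOn).mono'
      (measurable_id.abs.pow_const _).aestronglyMeasurable ?_
    filter_upwards [MeasureTheory.ae_restrict_mem (measurableSet_le measurable_const
      measurable_norm)] with t ht
    have ht' : 1 ≤ |t| := ht
    rw [Real.norm_of_nonneg (by positivity), Real.rpow_neg (abs_nonneg t), Real.rpow_two, sq_abs,
      ← div_eq_mul_inv, inv_eq_one_div, div_le_div_iff₀ (by rw [← sq_abs]; positivity)
      (by positivity)]
    nlinarith [sq_abs t]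

/-- Shifting the line of integration of a function `O(|s|⁻²)` across a circle which contains its
singularities. -/
theorem integral_sub_integral_eq_circleIntegral {f : ℂ → ℂ} {z₀ : ℂ} {R A B C t₀ : ℝ} (hR : 0 < R)
    (hA : A < z₀.re - R) (hB : z₀.re + R < B)
    (hf : ∀ s : ℂ, s.re ∈ Set.Icc A B → s ∉ Metric.ball z₀ R → DifferentiableAt ℂ f s)
    (hdec : ∀ s : ℂ, s.re ∈ Set.Icc A B → t₀ ≤ |s.im| → ‖f s‖ ≤ C * |s.im| ^ (-2 : ℝ)) :
    MeasureTheory.Integrable (fun t : ℝ => f (A + t * Complex.I)) ∧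
    MeasureTheory.Integrable (fun t : ℝ => f (B + t * Complex.I)) ∧
    (∫ t : ℝ, f (B + t * Complex.I)) - (∫ t : ℝ, f (A + t * Complex.I)) =
      2 * Real.pi * ((2 * (Real.pi : ℂ) * Complex.I)⁻¹ * ∮ w in C(z₀, R), f w) := by
  have hre : ∀ s ∈ Metric.closedBall z₀ R, |s.re - z₀.re| ≤ R := fun s hs => by
    rw [← Complex.sub_re]
    exact (Complex.abs_re_le_norm _).trans (by simpa [dist_eq_norm] using hs)
  have houtA : ∀ t : ℝ, (A : ℂ) + t * Complex.I ∉ Metric.closedBall z₀ R := fun t h => by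
    have := abs_le.1 (hre _ h)
    simp at this; linarith
  have houtB : ∀ t : ℝ, (B : ℂ) + t * Complex.I ∉ Metric.closedBall z₀ R := fun t h => by
    have := abs_le.1 (hre _ h)
    simp at this; linarith
  have hAI : A ∈ Set.Icc A B := ⟨le_rfl, by linarith⟩
  have hBI : B ∈ Set.Icc A B := ⟨by linarith, le_rfl⟩
  have hline : ∀ D : ℝ, D ∈ Set.Icc A B → (∀ t : ℝ, (D : ℂ) + t * Complex.I ∉
      Metric.closedBall z₀ R) → MeasureTheory.Integrable fun t : ℝ => f (D + t * Complex.I) := by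
    intro D hD hout
    refine integrable_of_decay (C := C) (t₀ := t₀) ?_ fun t ht => ?_
    · refine continuous_iff_continuousAt.2 fun t => ?_
      exact ContinuousAt.comp (f := fun t : ℝ => (D : ℂ) + t * Complex.I)
        (hf _ (by simpa using hD) fun h => hout t (Metric.ball_subset_closedBall h)).continuousAt
        (continuous_re_add_mul_I D).continuousAt
    · simpa using hdec (D + t * Complex.I) (by simpa using hD) (by simpa using ht)
  have hfA := hline A hAI houtA
  have hfB := hline B hBI houtB
  refine ⟨hfA, hfB, ?_⟩
  have hfs : ContinuousOn f (Metric.sphere z₀ R) := fun s hs => by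
    have := abs_le.1 (hre s (Metric.sphere_subset_closedBall hs))
    exact (hf s ⟨by linarith, by linarith⟩
      (by simp [Metric.mem_sphere.1 hs])).continuousAt.continuousWithinAt
  obtain ⟨g, hgd, hg⟩ := exists_cauchy_decomposition hR hA hB hf
  obtain ⟨hHi, hH⟩ := integral_cauchyTransform_sub hR hA hB hfs
  obtain ⟨C', hC', hHb⟩ := exists_norm_cauchyTransform_le hR hfs
  have hgA : ∀ t : ℝ, g (A + t * Complex.I) =
      f (A + t * Complex.I) - cauchyTransform f z₀ R (A + t * Complex.I) := fun t =>
    eq_sub_of_add_eq (hg _ (houtA t) (by simpa using hAI)).symm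
  have hgB : ∀ t : ℝ, g (B + t * Complex.I) =
      f (B + t * Complex.I) - cauchyTransform f z₀ R (B + t * Complex.I) := fun t =>
    eq_sub_of_add_eq (hg _ (houtB t) (by simpa using hBI)).symm
  -- After removal of the Cauchy transform the analytic part g inherits a tail of order 1/|t|, so
  -- only the difference over the two lines is known to be integrable. That decay still makes the
  -- horizontal sides of the rectangles tend to 0.
  have hgi : MeasureTheory.Integrable fun t : ℝ =>
      g (B + t * Complex.I) - g (A + t * Complex.I) := by
    refine ((hfB.sub hfA).sub hHi).congr (Eventually.of_forall fun t => ?_)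
    simp only [Pi.sub_apply, hgA, hgB]; ring
  have hg0 : ∫ t : ℝ, (g (B + t * Complex.I) - g (A + t * Complex.I)) = 0 := by
    have hlim := MeasureTheory.intervalIntegral_tendsto_integral hgi tendsto_neg_atTop_atBot
      tendsto_id
    refine tendsto_nhds_unique hlim ?_
    have hgline : ∀ D : ℝ, D ∈ Set.Icc A B → Continuous fun t : ℝ => g (D + t * Complex.I) :=
      fun D hD => continuous_iff_continuousAt.2 fun t =>
        ContinuousAt.comp (f := fun t : ℝ => (D : ℂ) + t * Complex.I)
          (hgd _ (by simpa using hD)).continuousAt (continuous_re_add_mul_I D).continuousAt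
    have hrect : ∀ T : ℝ, 0 < T →
        ∫ t in (-T)..T, (g (B + t * Complex.I) - g (A + t * Complex.I)) =
        Complex.I * ((∫ x in A..B, g (x + (-T : ℝ) * Complex.I)) -
          ∫ x in A..B, g (x + T * Complex.I)) := fun T hT => by
      have h := Complex.integral_boundary_rect_eq_zero_of_differentiableOn g
        ⟨A, -T⟩ ⟨B, T⟩ fun s hs => (hgd s (by
          have := hs.1; rwa [Set.mem_preimage, Set.uIcc_of_le (by linarith)] at this)).differentiableWithinAt
      simp only [smul_eq_mul] at h
      rw [intervalIntegral.integral_sub ((hgline B hBI).intervalIntegrable _ _)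
        ((hgline A hAI).intervalIntegrable _ _)]
      linear_combination (-Complex.I) * h + ((∫ t in (-T)..T, g (B + t * Complex.I)) -
        ∫ t in (-T)..T, g (A + t * Complex.I)) * Complex.I_mul_I
    have hbd : ∀ s : ℂ, s.re ∈ Set.Icc A B → max t₀ (|z₀.im| + R + 1) ≤ |s.im| →
        ‖g s‖ ≤ C * |s.im| ^ (-2 : ℝ) + C' * (|s.im| - |z₀.im| - R)⁻¹ := fun s hs ht => by
      have h1 : |s.im| - |z₀.im| ≤ ‖s - z₀‖ :=
        (abs_sub_abs_le_abs_sub _ _).trans ((Complex.sub_im s z₀) ▸ Complex.abs_im_le_norm (s - z₀))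
      have h2 := (le_max_right _ _).trans ht
      have h3 : R < ‖s - z₀‖ := by linarith
      have h4 := hg s (by simpa [dist_eq_norm] using h3) hs
      rw [eq_sub_of_add_eq h4.symm]
      refine (norm_sub_le _ _).trans (add_le_add (hdec s hs ((le_max_left _ _).trans ht))
        ((hHb s h3).trans ?_))
      have : 0 < |s.im| - |z₀.im| - R := by linarith
      gcongr
    have hε : Tendsto (fun T : ℝ => (C * T ^ (-2 : ℝ) + C' * (T - |z₀.im| - R)⁻¹) * |B - A|)
        atTop (𝓝 0) := by
      have h1 := (tendsto_rpow_neg_atTop (y := 2) (by norm_num)).const_mul C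
      have h2 : Tendsto (fun T : ℝ => T - |z₀.im| - R) atTop atTop := by
        simpa [sub_eq_add_neg] using tendsto_atTop_add_const_right atTop (-R)
          (tendsto_atTop_add_const_right atTop (-|z₀.im|) tendsto_id)
      simpa using (h1.add ((tendsto_inv_atTop_zero.comp h2).const_mul C')).mul_const |B - A|
    have hhor : ∀ T' : ℝ → ℝ, (∀ T, |T' T| = |T|) →
        Tendsto (fun T : ℝ => ∫ x in A..B, g (x + T' T * Complex.I)) atTop (𝓝 0) := by
      intro T' hT'
      refine squeeze_zero_norm' ?_ hε
      filter_upwards [eventually_ge_atTop (max t₀ (|z₀.im| + R + 1)), eventually_ge_atTop 0]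
        with T hT hT0
      refine intervalIntegral.norm_integral_le_of_norm_le_const fun x hx => ?_
      rw [Set.uIoc_of_le (by linarith)] at hx
      have := hbd (x + T' T * Complex.I) (by simpa using ⟨hx.1.le, hx.2⟩)
        (by simpa [hT', abs_of_nonneg hT0] using hT)
      simpa [hT', abs_of_nonneg hT0] using this
    have h3 := ((hhor (fun T => -T) fun T => abs_neg T).sub (hhor (fun T => T) fun T => rfl)).const_mul
      Complex.I
    rw [sub_zero, mul_zero] at h3
    refine h3.congr' ?_
    filter_upwards [eventually_gt_atTop 0] with T hT
    exact (hrect T hT).symm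
  rw [← MeasureTheory.integral_sub hfB hfA, ← hH]
  have : ∀ t : ℝ, f (B + t * Complex.I) - f (A + t * Complex.I) =
      (g (B + t * Complex.I) - g (A + t * Complex.I)) +
      (cauchyTransform f z₀ R (B + t * Complex.I) - cauchyTransform f z₀ R (A + t * Complex.I)) :=
    fun t => by rw [hgA, hgB]; ring
  simp only [this]
  rw [MeasureTheory.integral_add hgi hHi, hg0, zero_add]

end RieszSum

namespace RieszSum

/-! ### Polynomial growth of the continued Dirichlet series -/

/-- By Stirling, 1/Γ grows at most exponentially on vertical lines. This is harmless beside the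
doubly exponential growth allowed for χ, so φ satisfies a condition of the same kind. -/
theorem exists_norm_inv_Gamma_le (M : ℝ) : ∃ B t₀ : ℝ, 0 ≤ B ∧ 0 < t₀ ∧ ∀ w : ℂ, ‖w‖ ≤ M →
    ∀ t : ℝ, t₀ ≤ |t| → ‖(Complex.Gamma (w + t * Complex.I))⁻¹‖ ≤ Real.exp (B * |t|) := by
  obtain ⟨C, t₀, hC, ht₀, h⟩ := Gamma_stirling M
  set B : ℝ := Real.pi / 2 + (|M| + 1 / 2) + |M| * (Real.pi / 2) with hB
  have key : ∀ w : ℂ, ‖w‖ ≤ M → ∀ t : ℝ, max t₀ (max 1 (2 * C)) ≤ t →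
      ‖(Complex.Gamma (w + t * Complex.I))⁻¹‖ ≤ Real.exp (B * t) := by
    intro w hw t ht
    have h0 := (le_max_left _ _).trans ht
    have h1 := (le_max_left _ _).trans ((le_max_right _ _).trans ht)
    have h2 := (le_max_right _ _).trans ((le_max_right _ _).trans ht)
    have htpos : 0 < t := by linarith
    set S := stirlingExp w t with hS
    have h3 := h w hw t h0
    have hpi : 2 ≤ √(2 * Real.pi) := Real.le_sqrt_of_sq_le (by nlinarith [Real.pi_gt_three])
    have h4 : C / t ≤ 1 / 2 := by rw [div_le_iff₀ htpos]; linarith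
    have h5 : 1 / 2 ≤ ‖Complex.Gamma (w + t * Complex.I) * Complex.exp (-S) /
        ((√(2 * Real.pi) : ℝ) : ℂ)‖ := by
      have := norm_sub_norm_le (1 : ℂ) (1 - Complex.Gamma (w + t * Complex.I) *
        Complex.exp (-S) / ((√(2 * Real.pi) : ℝ) : ℂ))
      rw [sub_sub_cancel, norm_one, norm_sub_rev] at this
      linarith
    rw [norm_div, norm_mul, Complex.norm_exp, Complex.norm_real, Real.norm_of_nonneg (by positivity),
      le_div_iff₀ (by positivity), Complex.neg_re] at h5
    have h6 : 1 ≤ ‖Complex.Gamma (w + t * Complex.I)‖ * Real.exp (-S.re) := by linarith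
    have hG : 0 < ‖Complex.Gamma (w + t * Complex.I)‖ := by
      by_contra hcon
      have : ‖Complex.Gamma (w + t * Complex.I)‖ = 0 := le_antisymm (not_lt.1 hcon) (norm_nonneg _)
      rw [this, zero_mul] at h6
      linarith
    rw [norm_inv, inv_le_iff_one_le_mul₀' hG]
    refine h6.trans (mul_le_mul_of_nonneg_left (Real.exp_le_exp.2 ?_) hG.le)
    have hre : S.re = -(Real.pi * t / 2) + ((w.re - 1 / 2) * Real.log t - w.im * (Real.pi / 2)) := by
      rw [hS, stirlingExp]
      simp [Complex.sub_re, Complex.mul_re, Complex.normSq]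
    have hl0 : 0 ≤ Real.log t := Real.log_nonneg h1
    have hl1 : Real.log t ≤ t := (Real.log_le_sub_one_of_pos htpos).trans (by linarith)
    have hwr := abs_le.1 ((Complex.abs_re_le_norm w).trans (hw.trans (le_abs_self M)))
    have hwi := abs_le.1 ((Complex.abs_im_le_norm w).trans (hw.trans (le_abs_self M)))
    have hp := Real.pi_pos
    rw [hre, hB]
    have e1 : -((w.re - 1 / 2) * Real.log t) ≤ (|M| + 1 / 2) * t := by
      calc -((w.re - 1 / 2) * Real.log t) = (1 / 2 - w.re) * Real.log t := by ring
        _ ≤ (|M| + 1 / 2) * Real.log t := mul_le_mul_of_nonneg_right (by linarith) hl0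
        _ ≤ _ := mul_le_mul_of_nonneg_left hl1 (by positivity)
    have e2 : w.im * (Real.pi / 2) ≤ |M| * (Real.pi / 2) * t :=
      calc w.im * (Real.pi / 2) ≤ |M| * (Real.pi / 2) :=
            mul_le_mul_of_nonneg_right hwi.2 (by positivity)
        _ ≤ _ := le_mul_of_one_le_right (by positivity) h1
    nlinarith
  refine ⟨B, max t₀ (max 1 (2 * C)), by positivity, by positivity, fun w hw t ht => ?_⟩
  rcases le_total 0 t with h0 | h0
  · rw [abs_of_nonneg h0] at ht ⊢
    exact key w hw t ht
  · rw [abs_of_nonpos h0] at ht ⊢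
    have := key (starRingEnd ℂ w) (by simpa using hw) (-t) ht
    rw [← Complex.norm_conj, map_inv₀, ← Complex.Gamma_conj]
    simpa using this

theorem exists_norm_inv_gammaFactor_le {r : ℕ} {α : Fin r → ℝ} (hα : ∀ i, 0 < α i)
    (β : Fin r → ℂ) (c₁ c₂ : ℝ) : ∃ B t₀ : ℝ, 0 ≤ B ∧ 0 < t₀ ∧ ∀ s : ℂ,
      s.re ∈ Set.Icc c₁ c₂ → t₀ ≤ |s.im| →
      ‖(gammaFactor α β s)⁻¹‖ ≤ Real.exp (B * |s.im|) := by
  have h1 : ∀ i, ∃ B t₀ : ℝ, 0 ≤ B ∧ 0 < t₀ ∧ ∀ s : ℂ, s.re ∈ Set.Icc c₁ c₂ → t₀ ≤ |s.im| →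
      ‖(Complex.Gamma (α i * s + β i))⁻¹‖ ≤ Real.exp (B * |s.im|) := by
    intro i
    obtain ⟨B, t₀, hB, ht₀, h⟩ := exists_norm_inv_Gamma_le (α i * max |c₁| |c₂| + ‖β i‖)
    refine ⟨B * α i, t₀ / α i, mul_nonneg hB (hα i).le, div_pos ht₀ (hα i), fun s hs ht => ?_⟩
    have := h (α i * (s.re : ℂ) + β i) ((norm_add_le _ _).trans (by
      rw [norm_mul, Complex.norm_real, Complex.norm_real, Real.norm_of_nonneg (hα i).le,
        Real.norm_eq_abs]
      have := abs_le_max_abs_abs hs.1 hs.2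
      have := (hα i).le
      gcongr)) (α i * s.im) (by
        rw [abs_mul, abs_of_pos (hα i), mul_comm]; exact (div_le_iff₀ (hα i)).1 ht)
    rw [abs_mul, abs_of_pos (hα i), ← mul_assoc] at this
    convert this using 4
    apply Complex.ext
    · simp
    · simp [add_comm]
  choose B t₀ hB ht₀ h using h1
  refine ⟨∑ i, B i, 1 + ∑ i, t₀ i, Finset.sum_nonneg fun i _ => hB i,
    by have := Finset.sum_nonneg fun i (_ : i ∈ Finset.univ) => (ht₀ i).le; positivity,
    fun s hs ht => ?_⟩
  rw [gammaFactor, ← Finset.prod_inv_distrib, norm_prod, Finset.sum_mul, Real.exp_sum]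
  refine Finset.prod_le_prod (fun i _ => norm_nonneg _) fun i _ => h i s hs ?_
  have := Finset.single_le_sum (fun i (_ : i ∈ Finset.univ) => (ht₀ i).le) (Finset.mem_univ i)
  linarith

theorem HasAbscissa.summable {a : ℕ → ℂ} {lam : ℕ → ℝ} {σ q : ℝ} (h : HasAbscissa a lam σ)
    (hlam : IsFrequencySequence lam) (hq : σ < q) :
    Summable fun n => ‖a n‖ * lam n ^ (-q) := by
  obtain ⟨x, hx, hxq⟩ : ∃ x ∈ {x : ℝ | Summable fun n => ‖a n‖ * lam n ^ (-x)}, x < q := by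
    by_contra! hcon
    exact absurd (h.2 hcon) (not_le.2 hq)
  refine Summable.of_nonneg_of_le (fun n => mul_nonneg (norm_nonneg _)
    (Real.rpow_nonneg (hlam.1 n).le _)) (fun n => ?_) (hx.mul_left (lam 0 ^ (-(q - x))))
  have h0 : lam 0 ≤ lam n := hlam.2.1.monotone (Nat.zero_le n)
  calc ‖a n‖ * lam n ^ (-q) = lam n ^ (-(q - x)) * (‖a n‖ * lam n ^ (-x)) := by
        rw [mul_left_comm, ← Real.rpow_add (hlam.1 n)]; ring_nf
    _ ≤ _ := mul_le_mul_of_nonneg_right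
        (Real.rpow_le_rpow_of_nonpos (hlam.1 0) h0 (by linarith))
        (mul_nonneg (norm_nonneg _) (Real.rpow_nonneg (hlam.1 n).le _))

theorem norm_dirichlet_term {a : ℕ → ℂ} {lam : ℕ → ℝ} (hlam : ∀ n, 0 < lam n) (s : ℂ) (n : ℕ) :
    ‖a n * (lam n : ℂ) ^ (-s)‖ = ‖a n‖ * lam n ^ (-s.re) := by
  rw [norm_mul, Complex.norm_cpow_eq_rpow_re_of_pos (hlam n), Complex.neg_re]

theorem norm_dirichletSeries_le {a : ℕ → ℂ} {lam : ℕ → ℝ} (hlam : ∀ n, 0 < lam n) {s : ℂ}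
    (h : Summable fun n => ‖a n‖ * lam n ^ (-s.re)) :
    ‖dirichletSeries a lam s‖ ≤ ∑' n, ‖a n‖ * lam n ^ (-s.re) := by
  simp only [← norm_dirichlet_term hlam] at h ⊢
  exact norm_tsum_le_tsum_norm h

theorem isRegularPoint_of_re_pos {r : ℕ} {α : Fin r → ℝ} {β : Fin r → ℂ} (hα : ∀ i, 0 < α i)
    (hβ : ∀ i, 0 ≤ (β i).re) {s : ℂ} (hs : 0 < s.re) : IsRegularPoint α β s := fun i k h => by
  have h1 := congrArg Complex.re h
  simp at h1
  have := mul_pos (hα i) hs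
  have := hβ i
  have : (0 : ℝ) ≤ k := k.cast_nonneg
  linarith

theorem gammaFactor_ne_zero {r : ℕ} {α : Fin r → ℝ} {β : Fin r → ℂ} {s : ℂ}
    (h : IsRegularPoint α β s) : gammaFactor α β s ≠ 0 :=
  Finset.prod_ne_zero_iff.2 fun i _ => Complex.Gamma_ne_zero (h i)

theorem differentiable_inv_gammaFactor {r : ℕ} (α : Fin r → ℝ) (β : Fin r → ℂ) :
    Differentiable ℂ fun s => (gammaFactor α β s)⁻¹ := by
  simp only [gammaFactor, ← Finset.prod_inv_distrib]
  refine Differentiable.fun_finsetProd fun i _ => ?_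
  exact Complex.differentiable_one_div_Gamma.comp
    ((differentiable_id.const_mul _).add_const _)

/-! ### The continuation of φ and its growth -/

section

variable {r : ℕ} {a b : ℕ → ℂ} {lam mu : ℕ → ℝ} {σa σb δ Q : ℝ} {ω : ℂ}
    {α : Fin r → ℝ} {β : Fin r → ℂ} {S : Set ℂ} {χ : ℂ → ℂ}

theorem InClassC.differentiableAt_phiCont (hC : InClassC a b lam mu σa σb δ Q ω α β S χ) {s : ℂ}
    (hs : s ∉ S) : DifferentiableAt ℂ (phiCont Q α β χ) s := by
  have hQ : (Q : ℂ) ≠ 0 := by exact_mod_cast hC.Q_pos.ne'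
  refine DifferentiableAt.mul (DifferentiableAt.mul ?_ ?_) (differentiable_inv_gammaFactor α β s)
  · exact (differentiableAt_id.neg).const_cpow (Or.inl hQ)
  · exact hC.analytic.differentiableAt (hC.compact.isClosed.isOpen_compl.mem_nhds hs)

theorem InClassC.phiCont_eq_right (hC : InClassC a b lam mu σa σb δ Q ω α β S χ) {s : ℂ}
    (hs : s ∉ S) (h1 : σa < s.re) (h2 : 0 < s.re) :
    phiCont Q α β χ s = dirichletSeries a lam s := by
  have hQ : (Q : ℂ) ≠ 0 := by exact_mod_cast hC.Q_pos.ne'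
  have hreg := isRegularPoint_of_re_pos hC.α_pos hC.β_re h2
  rw [phiCont, hC.eq_right s hs h1 hreg, Complex.cpow_neg]
  have := gammaFactor_ne_zero hreg
  have hQs : (Q : ℂ) ^ s ≠ 0 := by simp [Complex.cpow_eq_zero_iff, hQ]
  field_simp

theorem InClassC.phiCont_eq_left (hC : InClassC a b lam mu σa σb δ Q ω α β S χ) {s : ℂ}
    (hs : s ∉ S) (h1 : s.re < δ - σb) (h2 : s.re < δ) :
    phiCont Q α β χ s = ω * (Q : ℂ) ^ ((δ : ℂ) - 2 * s) *
      starRingEnd ℂ (dirichletSeries b mu (δ - starRingEnd ℂ s)) * factorRatio δ α β (δ - s) := by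
  have hQ : (Q : ℂ) ≠ 0 := by exact_mod_cast hC.Q_pos.ne'
  have hreg := isRegularPoint_of_re_pos (s := δ - starRingEnd ℂ s) hC.α_pos hC.β_re
    (by simpa using h2)
  rw [phiCont, hC.eq_left s hs h1 hreg, map_mul, gammaFactor_conj, factorRatio]
  simp only [map_sub, Complex.conj_ofReal, Complex.conj_conj, sub_sub_cancel]
  rw [show (δ : ℂ) - 2 * s = -s + (δ - s) by ring, Complex.cpow_add _ _ hQ]
  ring

/-- The continuation of `φ` is of polynomial growth in the strip (Phragmén--Lindelöf). -/
theorem InClassC.exists_norm_phiCont_le (hC : InClassC a b lam mu σa σb δ Q ω α β S χ)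
    {q R : ℝ} {z₀ : ℂ} (hq0 : 0 < q) (hqa : σa < q) (hqb : σb < q) (hR : 0 < R)
    (hA : δ - q < z₀.re - R) (hB : z₀.re + R < q) (hS : S ⊆ Metric.ball z₀ R) :
    ∃ (M : ℕ) (C t₀ : ℝ), 0 ≤ C ∧ 1 ≤ t₀ ∧ ∀ s : ℂ, s.re ∈ Set.Icc (δ - q) q → t₀ ≤ |s.im| →
      ‖phiCont Q α β χ s‖ ≤ C * |s.im| ^ M := by
  -- On the left edge the functional equation bounds φ by a power of |t| with exponent (2q-δ)d.
  -- Division by (s - P)^M compensates it; P lies one unit to the left of the strip, so |s - P| ≥ 1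
  -- throughout.
  set M : ℕ := ⌈(2 * q - δ) * ∑ i, α i⌉₊ with hM
  set P : ℝ := δ - q - 1 with hP
  set φ := phiCont Q α β χ with hφ
  set f : ℂ → ℂ := fun s => φ s * ((s - P) ^ M)⁻¹ with hf
  have hne : ∀ s : ℂ, δ - q ≤ s.re → 1 ≤ ‖s - P‖ := fun s hs =>
    le_trans (by simp [hP]; linarith) ((le_abs_self _).trans (Complex.abs_re_le_norm (s - P)))
  have hfφ : ∀ s : ℂ, δ - q ≤ s.re → ‖f s‖ ≤ ‖φ s‖ := fun s hs => by
    rw [hf, norm_mul, norm_inv, norm_pow]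
    exact mul_le_of_le_one_right (norm_nonneg _) (inv_le_one_of_one_le₀ (one_le_pow₀ (hne s hs)))
  have hfd : ∀ s : ℂ, s.re ∈ Set.Icc (δ - q) q → s ∉ Metric.ball z₀ R →
      DifferentiableAt ℂ f s := fun s hs hsb => by
    refine (hC.differentiableAt_phiCont fun h => hsb (hS h)).mul
      (((differentiableAt_id.sub_const _).pow M).inv (pow_ne_zero M fun h => ?_))
    have := hne s hs.1
    rw [show s - (P : ℂ) = 0 from h, norm_zero] at this
    linarith
  have hre : ∀ s ∈ Metric.closedBall z₀ R, |s.re - z₀.re| ≤ R := fun s hs => by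
    rw [← Complex.sub_re]
    exact (Complex.abs_re_le_norm _).trans (by simpa [dist_eq_norm] using hs)
  have hfs : ContinuousOn f (Metric.sphere z₀ R) := fun s hs => by
    have := abs_le.1 (hre s (Metric.sphere_subset_closedBall hs))
    exact (hfd s ⟨by linarith, by linarith⟩
      (by simp [Metric.mem_sphere.1 hs])).continuousAt.continuousWithinAt
  -- Phragmén–Lindelöf needs analyticity in the whole strip. It is applied to g, which differs from
  -- f by a Cauchy transform that is bounded away from the circle.
  obtain ⟨g, hgd, hg⟩ := exists_cauchy_decomposition hR hA hB hfd
  obtain ⟨C', hC', hHb⟩ := exists_norm_cauchyTransform_le hR hfs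
  obtain ⟨u₀, hu0, hu⟩ := exists_between (show 0 < min 1 (min (z₀.re - R - (δ - q))
    (q - (z₀.re + R))) from lt_min one_pos (lt_min (by linarith) (by linarith)))
  have hu1 := hu.trans_le (min_le_left _ _)
  have hu2 := hu.trans_le ((min_le_right _ _).trans (min_le_left _ _))
  have hu3 := hu.trans_le ((min_le_right _ _).trans (min_le_right _ _))
  have hH : ∀ s : ℂ, R + u₀ ≤ ‖s - z₀‖ → ‖cauchyTransform f z₀ R s‖ ≤ C' * u₀⁻¹ := fun s hs =>
    (hHb s (by linarith)).trans (by
      have : u₀ ≤ ‖s - z₀‖ - R := by linarith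
      gcongr)
  have houtA : ∀ s : ℂ, s.re = δ - q → R + u₀ ≤ ‖s - z₀‖ := fun s hs => by
    have := (neg_abs_le _).trans' (neg_le_neg (Complex.abs_re_le_norm (s - z₀)))
    rw [Complex.sub_re] at this; linarith
  have houtB : ∀ s : ℂ, s.re = q → R + u₀ ≤ ‖s - z₀‖ := fun s hs => by
    have := (le_abs_self _).trans (Complex.abs_re_le_norm (s - z₀))
    rw [Complex.sub_re] at this; linarith
  have houtT : ∀ s : ℂ, |z₀.im| + R + 1 ≤ |s.im| → R + u₀ ≤ ‖s - z₀‖ := fun s hs => by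
    have : |s.im| - |z₀.im| ≤ ‖s - z₀‖ :=
      (abs_sub_abs_le_abs_sub _ _).trans ((Complex.sub_im s z₀) ▸ Complex.abs_im_le_norm (s - z₀))
    linarith
  have hball : ∀ s : ℂ, R + u₀ ≤ ‖s - z₀‖ → s ∉ Metric.closedBall z₀ R := fun s hs => by
    simp [dist_eq_norm]; linarith
  have hSout : ∀ s : ℂ, R + u₀ ≤ ‖s - z₀‖ → s ∉ S := fun s hs h =>
    hball s hs (Metric.ball_subset_closedBall (hS h))
  obtain ⟨D₁, hD₁⟩ : ∃ D, ∀ s : ℂ, s.re = q → ‖f s‖ ≤ D := by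
    refine ⟨∑' n, ‖a n‖ * lam n ^ (-q), fun s hs => ?_⟩
    refine (hfφ s (by linarith)).trans ?_
    rw [hφ, hC.phiCont_eq_right (hSout s (houtB s hs)) (by linarith) (by linarith)]
    have := norm_dirichletSeries_le (a := a) (s := s) hC.lam_seq.1 (by
      rw [hs]; exact hC.abscissa_a.summable hC.lam_seq hqa)
    rwa [hs] at this
  -- Far out on the left edge the functional equation and the Gamma asymptotics apply; the remaining
  -- compact segment is covered by continuity.
  obtain ⟨D₂, hD₂⟩ : ∃ D, ∀ s : ℂ, s.re = δ - q → ‖f s‖ ≤ D := by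
    obtain ⟨K, t₁, hK, ht₁, hfr⟩ := norm_factorRatio_le δ hC.α_pos β q q
    set L : ℝ := Q ^ (2 * q - δ) * (∑' n, ‖b n‖ * mu n ^ (-q)) * K with hL
    have hbig : ∀ s : ℂ, s.re = δ - q → max t₁ 1 ≤ |s.im| → ‖f s‖ ≤ L := by
      intro s hs ht
      have ht1 := (le_max_right _ _).trans ht
      have h1 := hfr (δ - s) (by simp [hs]) (by simpa using (le_max_left _ _).trans ht)
      have h2 : ‖dirichletSeries b mu (δ - starRingEnd ℂ s)‖ ≤ ∑' n, ‖b n‖ * mu n ^ (-q) := by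
        have e : (δ - starRingEnd ℂ s).re = q := by simp [hs]
        have := norm_dirichletSeries_le (a := b) (s := δ - starRingEnd ℂ s) hC.mu_seq.1 (by
          rw [e]; exact hC.abscissa_b.summable hC.mu_seq hqb)
        rwa [e] at this
      have h3 : ‖φ s‖ ≤ L * |s.im| ^ M := by
        rw [hφ, hC.phiCont_eq_left (hSout s (houtA s hs)) (by linarith) (by linarith), norm_mul,
          norm_mul, norm_mul, hC.norm_ω, one_mul, Complex.norm_conj,
          Complex.norm_cpow_eq_rpow_re_of_pos hC.Q_pos, hL, mul_assoc _ K]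
        have e : ((δ : ℂ) - 2 * s).re = 2 * q - δ := by simp [hs]; ring
        rw [e]
        refine mul_le_mul (mul_le_mul_of_nonneg_left h2 (Real.rpow_nonneg hC.Q_pos.le _))
          (h1.trans (mul_le_mul_of_nonneg_left ?_ hK.le)) (norm_nonneg _)
          (mul_nonneg (Real.rpow_nonneg hC.Q_pos.le _) ((norm_nonneg _).trans h2))
        have e2 : |((δ : ℂ) - s).im| = |s.im| := by simp
        rw [e2, ← Real.rpow_natCast]
        refine Real.rpow_le_rpow_of_exponent_le ht1 ?_
        have : ((δ : ℂ) - s).re = q := by simp [hs]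
        rw [this]; exact Nat.le_ceil _
      have h4 : |s.im| ^ M ≤ ‖s - P‖ ^ M := by
        have := Complex.abs_im_le_norm (s - P)
        simp only [Complex.sub_im, Complex.ofReal_im, sub_zero] at this
        gcongr
      have h5 : 0 < ‖s - P‖ ^ M := pow_pos (one_pos.trans_le (hne s hs.ge)) M
      have hL0 : 0 ≤ L := mul_nonneg (mul_nonneg (Real.rpow_nonneg hC.Q_pos.le _)
        ((norm_nonneg _).trans h2)) hK.le
      rw [hf, norm_mul, norm_inv, norm_pow, ← div_eq_mul_inv, div_le_iff₀ h5]
      exact h3.trans (mul_le_mul_of_nonneg_left h4 hL0)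
    have hcont : Continuous fun t : ℝ => f ((δ - q : ℝ) + t * Complex.I) :=
      continuous_iff_continuousAt.2 fun t => ContinuousAt.comp
        (f := fun t : ℝ => ((δ - q : ℝ) : ℂ) + t * Complex.I)
        (hfd _ (by simpa using (by linarith : δ - q ≤ q)) (fun h => hball _ (houtA _ (by simp))
          (Metric.ball_subset_closedBall h))).continuousAt
        (continuous_re_add_mul_I _).continuousAt
    obtain ⟨L', hL'⟩ := (isCompact_Icc (a := -max t₁ 1) (b := max t₁ 1)).exists_bound_of_continuousOn
      hcont.continuousOn
    refine ⟨max L L', fun s hs => ?_⟩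
    rcases le_total (max t₁ 1) |s.im| with h | h
    · exact (hbig s hs h).trans (le_max_left _ _)
    · have := hL' s.im (abs_le.1 h)
      rw [← hs, Complex.re_add_im] at this
      exact this.trans (le_max_right _ _)
  obtain ⟨θ, hθ, hgr⟩ := hC.growth
  obtain ⟨X, t₂, hX⟩ := hgr (δ - q) q (by linarith)
  obtain ⟨Bg, t₃, hBg, ht₃, hΓ⟩ := exists_norm_inv_gammaFactor_le hC.α_pos β (δ - q) q
  set W : ℝ := q - (δ - q) with hW
  have hW0 : 0 < W := by rw [hW]; linarith
  -- The given θ may be nonpositive; enlarging it keeps it below 1 and makes the rate c positive, so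
  -- that one can divide by c.
  set θ' : ℝ := max θ (1 / 2) with hθ'
  have hθ'1 : θ' < 1 := max_lt hθ (by norm_num)
  have hθ'0 : 0 < θ' := lt_of_lt_of_le (by norm_num) (le_max_right _ _)
  set c : ℝ := θ' * Real.pi / W with hc
  have hc0 : 0 < c := by positivity
  set E : ℝ := max |δ - q| |q| with hE
  -- The first summand accounts for |s| ≤ E + |Im s| in the growth condition. The second absorbs the
  -- exponential growth of the reciprocal Gamma factor, by |t| ≤ e^{c|t|}/c.
  set B' : ℝ := Real.exp (c * E) + Bg / c with hB'
  have hgrow : ∀ s : ℂ, s.re ∈ Set.Icc (δ - q) q →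
      max t₂ (max t₃ (|z₀.im| + R + 1)) ≤ |s.im| →
      ‖g s‖ ≤ ((Q ^ (-q) + Q ^ (-(δ - q))) * |X| + C' * u₀⁻¹) *
        Real.exp (B' * Real.exp (c * |s.im|)) := by
    intro s hs ht
    have h1 := (le_max_left _ _).trans ht
    have h2 := (le_max_left _ _).trans ((le_max_right _ _).trans ht)
    have h3 := houtT s ((le_max_right _ _).trans ((le_max_right _ _).trans ht))
    have hB'0 : 0 ≤ B' := by positivity
    have hge1 : 1 ≤ Real.exp (B' * Real.exp (c * |s.im|)) :=
      Real.one_le_exp (by positivity)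
    have hs' : ‖s‖ ≤ E + |s.im| := (Complex.norm_le_abs_re_add_abs_im s).trans (by
      have := abs_le_max_abs_abs hs.1 hs.2; linarith)
    have hχ : ‖χ s‖ ≤ |X| * Real.exp (Real.exp (c * E) * Real.exp (c * |s.im|)) := by
      refine (hX s hs.1 hs.2 h1).trans (mul_le_mul (le_abs_self X) ?_ (Real.exp_pos _).le
        (abs_nonneg X))
      rw [← Real.exp_add, ← mul_add]
      refine Real.exp_le_exp.2 (Real.exp_le_exp.2 ?_)
      rw [hc, div_mul_eq_mul_div]
      have := Real.pi_pos
      gcongr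
      exact le_max_left _ _
    have hφb : ‖φ s‖ ≤ (Q ^ (-q) + Q ^ (-(δ - q))) * |X| *
        Real.exp (B' * Real.exp (c * |s.im|)) := by
      have h4 := hΓ s hs h2
      have h5 : ‖(Q : ℂ) ^ (-s)‖ ≤ Q ^ (-q) + Q ^ (-(δ - q)) := by
        rw [Complex.norm_cpow_eq_rpow_re_of_pos hC.Q_pos]
        exact rpow_le_rpow_add_rpow hC.Q_pos (by simpa using hs.2) (by
          have := hs.1; simp; linarith)
      have h6 : |s.im| ≤ Real.exp (c * |s.im|) / c := by
        rw [le_div_iff₀ hc0, mul_comm]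
        linarith [Real.add_one_le_exp (c * |s.im|)]
      have h7 : Real.exp (Bg * |s.im|) ≤ Real.exp (Bg / c * Real.exp (c * |s.im|)) := by
        refine Real.exp_le_exp.2 ?_
        rw [div_mul_eq_mul_div, ← mul_div_assoc'] 
        exact mul_le_mul_of_nonneg_left h6 hBg
      have hQ0 : 0 ≤ Q ^ (-q) + Q ^ (-(δ - q)) :=
        add_nonneg (Real.rpow_nonneg hC.Q_pos.le _) (Real.rpow_nonneg hC.Q_pos.le _)
      rw [hφ, phiCont, norm_mul, norm_mul]
      calc _ ≤ (Q ^ (-q) + Q ^ (-(δ - q))) *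
            (|X| * Real.exp (Real.exp (c * E) * Real.exp (c * |s.im|))) *
            Real.exp (Bg / c * Real.exp (c * |s.im|)) :=
            mul_le_mul (mul_le_mul h5 hχ (norm_nonneg _) hQ0) (h4.trans h7) (norm_nonneg _)
              (by positivity)
        _ = _ := by rw [hB', add_mul _ _ (Real.exp (c * |s.im|)), Real.exp_add]; ring
    rw [eq_sub_of_add_eq (hg s (hball s h3) hs).symm]
    refine (norm_sub_le _ _).trans ?_
    rw [add_mul]
    refine add_le_add ((hfφ s hs.1).trans hφb) ((hH s h3).trans ?_)
    exact le_mul_of_one_le_right (by positivity) hge1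
  set D : ℝ := max D₁ D₂ + C' * u₀⁻¹ with hD
  have hgD : ∀ s : ℂ, s.re ∈ Set.Icc (δ - q) q → ‖g s‖ ≤ D := by
    intro s hs
    refine PhragmenLindelof.vertical_strip (a := δ - q) (b := q) ?_ ?_ ?_ ?_ hs.1 hs.2
    · refine DifferentiableOn.diffContOnCl fun z hz => (hgd z ?_).differentiableWithinAt
      exact closure_minimal (Set.preimage_mono Set.Ioo_subset_Icc_self)
        (isClosed_Icc.preimage Complex.continuous_re) hz
    · refine ⟨c, ?_, B', Asymptotics.IsBigO.of_bound
        ((Q ^ (-q) + Q ^ (-(δ - q))) * |X| + C' * u₀⁻¹) ?_⟩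
      · rw [hc, ← hW]
        gcongr
        exact mul_lt_of_lt_one_left Real.pi_pos hθ'1
      · rw [eventually_inf_principal]
        filter_upwards [(eventually_ge_atTop (max t₂ (max t₃ (|z₀.im| + R + 1)))).comap
          (_root_.abs ∘ Complex.im)] with z hz hz'
        rw [Real.norm_of_nonneg (Real.exp_pos _).le]
        exact hgrow z (Set.Ioo_subset_Icc_self hz') hz
    · intro z hz
      rw [eq_sub_of_add_eq (hg z (hball z (houtA z hz)) ⟨hz.ge, by linarith⟩).symm]
      exact (norm_sub_le _ _).trans (add_le_add ((hD₂ z hz).trans (le_max_right _ _))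
        (hH z (houtA z hz)))
    · intro z hz
      rw [eq_sub_of_add_eq (hg z (hball z (houtB z hz)) ⟨by linarith, hz.le⟩).symm]
      exact (norm_sub_le _ _).trans (add_le_add ((hD₁ z hz).trans (le_max_left _ _))
        (hH z (houtB z hz)))
  have hD0 : 0 ≤ D := (norm_nonneg _).trans (hgD q ⟨by simp; linarith, by simp⟩)
  refine ⟨M, (D + C' * u₀⁻¹) * (W + 2) ^ M, max 1 (|z₀.im| + R + 1), by positivity,
    le_max_left _ _, fun s hs ht => ?_⟩
  have h1 := (le_max_left _ _).trans ht
  have h2 := houtT s ((le_max_right _ _).trans ht)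
  have h3 : ‖f s‖ ≤ D + C' * u₀⁻¹ := by
    rw [hg s (hball s h2) hs]
    exact (norm_add_le _ _).trans (add_le_add (hgD s hs) (hH s h2))
  have h4 : ‖s - P‖ ≤ (W + 2) * |s.im| := by
    refine (Complex.norm_le_abs_re_add_abs_im _).trans ?_
    have : |(s - P).re| ≤ W + 1 := by
      rw [abs_le]; simp [hP, hW]; constructor <;> linarith [hs.1, hs.2]
    simp only [Complex.sub_im, Complex.ofReal_im, sub_zero]
    nlinarith
  have h5 : (s - P) ^ M ≠ 0 := pow_ne_zero M (norm_pos_iff.1 (one_pos.trans_le (hne s hs.1)))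
  have h6 : φ s = f s * (s - P) ^ M := by
    simp only [hf]; field_simp
  rw [h6, norm_mul, norm_pow, mul_assoc, ← mul_pow]
  gcongr

end

end RieszSum

namespace RieszSum

/-! ### Removing removable singularities -/

/-- The function obtained from `h` by removing all removable singularities. -/
noncomputable def clean (h : ℂ → ℂ) (z : ℂ) : ℂ := limUnder (𝓝[≠] z) h

theorem clean_eq_of_tendsto {h : ℂ → ℂ} {z l : ℂ} (H : Tendsto h (𝓝[≠] z) (𝓝 l)) :
    clean h z = l := H.limUnder_eq

theorem clean_eq_self {h : ℂ → ℂ} {z : ℂ} (H : ContinuousAt h z) : clean h z = h z :=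
  clean_eq_of_tendsto (H.tendsto.mono_left nhdsWithin_le_nhds)

theorem differentiableAt_clean {h : ℂ → ℂ} {z : ℂ} (H : ¬ IsSingularity h z) :
    DifferentiableAt ℂ (clean h) z := by
  obtain ⟨g, hg, hgz⟩ := not_not.1 H
  refine hg.differentiableAt.congr_of_eventuallyEq ?_
  rw [EventuallyEq, eventually_nhdsWithin_iff] at hgz
  obtain ⟨u, hu, huo, hzu⟩ := eventually_nhds_iff.1 hgz
  filter_upwards [huo.mem_nhds hzu, hg.eventually_analyticAt] with y hy hgy
  refine clean_eq_of_tendsto ((hgy.continuousAt.tendsto.mono_left nhdsWithin_le_nhds).congr' ?_)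
  rcases eq_or_ne y z with rfl | hyz
  · filter_upwards [nhdsWithin_le_nhds (huo.mem_nhds hy), self_mem_nhdsWithin] with w hw hw'
    exact (hu w hw hw').symm
  · filter_upwards [nhdsWithin_le_nhds (huo.mem_nhds hy),
      nhdsWithin_le_nhds (isOpen_ne.mem_nhds hyz)] with w hw hw'
    exact (hu w hw hw').symm

theorem circleIntegral_congr_of_countable {f g : ℂ → ℂ} {z₀ : ℂ} {R : ℝ} (hR : R ≠ 0) {s : Set ℂ}
    (hs : s.Countable) (h : ∀ w ∈ Metric.sphere z₀ |R|, w ∉ s → f w = g w) :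
    (∮ w in C(z₀, R), f w) = ∮ w in C(z₀, R), g w := by
  refine intervalIntegral.integral_congr_ae
    (((hs.preimage_circleMap z₀ hR).ae_notMem _).mono fun θ hθ _ => ?_)
  simp only [h _ (circleMap_mem_sphere' z₀ R θ) hθ]

/-- Outside the circle φΓ may still have removable singularities at the poles -k of Γ, where the
written product has a default value; such points may even lie on the circle. Filling in the limits
gives a function differentiable there and alters the circle integral at countably many points only.
-/
theorem InClassC.exists_clean {r : ℕ} {a b : ℕ → ℂ} {lam mu : ℕ → ℝ} {σa σb δ Q : ℝ} {ω : ℂ}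
    {α : Fin r → ℝ} {β : Fin r → ℂ} {S : Set ℂ} {χ : ℂ → ℂ}
    (hC : InClassC a b lam mu σa σb δ Q ω α β S χ) {p R : ℝ} {z₀ : ℂ}
    (hcirc : IsAdmissibleCircle δ Q α β S χ p z₀ R) :
    ∃ f : ℂ → ℂ, (∀ s ∈ strip δ p, s ∉ Metric.ball z₀ R → DifferentiableAt ℂ f s) ∧
      (∀ s ∉ S, (∀ k : ℕ, s ≠ -k) → f s = phiCont Q α β χ s * Complex.Gamma s) ∧
      ∀ ρ x : ℝ, residualTerm Q α β χ z₀ R ρ x = (2 * (Real.pi : ℂ) * Complex.I)⁻¹ *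
        ∮ s in C(z₀, R), f s * (Complex.Gamma (s + ρ + 1))⁻¹ * (x : ℂ) ^ (s + (ρ : ℂ)) := by
  have hraw : ∀ s ∉ S, (∀ k : ℕ, s ≠ -k) →
      clean (fun z => phiCont Q α β χ z * Complex.Gamma z) s =
        phiCont Q α β χ s * Complex.Gamma s := fun s hs hk =>
    clean_eq_self (h := fun z => phiCont Q α β χ z * Complex.Gamma z)
      ((hC.differentiableAt_phiCont hs).mul (Complex.differentiableAt_Gamma s hk)).continuousAt
  refine ⟨clean fun z => phiCont Q α β χ z * Complex.Gamma z, fun s hs hsb =>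
    differentiableAt_clean fun h => hsb (hcirc.encloses_sing s hs h), hraw, fun ρ x => ?_⟩
  rw [residualTerm]
  congr 1
  refine circleIntegral_congr_of_countable hcirc.radius_pos.ne'
    (Set.countable_range fun k : ℕ => -(k : ℂ)) fun w hw hwk => ?_
  rw [abs_of_pos hcirc.radius_pos] at hw
  rw [hraw w (fun h => by simpa [Metric.mem_sphere.1 hw] using hcirc.encloses_S h)
    fun k hk => hwk ⟨k, hk.symm⟩]
  rw [div_eq_mul_inv]
  ring

/-! ### Residual functions -/

theorem isConnected_compl_closedBall (c : ℂ) {R : ℝ} (hR : 0 ≤ R) :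
    IsConnected (Metric.closedBall c R)ᶜ := by
  have h : (Metric.closedBall c R)ᶜ =
      (fun x : ℝ × ℝ => circleMap c x.1 x.2) '' (Set.Ioi R ×ˢ Set.univ) := by
    ext z
    constructor
    · intro hz
      have hz' : R < ‖z - c‖ := by simpa [dist_eq_norm] using hz
      refine ⟨(‖z - c‖, Complex.arg (z - c)), ⟨hz', trivial⟩, ?_⟩
      simp [circleMap]
    · rintro ⟨⟨ρ, θ⟩, ⟨hρ, -⟩, rfl⟩
      have : R < ρ := hρ
      simp [circleMap, dist_eq_norm, abs_of_nonneg (hR.trans this.le), this]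
  rw [h]
  refine (isConnected_Ioi.prod isConnected_univ).image _ (Continuous.continuousOn ?_)
  simp only [circleMap]
  fun_prop

theorem circleIntegral_cpow_eq {Φ : ℂ → ℂ} {z₀ : ℂ} {R : ℝ} (k : ℂ → ℂ) (x : ℝ) :
    (2 * (Real.pi : ℂ) * Complex.I)⁻¹ * ∮ s in C(z₀, R), Φ s * (x : ℂ) ^ k s =
      ∫ θ in Set.Ioc 0 (2 * Real.pi), (2 * (Real.pi : ℂ) * Complex.I)⁻¹ *
        (deriv (circleMap z₀ R) θ * Φ (circleMap z₀ R θ)) * (x : ℂ) ^ k (circleMap z₀ R θ) := by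
  rw [circleIntegral, intervalIntegral.integral_of_le Real.two_pi_pos.le,
    ← MeasureTheory.integral_const_mul]
  congr 1
  funext θ
  simp only [smul_eq_mul]
  ring

theorem continuous_circle_coefficient {Φ : ℂ → ℂ} {z₀ : ℂ} {R : ℝ} (hR : 0 < R)
    (hΦ : ContinuousOn Φ (Metric.sphere z₀ R)) :
    Continuous fun θ => (2 * (Real.pi : ℂ) * Complex.I)⁻¹ *
      (deriv (circleMap z₀ R) θ * Φ (circleMap z₀ R θ)) :=
  continuous_const.mul ((continuous_deriv_circleMap z₀ R).mul (continuous_comp_circleMap hR hΦ))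

theorem circleMap_re_mem {z₀ : ℂ} {R : ℝ} (hR : 0 < R) (θ : ℝ) :
    (circleMap z₀ R θ).re ∈ Set.Icc (z₀.re - R) (z₀.re + R) := by
  have h := Complex.abs_re_le_norm (circleMap z₀ R θ - z₀)
  have h2 := circleMap_mem_sphere z₀ hR.le θ
  rw [mem_sphere_iff_norm] at h2
  rw [h2, Complex.sub_re, abs_le] at h
  constructor <;> linarith

theorem hasDerivAt_circleIntegral_cpow {Φ : ℂ → ℂ} {z₀ : ℂ} {R : ℝ} (hR : 0 < R)
    (hΦ : ContinuousOn Φ (Metric.sphere z₀ R)) (c : ℝ) {x : ℝ} (hx : 0 < x) :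
    HasDerivAt (fun x : ℝ => (2 * (Real.pi : ℂ) * Complex.I)⁻¹ *
        ∮ s in C(z₀, R), Φ s * (x : ℂ) ^ (s + c))
      ((2 * (Real.pi : ℂ) * Complex.I)⁻¹ *
        ∮ s in C(z₀, R), Φ s * (s + c) * (x : ℂ) ^ (s + c - 1)) x := by
  have hA := continuous_circle_coefficient hR hΦ
  have hk : Continuous fun θ => circleMap z₀ R θ + c := (continuous_circleMap z₀ R).add_const _
  have key := hasDerivAt_integral_cpow (ν := MeasureTheory.volume.restrict
    (Set.Ioc 0 (2 * Real.pi))) (c₁ := z₀.re - R + c) (c₂ := z₀.re + R + c)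
    ((hA.integrableOn_Icc (a := 0) (b := 2 * Real.pi)).mono_set Set.Ioc_subset_Icc_self)
    (((hA.mul hk).integrableOn_Icc (a := 0) (b := 2 * Real.pi)).mono_set Set.Ioc_subset_Icc_self)
    hk (Eventually.of_forall fun θ => by
      have := circleMap_re_mem (z₀ := z₀) hR θ
      rw [Complex.add_re, Complex.ofReal_re]
      exact ⟨by linarith [this.1], by linarith [this.2]⟩) hx
  rw [circleIntegral_cpow_eq (Φ := fun s => Φ s * (s + c)) (fun s => s + c - 1) x]
  simp only [circleIntegral_cpow_eq (Φ := Φ) (fun s => s + c)]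
  refine key.congr_deriv ?_
  congr 1
  funext θ
  ring

/-- Fubini for the Mellin transform of a superposition of powers; integrability for the two extreme
exponents dominates all exponents in between. -/
theorem integrableOn_and_integral_cpow {A k : ℝ → ℂ} (hA : Continuous A) (hk : Continuous k)
    {κ₁ κ₂ : ℝ} (hre : ∀ θ, (k θ).re ∈ Set.Icc κ₁ κ₂) {s : Set ℝ} (hs : MeasurableSet s)
    (hs0 : s ⊆ Set.Ioi 0) (z : ℂ)
    (h1 : MeasureTheory.IntegrableOn (fun x : ℝ => x ^ (κ₁ + z.re - 1)) s)
    (h2 : MeasureTheory.IntegrableOn (fun x : ℝ => x ^ (κ₂ + z.re - 1)) s) :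
    MeasureTheory.IntegrableOn (fun x : ℝ =>
      (∫ θ in Set.Ioc 0 (2 * Real.pi), A θ * (x : ℂ) ^ k θ) * (x : ℂ) ^ (z - 1)) s ∧
    ∫ x in s, (∫ θ in Set.Ioc 0 (2 * Real.pi), A θ * (x : ℂ) ^ k θ) * (x : ℂ) ^ (z - 1) =
      ∫ θ in Set.Ioc 0 (2 * Real.pi), A θ * ∫ x in s, (x : ℂ) ^ (k θ + z - 1) := by
  obtain ⟨M, hM⟩ := (isCompact_Icc (a := (0 : ℝ)) (b := 2 * Real.pi)).exists_bound_of_continuousOn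
    hA.continuousOn
  set ν := MeasureTheory.volume.restrict (Set.Ioc 0 (2 * Real.pi)) with hν
  have e : ∀ x ∈ s, (∫ θ, A θ * (x : ℂ) ^ k θ ∂ν) * (x : ℂ) ^ (z - 1) =
      ∫ θ, A θ * (x : ℂ) ^ (k θ + z - 1) ∂ν := fun x hx => by
    rw [← MeasureTheory.integral_mul_const]
    congr 1
    funext θ
    rw [mul_assoc, ← Complex.cpow_add _ _ (by exact_mod_cast (hs0 hx : 0 < x).ne'), add_sub_assoc]
  have hint : MeasureTheory.Integrable (Function.uncurry fun x θ : ℝ =>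
      A θ * (x : ℂ) ^ (k θ + z - 1)) ((MeasureTheory.volume.restrict s).prod ν) := by
    have hb := ((h1.add h2).mul_prod (MeasureTheory.integrable_const (μ := ν) |M|))
    refine hb.mono' ?_ ?_
    · refine Measurable.aestronglyMeasurable ?_
      simp only [Function.uncurry_def]
      have m1 : Measurable A := hA.measurable
      have m2 : Measurable k := hk.measurable
      exact (m1.comp measurable_snd).mul ((Complex.measurable_ofReal.comp measurable_fst).pow
        (((m2.comp measurable_snd).add_const z).sub_const 1))
    · rw [hν, MeasureTheory.Measure.prod_restrict]
      filter_upwards [MeasureTheory.ae_restrict_mem (hs.prod measurableSet_Ioc)] with x hx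
      have hx0 : 0 < x.1 := hs0 hx.1
      rw [Function.uncurry_def]
      dsimp only
      rw [norm_mul, Complex.norm_cpow_eq_rpow_re_of_pos hx0, mul_comm]
      refine mul_le_mul (rpow_le_rpow_add_rpow hx0 ?_ ?_)
        ((hM _ (Set.Ioc_subset_Icc_self hx.2)).trans (le_abs_self M)) (norm_nonneg _)
        (add_nonneg (Real.rpow_nonneg hx0.le _) (Real.rpow_nonneg hx0.le _))
      · have := (hre x.2).1; simp; linarith
      · have := (hre x.2).2; simp; linarith
  constructor
  · exact (MeasureTheory.integrableOn_congr_fun e hs).2 hint.integral_prod_left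
  · rw [MeasureTheory.setIntegral_congr_fun hs e, MeasureTheory.integral_integral_swap hint]
    congr 1
    funext θ
    exact MeasureTheory.integral_const_mul _ _

theorem norm_integral_cpow_le {A k : ℝ → ℂ} (hA : Continuous A) {κ₁ κ₂ : ℝ}
    (hre : ∀ θ, (k θ).re ∈ Set.Icc κ₁ κ₂) : ∃ C, 0 ≤ C ∧ ∀ x : ℝ, 0 < x →
      ‖∫ θ in Set.Ioc 0 (2 * Real.pi), A θ * (x : ℂ) ^ k θ‖ ≤ C * (x ^ κ₁ + x ^ κ₂) := by
  obtain ⟨M, hM⟩ := (isCompact_Icc (a := (0 : ℝ)) (b := 2 * Real.pi)).exists_bound_of_continuousOn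
    hA.continuousOn
  refine ⟨|M| * (2 * Real.pi), by positivity, fun x hx => ?_⟩
  have := MeasureTheory.norm_setIntegral_le_of_norm_le_const (μ := MeasureTheory.volume)
    (s := Set.Ioc 0 (2 * Real.pi)) (f := fun θ => A θ * (x : ℂ) ^ k θ)
    (C := |M| * (x ^ κ₁ + x ^ κ₂)) measure_Ioc_lt_top (fun θ hθ => by
      rw [norm_mul, Complex.norm_cpow_eq_rpow_re_of_pos hx]
      exact mul_le_mul ((hM _ (Set.Ioc_subset_Icc_self hθ)).trans (le_abs_self M))
        (rpow_le_rpow_add_rpow hx (hre θ).1 (hre θ).2) (by positivity) (abs_nonneg M))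
  refine this.trans (le_of_eq ?_)
  rw [MeasureTheory.measureReal_def, Real.volume_Ioc, sub_zero,
    ENNReal.toReal_ofReal Real.two_pi_pos.le]
  ring

/-- For a single power x^{w+c}, both ∫₀¹ x^{w+c+z-1} dx and -∫₁^∞ x^{w+c+z-1} dx equal 1/(w + c +
z), each in its half-plane. Superposition over the circle gives in both cases the same Cauchy
transform at -c - z, up to sign, which is analytic off a disc and tends to 0 at infinity. -/
theorem isResidualFunction_circleIntegral {Φ : ℂ → ℂ} {z₀ : ℂ} {R : ℝ} (hR : 0 < R)
    (hΦ : ContinuousOn Φ (Metric.sphere z₀ R)) (c : ℝ) :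
    IsResidualFunction fun x : ℝ => (2 * (Real.pi : ℂ) * Complex.I)⁻¹ *
      ∮ s in C(z₀, R), Φ s * (x : ℂ) ^ (s + c) := by
  have hA := continuous_circle_coefficient hR hΦ
  have hk : Continuous fun θ => circleMap z₀ R θ + c := (continuous_circleMap z₀ R).add_const _
  have hre : ∀ θ, (circleMap z₀ R θ + c).re ∈ Set.Icc (z₀.re - R + c) (z₀.re + R + c) := fun θ => by
    have := circleMap_re_mem (z₀ := z₀) hR θ
    rw [Complex.add_re, Complex.ofReal_re]
    exact ⟨by linarith [this.1], by linarith [this.2]⟩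
  set κ₁ := z₀.re - R + c with hκ₁
  set κ₂ := z₀.re + R + c with hκ₂
  set I : ℂ → ℂ := fun z => -cauchyTransform Φ z₀ R (-c - z) with hI
  have hIeq : ∀ z, I z = ∫ θ in Set.Ioc 0 (2 * Real.pi), (2 * (Real.pi : ℂ) * Complex.I)⁻¹ *
      (deriv (circleMap z₀ R) θ * Φ (circleMap z₀ R θ)) * (circleMap z₀ R θ + c + z)⁻¹ := fun z => by
    simp only [hI]
    rw [cauchyTransform, circleIntegral, intervalIntegral.integral_of_le Real.two_pi_pos.le,
      ← MeasureTheory.integral_const_mul, ← MeasureTheory.integral_neg]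
    congr 1
    funext θ
    rw [show -(c : ℂ) - z - circleMap z₀ R θ = -(circleMap z₀ R θ + c + z) by ring, inv_neg]
    simp only [smul_eq_mul]
    ring
  have hKout : ∀ z : ℂ, z ∉ Metric.closedBall (-c - z₀) R ↔ -(c : ℂ) - z ∉ Metric.closedBall z₀ R :=
    fun z => by
      rw [Metric.mem_closedBall, Metric.mem_closedBall, dist_eq_norm, dist_eq_norm, ← norm_neg]
      congr! 3
      ring
  refine ⟨fun x hx => ((hasDerivAt_circleIntegral_cpow hR hΦ c hx).differentiableAt
    ).differentiableWithinAt, ?_, Metric.closedBall (-c - z₀) R, I,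
    isCompact_closedBall _ _, isConnected_compl_closedBall _ hR.le, ?_, ?_, ?_, ?_⟩
  · obtain ⟨C, hC, hb⟩ := norm_integral_cpow_le (k := fun θ => circleMap z₀ R θ + c) hA hre
    have h1 := (le_abs_self κ₁)
    have h2 := (le_abs_self κ₂)
    have h3 := (neg_abs_le κ₁)
    have h4 := (neg_abs_le κ₂)
    have h5 := abs_nonneg κ₁
    have h6 := abs_nonneg κ₂
    refine ⟨|κ₁| + |κ₂| + 1, by positivity, ?_, ?_⟩
    · refine Asymptotics.IsBigO.of_bound (C * 2) ?_
      filter_upwards [Ioc_mem_nhdsGT one_pos] with x hx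
      rw [circleIntegral_cpow_eq, Real.norm_of_nonneg (by have := hx.1; positivity), mul_assoc C]
      refine (hb x hx.1).trans (mul_le_mul_of_nonneg_left ?_ hC)
      rw [two_mul]
      exact add_le_add (Real.rpow_le_rpow_of_exponent_ge hx.1 hx.2 (by linarith))
        (Real.rpow_le_rpow_of_exponent_ge hx.1 hx.2 (by linarith))
    · refine Asymptotics.IsBigO.of_bound (C * 2) ?_
      filter_upwards [eventually_ge_atTop 1] with x hx
      have hx0 : 0 < x := by linarith
      rw [circleIntegral_cpow_eq, Real.norm_of_nonneg (by positivity), mul_assoc C]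
      refine (hb x hx0).trans (mul_le_mul_of_nonneg_left ?_ hC)
      rw [two_mul]
      exact add_le_add (Real.rpow_le_rpow_of_exponent_le hx (by linarith))
        (Real.rpow_le_rpow_of_exponent_le hx (by linarith))
  · intro z hz
    refine DifferentiableAt.differentiableWithinAt (DifferentiableAt.neg ?_)
    exact DifferentiableAt.comp (g := cauchyTransform Φ z₀ R) z
      (differentiableAt_cauchyTransform hR hΦ ((hKout z).1 hz))
      (differentiableAt_id.const_sub _)
  · refine ⟨-κ₁, fun s _ hs => ?_⟩
    have hκ : κ₁ ≤ κ₂ := by rw [hκ₁, hκ₂]; linarith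
    have key := integrableOn_and_integral_cpow hA hk hre measurableSet_Ioc
      Set.Ioc_subset_Ioi_self s
      ((intervalIntegrable_iff_integrableOn_Ioc_of_le zero_le_one).1
        (intervalIntegral.intervalIntegrable_rpow' (by linarith)))
      ((intervalIntegrable_iff_integrableOn_Ioc_of_le zero_le_one).1
        (intervalIntegral.intervalIntegrable_rpow' (by linarith)))
    simp only [circleIntegral_cpow_eq (Φ := Φ) (fun s => s + c)]
    refine ⟨key.1, ?_⟩
    rw [key.2, hIeq]
    congr 1
    funext θ
    congr 1
    have h0 := (hre θ).1
    have h1 : 0 < (circleMap z₀ R θ + c + s).re := by rw [Complex.add_re]; linarith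
    have h2 : circleMap z₀ R θ + c + s ≠ 0 := fun h => by rw [h] at h1; simp at h1
    rw [← intervalIntegral.integral_of_le zero_le_one, integral_cpow (Or.inl (by
      rw [Complex.sub_re, Complex.one_re]; linarith))]
    simp [Complex.zero_cpow h2]
  · refine ⟨-κ₂, fun s _ hs => ?_⟩
    have hκ : κ₁ ≤ κ₂ := by rw [hκ₁, hκ₂]; linarith
    have key := integrableOn_and_integral_cpow hA hk hre measurableSet_Ioi
      (Set.Ioi_subset_Ioi zero_le_one) s
      (integrableOn_Ioi_rpow_of_lt (by linarith) one_pos)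
      (integrableOn_Ioi_rpow_of_lt (by linarith) one_pos)
    simp only [circleIntegral_cpow_eq (Φ := Φ) (fun s => s + c)]
    refine ⟨key.1, ?_⟩
    rw [key.2, hIeq, ← MeasureTheory.integral_neg]
    congr 1
    funext θ
    have h0 := (hre θ).2
    rw [integral_Ioi_cpow_of_lt (by
      rw [Complex.sub_re, Complex.one_re, Complex.add_re]; linarith) one_pos]
    simp [div_eq_mul_inv]
  · intro σ₁ σ₂ ε hε
    obtain ⟨C, hC, hb⟩ := exists_norm_cauchyTransform_le hR hΦ
    refine ⟨R + |z₀.im| + (C / ε + 1), fun s _ _ ht => ?_⟩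
    have h1 : |s.im| - |z₀.im| ≤ ‖-(c : ℂ) - s - z₀‖ := by
      have h := Complex.abs_im_le_norm (-(c : ℂ) - s - z₀)
      have h' : |(-(c : ℂ) - s - z₀).im| = |s.im + z₀.im| := by
        rw [← abs_neg]; congr 1; simp; ring
      have := abs_sub_abs_le_abs_sub s.im (-z₀.im)
      rw [abs_neg, sub_neg_eq_add] at this
      linarith
    have h3 : 0 ≤ C / ε := by positivity
    have h2 : C / ε < ‖-(c : ℂ) - s - z₀‖ - R := by linarith
    simp only [hI, norm_neg]
    refine (hb _ (by linarith)).trans_lt ?_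
    rw [← div_eq_mul_inv, div_lt_iff₀ (by linarith), mul_comm]
    exact (div_lt_iff₀ hε).1 h2

end RieszSum

namespace RieszSum

/-! ### The Perron integral of a Riesz mean -/

theorem norm_Gamma_div_le_rpow_neg_two (ρ c₁ c₂ : ℝ) (hρ : 1 ≤ ρ) : ∃ C t₀ : ℝ, 0 < C ∧ 0 < t₀ ∧
    ∀ s : ℂ, s.re ∈ Set.Icc c₁ c₂ → t₀ ≤ |s.im| →
      ‖Complex.Gamma s * (Complex.Gamma (s + ρ + 1))⁻¹‖ ≤ C * |s.im| ^ (-2 : ℝ) := by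
  obtain ⟨C, t₀, hC, ht₀, h⟩ := norm_Gamma_div_le ρ c₁ c₂
  refine ⟨C, max t₀ 1, hC, by positivity, fun s hs ht => ?_⟩
  refine (h s hs ((le_max_left _ _).trans ht)).trans (mul_le_mul_of_nonneg_left ?_ hC.le)
  exact Real.rpow_le_rpow_of_exponent_le ((le_max_right _ _).trans ht) (by linarith)

theorem differentiable_inv_Gamma_add (ρ : ℝ) :
    Differentiable ℂ fun s : ℂ => (Complex.Gamma (s + ρ + 1))⁻¹ :=
  Complex.differentiable_one_div_Gamma.comp
    ((differentiable_id.add_const (ρ : ℂ)).add_const 1)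

theorem continuous_Gamma_div_line (ρ : ℝ) {q : ℝ} (hq : 0 < q) : Continuous fun t : ℝ =>
    Complex.Gamma (q + t * Complex.I) * (Complex.Gamma (q + t * Complex.I + ρ + 1))⁻¹ := by
  refine Continuous.mul (continuous_iff_continuousAt.2 fun t => ?_)
    ((differentiable_inv_Gamma_add ρ).continuous.comp (continuous_re_add_mul_I q))
  refine ContinuousAt.comp (f := fun t : ℝ => (q : ℂ) + t * Complex.I) ?_
    (continuous_re_add_mul_I q).continuousAt
  refine (Complex.differentiableAt_Gamma _ fun k h => ?_).continuousAt
  have h1 := congrArg Complex.re h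
  simp at h1
  have : (0 : ℝ) ≤ k := k.cast_nonneg
  linarith

theorem integrable_Gamma_div_line {ρ : ℝ} (hρ : 1 ≤ ρ) {q : ℝ} (hq : 0 < q) :
    MeasureTheory.Integrable fun t : ℝ =>
      Complex.Gamma (q + t * Complex.I) * (Complex.Gamma (q + t * Complex.I + ρ + 1))⁻¹ := by
  obtain ⟨C, t₀, hC, ht₀, h⟩ := norm_Gamma_div_le_rpow_neg_two ρ q q hρ
  exact integrable_of_decay (f := fun s => Complex.Gamma s * (Complex.Gamma (s + ρ + 1))⁻¹)
    (C := C) (t₀ := t₀) (continuous_Gamma_div_line ρ hq) fun t ht => by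
      simpa using h (q + t * Complex.I) (by simp) (by simpa using ht)

/-- Euler's Beta integral, read as a Mellin transform. -/
theorem mellin_max_sub_rpow {ρ : ℝ} (hρ : 0 < ρ) {s : ℂ} (hs : 0 < s.re) :
    MellinConvergent (fun t : ℝ => ((max (1 - t) 0 ^ ρ : ℝ) : ℂ)) s ∧
    mellin (fun t : ℝ => ((max (1 - t) 0 ^ ρ : ℝ) : ℂ)) s =
      Complex.Gamma (ρ + 1) * (Complex.Gamma s * (Complex.Gamma (s + ρ + 1))⁻¹) := by
  have h0 : ∀ t : ℝ, t ∈ Set.Ioi 0 \ Set.Ioc (0 : ℝ) 1 →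
      (t : ℂ) ^ (s - 1) • ((max (1 - t) 0 ^ ρ : ℝ) : ℂ) = 0 := fun t ht => by
    have ht' : 1 < t := by
      by_contra hcon
      exact ht.2 ⟨ht.1, not_lt.1 hcon⟩
    rw [max_eq_right (by linarith), Real.zero_rpow hρ.ne']
    simp
  have h1 : ∀ t ∈ Set.Ioc (0 : ℝ) 1, (t : ℂ) ^ (s - 1) • ((max (1 - t) 0 ^ ρ : ℝ) : ℂ) =
      (t : ℂ) ^ (s - 1) * (1 - (t : ℂ)) ^ ((ρ + 1 : ℂ) - 1) := fun t ht => by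
    rw [max_eq_left (by linarith [ht.2]), smul_eq_mul, add_sub_cancel_right,
      Complex.ofReal_cpow (by linarith [ht.2])]
    push_cast
    rfl
  have hre : 0 < ((ρ : ℂ) + 1).re := by simp; linarith
  have hB := Complex.betaIntegral_convergent hs hre
  rw [intervalIntegrable_iff_integrableOn_Ioc_of_le zero_le_one] at hB
  constructor
  · rw [MellinConvergent]
    exact ((MeasureTheory.integrableOn_congr_fun h1 measurableSet_Ioc).2 hB).of_forall_sdiff_eq_zero
      measurableSet_Ioi h0
  · rw [mellin, MeasureTheory.setIntegral_eq_of_subset_of_forall_sdiff_eq_zero measurableSet_Ioi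
      Set.Ioc_subset_Ioi_self h0, MeasureTheory.setIntegral_congr_fun measurableSet_Ioc h1,
      ← intervalIntegral.integral_of_le zero_le_one]
    have hG := Complex.Gamma_mul_Gamma_eq_betaIntegral hs hre
    have hne : Complex.Gamma (s + ρ + 1) ≠ 0 := Complex.Gamma_ne_zero_of_re_pos (by simp; linarith)
    rw [Complex.betaIntegral, ← add_assoc] at hG
    rw [← mul_assoc, ← div_eq_mul_inv, eq_div_iff hne, mul_comm, ← hG, mul_comm]

/-- Mellin inversion of the Beta integral at the point 1/y; the decay |t|^{-1-ρ} provides the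
absolute convergence it requires. -/
theorem integral_Gamma_div_cpow {ρ : ℝ} (hρ : 1 ≤ ρ) {q : ℝ} (hq : 0 < q) {y : ℝ} (hy : 0 < y) :
    ∫ t : ℝ, Complex.Gamma (q + t * Complex.I) * (Complex.Gamma (q + t * Complex.I + ρ + 1))⁻¹ *
      (y : ℂ) ^ (q + t * Complex.I) =
      2 * Real.pi * (Complex.Gamma (ρ + 1))⁻¹ * ((max (1 - y⁻¹) 0 ^ ρ : ℝ) : ℂ) := by
  have hρ0 : 0 < ρ := by linarith
  have hre : ∀ t : ℝ, 0 < ((q : ℂ) + t * Complex.I).re := fun t => by simpa using hq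
  have hm : ∀ t : ℝ, mellin (fun t : ℝ => ((max (1 - t) 0 ^ ρ : ℝ) : ℂ)) (q + t * Complex.I) =
      Complex.Gamma (ρ + 1) * (Complex.Gamma (q + t * Complex.I) *
        (Complex.Gamma (q + t * Complex.I + ρ + 1))⁻¹) := fun t =>
    (mellin_max_sub_rpow hρ0 (hre t)).2
  have key := mellinInv_mellin_eq q (fun t : ℝ => ((max (1 - t) 0 ^ ρ : ℝ) : ℂ))
    (x := y⁻¹) (by positivity) (mellin_max_sub_rpow hρ0 (by simpa using hq)).1 ?_ ?_
  · rw [mellinInv] at key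
    simp only [hm, smul_eq_mul] at key
    have hG : Complex.Gamma (ρ + 1) ≠ 0 := Complex.Gamma_ne_zero_of_re_pos (by simp; linarith)
    rw [← key]
    have e : ∀ t : ℝ, ((y⁻¹ : ℝ) : ℂ) ^ (-((q : ℂ) + t * Complex.I)) * (Complex.Gamma (ρ + 1) *
        (Complex.Gamma (q + t * Complex.I) * (Complex.Gamma (q + t * Complex.I + ρ + 1))⁻¹)) =
        Complex.Gamma (ρ + 1) * (Complex.Gamma (q + t * Complex.I) *
        (Complex.Gamma (q + t * Complex.I + ρ + 1))⁻¹ * (y : ℂ) ^ (q + t * Complex.I)) := fun t => by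
      rw [Complex.ofReal_inv, Complex.inv_cpow _ _ (by
        rw [Complex.arg_ofReal_of_nonneg hy.le]; exact Real.pi_pos.ne), Complex.cpow_neg, inv_inv]
      ring
    simp only [e]
    rw [MeasureTheory.integral_const_mul, Complex.real_smul]
    have hpi : (Real.pi : ℂ) ≠ 0 := by exact_mod_cast Real.pi_pos.ne'
    generalize (∫ t : ℝ, Complex.Gamma (q + t * Complex.I) *
      (Complex.Gamma (q + t * Complex.I + ρ + 1))⁻¹ * (y : ℂ) ^ (q + t * Complex.I)) = J
    push_cast
    field_simp
  · rw [Complex.VerticalIntegrable]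
    simp only [hm]
    exact (integrable_Gamma_div_line hρ hq).const_mul _
  · refine Complex.continuous_ofReal.continuousAt.comp (Continuous.continuousAt ?_)
    exact ((continuous_const.sub continuous_id).max continuous_const).rpow_const
      fun _ => Or.inr hρ0.le

/-- The Riesz mean as a Perron integral. -/
theorem integral_dirichletSeries_mul_Gamma_div {a : ℕ → ℂ} {lam : ℕ → ℝ}
    (hlam : IsFrequencySequence lam) {ρ : ℝ} (hρ : 1 ≤ ρ) {q : ℝ} (hq : 0 < q)
    (ha : Summable fun n => ‖a n‖ * lam n ^ (-q)) {x : ℝ} (hx : 0 < x) :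
    ∫ t : ℝ, dirichletSeries a lam (q + t * Complex.I) * (Complex.Gamma (q + t * Complex.I) *
      (Complex.Gamma (q + t * Complex.I + ρ + 1))⁻¹) * (x : ℂ) ^ (q + t * Complex.I + ρ) =
      2 * Real.pi * rieszSum a lam ρ x := by
  set k : ℝ → ℂ := fun t => Complex.Gamma (q + t * Complex.I) *
    (Complex.Gamma (q + t * Complex.I + ρ + 1))⁻¹ with hk
  have hx' : (x : ℂ) ≠ 0 := by exact_mod_cast hx.ne'
  have hki : MeasureTheory.Integrable k := integrable_Gamma_div_line hρ hq
  set F : ℕ → ℝ → ℂ := fun n t => a n * (x : ℂ) ^ (ρ : ℂ) *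
    (k t * ((x / lam n : ℝ) : ℂ) ^ (q + t * Complex.I)) with hF
  have hpos : ∀ n, 0 < x / lam n := fun n => div_pos hx (hlam.1 n)
  have hnorm : ∀ n t, ‖F n t‖ = ‖a n‖ * lam n ^ (-q) * (x ^ (q + ρ) * ‖k t‖) := fun n t => by
    simp only [hF, norm_mul]
    rw [Complex.norm_cpow_eq_rpow_re_of_pos hx, Complex.norm_cpow_eq_rpow_re_of_pos (hpos n)]
    have : ((q : ℂ) + t * Complex.I).re = q := by simp
    rw [this, Complex.ofReal_re, Real.div_rpow hx.le (hlam.1 n).le, Real.rpow_neg (hlam.1 n).le,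
      Real.rpow_add hx]
    ring
  have hFi : ∀ n, MeasureTheory.Integrable (F n) := fun n => by
    refine (MeasureTheory.Integrable.mul_bdd (c := (x / lam n) ^ q) hki ?_ ?_).const_mul _
    · refine Continuous.aestronglyMeasurable ?_
      exact (continuous_re_add_mul_I q).const_cpow (Or.inl (by exact_mod_cast (hpos n).ne'))
    · refine Eventually.of_forall fun t => ?_
      rw [Complex.norm_cpow_eq_rpow_re_of_pos (hpos n)]
      simp
  have hsum : Summable fun n => ∫ t, ‖F n t‖ := by
    simp only [hnorm, MeasureTheory.integral_const_mul]
    exact ha.mul_right _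
  have key := MeasureTheory.hasSum_integral_of_summable_integral_norm hFi hsum
  have hterm : ∀ t : ℝ, ∑' n, F n t = dirichletSeries a lam (q + t * Complex.I) * k t *
      (x : ℂ) ^ (q + t * Complex.I + ρ) := fun t => by
    rw [dirichletSeries, ← tsum_mul_right, ← tsum_mul_right]
    refine tsum_congr fun n => ?_
    have hl : (lam n : ℂ) ≠ 0 := by exact_mod_cast (hlam.1 n).ne'
    simp only [hF]
    rw [Complex.ofReal_div, Complex.div_cpow_ofReal_nonneg hx.le (hlam.1 n).le, Complex.cpow_neg,
      Complex.cpow_add (q + t * Complex.I) (ρ : ℂ) hx', div_eq_mul_inv]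
    ring
  have hval : ∀ n, ∫ t, F n t = 2 * Real.pi * ((Complex.Gamma (ρ + 1))⁻¹ *
      (a n * ((max (x - lam n) 0 ^ ρ : ℝ) : ℂ))) := fun n => by
    simp only [hF]
    rw [MeasureTheory.integral_const_mul, integral_Gamma_div_cpow hρ hq (hpos n)]
    have : max (x - lam n) 0 = x * max (1 - (x / lam n)⁻¹) 0 := by
      rw [mul_max_of_nonneg _ _ hx.le, mul_zero, inv_div, mul_sub, mul_one,
        mul_div_cancel₀ _ hx.ne']
    rw [this, Real.mul_rpow hx.le (le_max_right _ _), Complex.ofReal_mul,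
      Complex.ofReal_cpow hx.le]
    ring
  simp only [hterm, hval] at key
  rw [← key.tsum_eq, tsum_mul_left, tsum_mul_left]
  obtain ⟨N, hN⟩ := eventually_atTop.1 (hlam.2.2.eventually_ge_atTop x)
  rw [rieszSum_eq (by linarith) hN]
  congr 2
  refine tsum_eq_sum fun n hn => ?_
  rw [max_eq_right (by linarith [hN n (by simpa using hn)]), Real.zero_rpow (by linarith)]
  simp

end RieszSum

namespace RieszSum

/-! ### The identity for Riesz means of large order -/

/-- With c = p = q the horizontal pieces are degenerate, and the contour is the full line. -/
theorem bentIntegral_self {f : ℂ → ℂ} {q : ℝ}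
    (hf : MeasureTheory.Integrable fun t : ℝ => f (q + t * Complex.I)) (T : ℝ) :
    bentIntegral f q q T = (2 * (Real.pi : ℂ))⁻¹ * ∫ t : ℝ, f (q + t * Complex.I) := by
  have h1 := intervalIntegral.integral_interval_add_Ioi (a := -T) (b := T)
    (f := fun t : ℝ => f (q + t * Complex.I)) hf.integrableOn hf.integrableOn
  have h2 := intervalIntegral.integral_Iic_add_Ioi (b := -T)
    (f := fun t : ℝ => f (q + t * Complex.I)) hf.integrableOn hf.integrableOn
  rw [bentIntegral, intervalIntegral.integral_same, intervalIntegral.integral_same, ← h2, ← h1,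
    mul_inv]
  linear_combination ((2 * (Real.pi : ℂ))⁻¹ * ((∫ t in Set.Iic (-T), f (q + t * Complex.I)) +
    ((∫ t in (-T)..T, f (q + t * Complex.I)) + ∫ t in Set.Ioi T, f (q + t * Complex.I)))) *
    mul_inv_cancel₀ Complex.I_ne_zero

section

variable {r : ℕ} {δ ρ : ℝ} {α : Fin r → ℝ} {β : Fin r → ℂ}

theorem integrable_gammaQuotient_line (hα : ∀ i, 0 < α i) (hβ : ∀ i, 0 ≤ (β i).re) {q : ℝ}
    (hq : 0 < q) (hk : ∀ k : ℕ, q ≠ δ + k) (hρ : (2 * q - δ) * ∑ i, α i + 1 ≤ ρ) :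
    MeasureTheory.Integrable fun t : ℝ => gammaQuotient δ α β ρ (q + t * Complex.I) := by
  obtain ⟨C, t₀, hC, ht₀, h⟩ := norm_gammaQuotient_le δ hα β ρ q q
  refine integrable_of_decay (C := C) (t₀ := max t₀ 1)
    (continuous_gammaQuotient_line hα hβ ρ hq hk) fun t ht => ?_
  have := h (q + t * Complex.I) (by simp) (by simpa using (le_max_left _ _).trans ht)
  refine this.trans (mul_le_mul_of_nonneg_left ?_ hC.le)
  simp only [Complex.add_im, Complex.ofReal_im, Complex.mul_im, Complex.ofReal_re, Complex.I_im,
    mul_one, Complex.I_re, mul_zero, add_zero, zero_add, Complex.add_re, Complex.mul_re, sub_self]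
  exact Real.rpow_le_rpow_of_exponent_le ((le_max_right _ _).trans ht) (by linarith)

theorem integrable_integrand_line (hα : ∀ i, 0 < α i) (hβ : ∀ i, 0 ≤ (β i).re) {q : ℝ}
    (hq : 0 < q) (hk : ∀ k : ℕ, q ≠ δ + k) (hρ : (2 * q - δ) * ∑ i, α i + 1 ≤ ρ) {y : ℝ}
    (hy : 0 < y) :
    MeasureTheory.Integrable fun t : ℝ => integrand δ α β ρ y (q + t * Complex.I) := by
  refine (integrable_gammaQuotient_line hα hβ hq hk hρ).mul_bdd (c := y ^ (-q))
    (aestronglyMeasurable_cpow_line hy q).aestronglyMeasurable (Eventually.of_forall fun t => ?_)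
  rw [Complex.norm_cpow_eq_rpow_re_of_pos hy]
  simp

theorem conj_dirichletSeries {b : ℕ → ℂ} {mu : ℕ → ℝ} (hmu : ∀ n, 0 < mu n) (s : ℂ) :
    starRingEnd ℂ (dirichletSeries b mu (starRingEnd ℂ s)) =
      ∑' n, starRingEnd ℂ (b n) * (mu n : ℂ) ^ (-s) := by
  rw [dirichletSeries, Complex.conj_tsum]
  refine tsum_congr fun n => ?_
  rw [map_mul, ← map_neg, Complex.cpow_conj, Complex.conj_conj, Complex.conj_ofReal]
  rw [Complex.arg_ofReal_of_nonneg (hmu n).le]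
  exact Real.pi_pos.ne

theorem integral_conj_dirichletSeries_mul_gammaQuotient (hα : ∀ i, 0 < α i)
    (hβ : ∀ i, 0 ≤ (β i).re) {q : ℝ} (hq : 0 < q) (hk : ∀ k : ℕ, q ≠ δ + k)
    (hρ : (2 * q - δ) * ∑ i, α i + 1 ≤ ρ) {b : ℕ → ℂ} {mu : ℕ → ℝ} (hmu : ∀ n, 0 < mu n)
    (hb : Summable fun n => ‖b n‖ * mu n ^ (-q)) {y : ℝ} (hy : 0 < y) :
    ∫ t : ℝ, starRingEnd ℂ (dirichletSeries b mu (starRingEnd ℂ (q + t * Complex.I))) *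
      integrand δ α β ρ y (q + t * Complex.I) =
      ∑' n, starRingEnd ℂ (b n) * ∫ t : ℝ, integrand δ α β ρ (mu n * y) (q + t * Complex.I) := by
  set F : ℕ → ℝ → ℂ := fun n t => starRingEnd ℂ (b n) *
    integrand δ α β ρ (mu n * y) (q + t * Complex.I) with hF
  have hFi : ∀ n, MeasureTheory.Integrable (F n) := fun n =>
    (integrable_integrand_line hα hβ hq hk hρ (mul_pos (hmu n) hy)).const_mul _
  have hnorm : ∀ n t, ‖F n t‖ = ‖b n‖ * mu n ^ (-q) *
      (y ^ (-q) * ‖gammaQuotient δ α β ρ (q + t * Complex.I)‖) := fun n t => by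
    simp only [hF, integrand, norm_mul, Complex.norm_conj]
    rw [Complex.norm_cpow_eq_rpow_re_of_pos (mul_pos (hmu n) hy)]
    have : (-((q : ℂ) + t * Complex.I)).re = -q := by simp
    rw [this, Real.mul_rpow (hmu n).le hy.le]
    ring
  have hsum : Summable fun n => ∫ t, ‖F n t‖ := by
    simp only [hnorm, MeasureTheory.integral_const_mul]
    exact hb.mul_right _
  have key := MeasureTheory.hasSum_integral_of_summable_integral_norm hFi hsum
  have hval : ∀ n, ∫ t, F n t = starRingEnd ℂ (b n) *
      ∫ t : ℝ, integrand δ α β ρ (mu n * y) (q + t * Complex.I) := fun n =>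
    MeasureTheory.integral_const_mul _ _
  have hterm : ∀ t : ℝ, ∑' n, F n t =
      starRingEnd ℂ (dirichletSeries b mu (starRingEnd ℂ (q + t * Complex.I))) *
        integrand δ α β ρ y (q + t * Complex.I) := fun t => by
    rw [conj_dirichletSeries hmu, ← tsum_mul_right]
    refine tsum_congr fun n => ?_
    simp only [hF, integrand]
    rw [Complex.ofReal_mul, Complex.mul_cpow_ofReal_nonneg (hmu n).le hy.le]
    ring
  simp only [hterm, hval] at key
  exact key.tsum_eq.symm

end

section

variable {r : ℕ} {a b : ℕ → ℂ} {lam mu : ℕ → ℝ} {σa σb δ Q : ℝ} {ω : ℂ}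
    {α : Fin r → ℝ} {β : Fin r → ℂ} {S : Set ℂ} {χ : ℂ → ℂ}

/-- Under s = δ - z the Perron integrand becomes, by the functional equation, the conjugate series
times the Mellin–Barnes integrand; collecting the powers of Q produces the argument x/Q². -/
theorem InClassC.phiCont_mul_Gamma_reflect (hC : InClassC a b lam mu σa σb δ Q ω α β S χ) {z : ℂ}
    (hz : δ - z ∉ S) (h1 : σb < z.re) (h2 : 0 < z.re) (ρ : ℝ) {x : ℝ} (hx : 0 < x) :
    phiCont Q α β χ (δ - z) * Complex.Gamma (δ - z) * (Complex.Gamma (δ - z + ρ + 1))⁻¹ *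
      (x : ℂ) ^ (δ - z + ρ) =
    ω * (x : ℂ) ^ ((δ : ℂ) + ρ) / (Q : ℂ) ^ (δ : ℂ) *
      (starRingEnd ℂ (dirichletSeries b mu (starRingEnd ℂ z)) *
        integrand δ α β ρ (x / Q ^ 2) z) := by
  have hQ : (Q : ℂ) ≠ 0 := by exact_mod_cast hC.Q_pos.ne'
  have hx' : (x : ℂ) ≠ 0 := by exact_mod_cast hx.ne'
  rw [hC.phiCont_eq_left hz (by simp; linarith) (by simp; linarith), integrand, gammaQuotient_eq]
  simp only [map_sub, Complex.conj_ofReal, sub_sub_cancel]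
  have e1 : (Q : ℂ) ^ ((δ : ℂ) - 2 * (δ - z)) = (Q : ℂ) ^ z * (Q : ℂ) ^ z / (Q : ℂ) ^ (δ : ℂ) := by
    rw [← Complex.cpow_add _ _ hQ, ← Complex.cpow_sub _ _ hQ]
    ring_nf
  have e2 : (x : ℂ) ^ ((δ : ℂ) - z + ρ) = (x : ℂ) ^ ((δ : ℂ) + ρ) * (x : ℂ) ^ (-z) := by
    rw [← Complex.cpow_add _ _ hx']
    ring_nf
  have e3 : ((x / Q ^ 2 : ℝ) : ℂ) ^ (-z) = (x : ℂ) ^ (-z) * ((Q : ℂ) ^ z * (Q : ℂ) ^ z) := by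
    rw [Complex.ofReal_div, Complex.div_cpow_ofReal_nonneg hx.le (by positivity), pow_two,
      Complex.ofReal_mul, Complex.mul_cpow_ofReal_nonneg hC.Q_pos.le hC.Q_pos.le, Complex.cpow_neg,
      Complex.cpow_neg (Q : ℂ)]
    have : (Q : ℂ) ^ z ≠ 0 := by simp [Complex.cpow_eq_zero_iff, hQ]
    field_simp
  rw [e1, e2, e3, show (1 : ℂ) + δ - z + ρ = δ - z + ρ + 1 by ring]
  ring

/-- For large orders every integral converges absolutely: Perron's formula on Re s = q, the shift to
Re s = δ - q across the circle, and termwise integration of the reflected series give the identity.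
-/
theorem InClassC.exists_rieszSum_eq_of_large (hC : InClassC a b lam mu σa σb δ Q ω α β S χ)
    {p R : ℝ} {z₀ : ℂ} (hcirc : IsAdmissibleCircle δ Q α β S χ p z₀ R) {q : ℝ} (hqp : q < p)
    (hq0 : 0 < q) (hqa : σa < q) (hqb : σb < q) (hA : δ - q < z₀.re - R) (hB : z₀.re + R < q)
    (hk : ∀ k : ℕ, q ≠ δ + k) : ∃ ρ₀ : ℝ, ∀ ρ, ρ₀ ≤ ρ → ∀ T x : ℝ, 0 < x →
      rieszSum a lam ρ x = residualTerm Q α β χ z₀ R ρ x +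
        ω * (x : ℂ) ^ ((δ : ℂ) + ρ) / (Q : ℂ) ^ (δ : ℂ) * ∑' n, starRingEnd ℂ (b n) *
          bentIntegral (integrand δ α β ρ (mu n * x / Q ^ 2)) q q T := by
  have hR := hcirc.radius_pos
  obtain ⟨f, hfd, hfraw, hres⟩ := hC.exists_clean hcirc
  obtain ⟨M, C, t₀, hC0, ht₀, hφ⟩ := hC.exists_norm_phiCont_le hq0 hqa hqb hR hA hB
    hcirc.encloses_S
  -- The two bounds on ρ give decay |t|^{-2}: the first for the Perron integrand in the strip, where
  -- φ grows like |t|^M, the second for the Gamma quotient on Re s = q.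
  refine ⟨max (M + 1) ((2 * q - δ) * ∑ i, α i + 1), fun ρ hρ T x hx => ?_⟩
  have hρ1 := (le_max_left _ _).trans hρ
  have hρ2 := (le_max_right _ _).trans hρ
  have hM0 : (0 : ℝ) ≤ M := M.cast_nonneg
  have hx' : (x : ℂ) ≠ 0 := by exact_mod_cast hx.ne'
  have hre : ∀ s ∈ Metric.ball z₀ R, |s.re - z₀.re| < R := fun s hs => by
    rw [← Complex.sub_re]
    exact (Complex.abs_re_le_norm _).trans_lt (by simpa [dist_eq_norm] using hs)
  have him : ∀ s ∈ Metric.ball z₀ R, |s.im| < |z₀.im| + R := fun s hs => by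
    have h := (Complex.abs_im_le_norm (s - z₀)).trans_lt (by simpa [dist_eq_norm] using hs)
    rw [Complex.sub_im] at h
    have := abs_sub_abs_le_abs_sub s.im z₀.im
    linarith
  set F : ℂ → ℂ := fun s => f s * (Complex.Gamma (s + ρ + 1))⁻¹ * (x : ℂ) ^ (s + (ρ : ℂ)) with hF
  have hFd : ∀ s : ℂ, s.re ∈ Set.Icc (δ - q) q → s ∉ Metric.ball z₀ R →
      DifferentiableAt ℂ F s := fun s hs hsb => by
    refine ((hfd s ⟨by linarith [hs.1], by linarith [hs.2]⟩ hsb).mul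
      (differentiable_inv_Gamma_add ρ s)).mul ?_
    exact (differentiableAt_id.add_const (ρ : ℂ)).const_cpow (Or.inl hx')
  obtain ⟨C₁, t₁, hC₁, ht₁, hΓ⟩ := norm_Gamma_div_le ρ (δ - q) q
  have hdec : ∀ s : ℂ, s.re ∈ Set.Icc (δ - q) q → max (max t₀ t₁) (|z₀.im| + R) ≤ |s.im| →
      ‖F s‖ ≤ C * C₁ * (x ^ (δ - q + ρ) + x ^ (q + ρ)) * |s.im| ^ (-2 : ℝ) := by
    intro s hs ht
    have h1 := (le_max_left _ _).trans ((le_max_left _ _).trans ht)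
    have h2 := (le_max_right _ _).trans ((le_max_left _ _).trans ht)
    have h3 := (le_max_right _ _).trans ht
    have ht1 : 1 ≤ |s.im| := ht₀.trans h1
    have hsS : s ∉ S := fun h => absurd (him s (hcirc.encloses_S h)) (not_lt.2 h3)
    have hsk : ∀ k : ℕ, s ≠ -k := fun k h => by
      rw [h] at ht1
      simp at ht1
      linarith
    simp only [hF]
    rw [hfraw s hsS hsk, mul_assoc (phiCont Q α β χ s), norm_mul, norm_mul,
      Complex.norm_cpow_eq_rpow_re_of_pos hx]
    have h4 : x ^ (s + (ρ : ℂ)).re ≤ x ^ (δ - q + ρ) + x ^ (q + ρ) :=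
      rpow_le_rpow_add_rpow hx (by simp; linarith [hs.1]) (by simp; linarith [hs.2])
    calc _ ≤ C * |s.im| ^ M * (C₁ * |s.im| ^ (-1 - ρ)) * (x ^ (δ - q + ρ) + x ^ (q + ρ)) := by
          have := hφ s hs h1
          have := hΓ s hs h2
          gcongr
      _ = C * C₁ * (x ^ (δ - q + ρ) + x ^ (q + ρ)) * |s.im| ^ ((M : ℝ) + (-1 - ρ)) := by
          rw [Real.rpow_add (x := |s.im|) (by linarith), Real.rpow_natCast]; ring
      _ ≤ _ := by
          refine mul_le_mul_of_nonneg_left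
            (Real.rpow_le_rpow_of_exponent_le ht1 (by linarith)) (by positivity)
  obtain ⟨-, -, hshift⟩ := integral_sub_integral_eq_circleIntegral hR hA hB hFd hdec
  rw [← hres ρ x] at hshift
  have hright : ∫ t : ℝ, F (q + t * Complex.I) = 2 * Real.pi * rieszSum a lam ρ x := by
    rw [← integral_dirichletSeries_mul_Gamma_div hC.lam_seq (by linarith) hq0
      (hC.abscissa_a.summable hC.lam_seq hqa) hx]
    congr 1
    funext t
    have hs : ((q : ℂ) + t * Complex.I).re = q := by simp
    have hsS : (q : ℂ) + t * Complex.I ∉ S := fun h => by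
      have := abs_lt.1 (hre _ (hcirc.encloses_S h))
      rw [hs] at this; linarith
    have hsk : ∀ k : ℕ, (q : ℂ) + t * Complex.I ≠ -k := fun k h => by
      rw [h] at hs
      simp at hs
      have : (0 : ℝ) ≤ k := k.cast_nonneg
      linarith
    simp only [hF]
    rw [hfraw _ hsS hsk, hC.phiCont_eq_right hsS (by rw [hs]; exact hqa) (by rw [hs]; exact hq0)]
    ring
  have hleft : ∫ t : ℝ, F ((δ - q : ℝ) + t * Complex.I) =
      ω * (x : ℂ) ^ ((δ : ℂ) + ρ) / (Q : ℂ) ^ (δ : ℂ) * ∑' n, starRingEnd ℂ (b n) *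
        ∫ t : ℝ, integrand δ α β ρ (mu n * (x / Q ^ 2)) (q + t * Complex.I) := by
    rw [← integral_conj_dirichletSeries_mul_gammaQuotient hC.α_pos hC.β_re hq0 hk hρ2
      hC.mu_seq.1 (hC.abscissa_b.summable hC.mu_seq hqb) (div_pos hx (pow_pos hC.Q_pos 2)),
      ← MeasureTheory.integral_const_mul, ← MeasureTheory.integral_neg_eq_self]
    congr 1
    funext t
    -- After the change t → -t the left line is the reflection δ - z of the line z = q + it.
    have hz : ((δ - q : ℝ) : ℂ) + ((-t : ℝ) : ℂ) * Complex.I = δ - (q + t * Complex.I) := by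
      push_cast; ring
    rw [hz]
    have hs : ((δ : ℂ) - (q + t * Complex.I)).re = δ - q := by simp
    have hsS : (δ : ℂ) - (q + t * Complex.I) ∉ S := fun h => by
      have := abs_lt.1 (hre _ (hcirc.encloses_S h))
      rw [hs] at this; linarith
    have hsk : ∀ k : ℕ, (δ : ℂ) - (q + t * Complex.I) ≠ -k := fun k h => by
      rw [h] at hs
      simp at hs
      exact hk k (by linarith)
    simp only [hF]
    rw [hfraw _ hsS hsk]
    exact hC.phiCont_mul_Gamma_reflect hsS (by simpa using hqb) (by simpa using hq0) ρ hx
  have hbent : ∀ n, bentIntegral (integrand δ α β ρ (mu n * x / Q ^ 2)) q q T =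
      (2 * (Real.pi : ℂ))⁻¹ *
        ∫ t : ℝ, integrand δ α β ρ (mu n * (x / Q ^ 2)) (q + t * Complex.I) := fun n => by
    rw [mul_div_assoc]
    exact bentIntegral_self (integrable_integrand_line hC.α_pos hC.β_re hq0 hk hρ2
      (mul_pos (hC.mu_seq.1 n) (div_pos hx (pow_pos hC.Q_pos 2)))) T
  simp only [hbent, mul_left_comm _ (2 * (Real.pi : ℂ))⁻¹]
  rw [hright, hleft] at hshift
  rw [tsum_mul_left]
  have hpi : (Real.pi : ℂ) ≠ 0 := by exact_mod_cast Real.pi_pos.ne'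
  have h2pi : (2 * (Real.pi : ℂ)) ≠ 0 := mul_ne_zero two_ne_zero hpi
  refine mul_left_cancel₀ h2pi ?_
  rw [mul_add, mul_left_comm _ (2 * (Real.pi : ℂ))⁻¹, mul_inv_cancel_left₀ h2pi]
  linear_combination hshift

end

end RieszSum

namespace RieszSum

/-! ### Descent to small orders -/

section

variable {r : ℕ} {δ ρ : ℝ} {α : Fin r → ℝ} {β : Fin r → ℂ}

/-- A majorant for the dual series, uniform for x in compact intervals. The arguments μ_n x/Q² stay
above their value for the first μ and x = x₁, which serves as y₀, and the estimate y^{-σ} reproduces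
the terms of the absolutely convergent series for ψ. -/
theorem exists_norm_mul_bentIntegral_le (hα : ∀ i, 0 < α i) (hd : 0 < ∑ i, α i)
    (hβ : ∀ i, 0 ≤ (β i).re) {q c T σ Q : ℝ} (hQ : 0 < Q) (hq : 0 < q) (hk : ∀ k : ℕ, q ≠ δ + k)
    (hσ : (2 * σ - δ) * ∑ i, α i - 1 / 2 < ρ) (hσq : σ ≤ q)
    (hc : (2 * c - δ) * ∑ i, α i < ρ) (hT : AbovePoles α β T) {b : ℕ → ℂ} {mu : ℕ → ℝ}
    (hmu : IsFrequencySequence mu) {x₁ x₂ : ℝ} (hx₁ : 0 < x₁) :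
    ∃ C, ∀ n, ∀ x ∈ Set.Icc x₁ x₂, ‖starRingEnd ℂ (b n) *
      ((x : ℂ) ^ ((δ : ℂ) + ρ) * bentIntegral (integrand δ α β ρ (mu n / Q ^ 2 * x)) q c T)‖ ≤
      C * (‖b n‖ * mu n ^ (-σ)) := by
  have hm : ∀ n, 0 < mu n / Q ^ 2 := fun n => div_pos (hmu.1 n) (pow_pos hQ 2)
  obtain ⟨C, hC, hb⟩ := exists_norm_bentIntegral_le hα hd hβ hq hk hσ hσq hc hT
    (mul_pos (hm 0) hx₁)
  obtain ⟨K, hK⟩ := (isCompact_Icc (a := x₁) (b := x₂)).exists_bound_of_continuousOn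
    (f := fun x : ℝ => x ^ (δ + ρ - σ)) fun x hx =>
      (Real.continuousAt_rpow_const x _ (Or.inl (hx₁.trans_le hx.1).ne')).continuousWithinAt
  refine ⟨K * (C * (Q ^ 2) ^ σ), fun n x hx => ?_⟩
  have hx0 : 0 < x := hx₁.trans_le hx.1
  have h1 : mu 0 / Q ^ 2 * x₁ ≤ mu n / Q ^ 2 * x := by
    have h := hmu.2.1.monotone (Nat.zero_le n)
    have := (hmu.1 n).le
    exact mul_le_mul (by gcongr) hx.1 hx₁.le (hm n).le
  have h2 := hb _ h1
  have h3 := hK x hx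
  rw [Real.norm_of_nonneg (Real.rpow_nonneg hx0.le _)] at h3
  rw [norm_mul, norm_mul, Complex.norm_conj, Complex.norm_cpow_eq_rpow_re_of_pos hx0]
  have e : ((δ : ℂ) + ρ).re = δ + ρ := by simp
  have hbmu : 0 ≤ ‖b n‖ * mu n ^ (-σ) :=
    mul_nonneg (norm_nonneg _) (Real.rpow_nonneg (hmu.1 n).le _)
  calc _ ≤ ‖b n‖ * (x ^ (δ + ρ) * (C * (mu n / Q ^ 2 * x) ^ (-σ))) := by
        rw [e]
        gcongr
    _ = x ^ (δ + ρ - σ) * (C * (Q ^ 2) ^ σ) * (‖b n‖ * mu n ^ (-σ)) := by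
        rw [Real.mul_rpow (hm n).le hx0.le, Real.div_rpow (hmu.1 n).le (by positivity),
          Real.rpow_neg (pow_pos hQ 2).le, sub_eq_add_neg, Real.rpow_add hx0 (δ + ρ) (-σ),
          div_inv_eq_mul]
        ring
    _ ≤ _ := by
        refine mul_le_mul_of_nonneg_right (mul_le_mul_of_nonneg_right h3 ?_) hbmu
        positivity

theorem summable_mul_bentIntegral (hα : ∀ i, 0 < α i) (hd : 0 < ∑ i, α i)
    (hβ : ∀ i, 0 ≤ (β i).re) {q c T σ Q : ℝ} (hQ : 0 < Q) (hq : 0 < q) (hk : ∀ k : ℕ, q ≠ δ + k)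
    (hσ : (2 * σ - δ) * ∑ i, α i - 1 / 2 < ρ) (hσq : σ ≤ q)
    (hc : (2 * c - δ) * ∑ i, α i < ρ) (hT : AbovePoles α β T) {b : ℕ → ℂ} {mu : ℕ → ℝ}
    (hmu : IsFrequencySequence mu) (hb : Summable fun n => ‖b n‖ * mu n ^ (-σ)) {x : ℝ}
    (hx : 0 < x) : Summable fun n => starRingEnd ℂ (b n) *
      ((x : ℂ) ^ ((δ : ℂ) + ρ) * bentIntegral (integrand δ α β ρ (mu n / Q ^ 2 * x)) q c T) := by
  obtain ⟨C, hC⟩ := exists_norm_mul_bentIntegral_le hα hd hβ hQ hq hk hσ hσq hc hT (b := b) hmu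
    (x₂ := x) hx
  exact Summable.of_norm_bounded (hb.mul_left C) fun n => hC n x ⟨le_rfl, le_rfl⟩

theorem hasDerivAt_tsum_mul_bentIntegral (hα : ∀ i, 0 < α i) (hd : 0 < ∑ i, α i)
    (hβ : ∀ i, 0 ≤ (β i).re) {q c T σ Q : ℝ} (hQ : 0 < Q) (hq : 0 < q) (hk : ∀ k : ℕ, q ≠ δ + k)
    (hσ : (2 * σ - δ) * ∑ i, α i - 1 / 2 < ρ) (hσq : σ ≤ q) (hcq : c ≤ q)
    (hc : (2 * c - δ) * ∑ i, α i < ρ) (hT : AbovePoles α β T) {b : ℕ → ℂ} {mu : ℕ → ℝ}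
    (hmu : IsFrequencySequence mu) (hb : Summable fun n => ‖b n‖ * mu n ^ (-σ)) {x : ℝ}
    (hx : 0 < x) :
    HasDerivAt (fun x : ℝ => ∑' n, starRingEnd ℂ (b n) * ((x : ℂ) ^ ((δ : ℂ) + (ρ + 1 : ℝ)) *
        bentIntegral (integrand δ α β (ρ + 1) (mu n / Q ^ 2 * x)) q c T))
      (∑' n, starRingEnd ℂ (b n) * ((x : ℂ) ^ ((δ : ℂ) + ρ) *
        bentIntegral (integrand δ α β ρ (mu n / Q ^ 2 * x)) q c T)) x := by
  have hm : ∀ n, 0 < mu n / Q ^ 2 := fun n => div_pos (hmu.1 n) (pow_pos hQ 2)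
  obtain ⟨C, hC⟩ := exists_norm_mul_bentIntegral_le hα hd hβ hQ hq hk hσ hσq hc hT (b := b) hmu
    (x₁ := x / 2) (x₂ := 2 * x) (by positivity)
  have hxmem : x ∈ Set.Ioo (x / 2) (2 * x) := ⟨by linarith, by linarith⟩
  exact hasDerivAt_tsum_of_isPreconnected (hb.mul_left C) isOpen_Ioo isPreconnected_Ioo
    (fun n y hy => (hasDerivAt_bentIntegral hα hβ hq hk hcq hc hT (hm n)
      (lt_trans (by positivity) hy.1)).const_mul _)
    (fun n y hy => hC n y (Set.Ioo_subset_Icc_self hy)) hxmem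
    (summable_mul_bentIntegral hα hd hβ hQ hq hk (by linarith) hσq (by linarith) hT hmu hb hx)
    hxmem

end

/-! ### Descent for the class 𝒞 -/

section

variable {r : ℕ} {a b : ℕ → ℂ} {lam mu : ℕ → ℝ} {σa σb δ Q : ℝ} {ω : ℂ}
    {α : Fin r → ℝ} {β : Fin r → ℂ} {S : Set ℂ} {χ : ℂ → ℂ}

/-- Differentiation brings down s + ρ + 1, which lowers 1/Γ(s+ρ+2) to 1/Γ(s+ρ+1), as in the
Mellin–Barnes integral. -/
theorem InClassC.hasDerivAt_residualTerm (hC : InClassC a b lam mu σa σb δ Q ω α β S χ)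
    {p R : ℝ} {z₀ : ℂ} (hcirc : IsAdmissibleCircle δ Q α β S χ p z₀ R) (ρ : ℝ) {x : ℝ}
    (hx : 0 < x) :
    HasDerivAt (residualTerm Q α β χ z₀ R (ρ + 1)) (residualTerm Q α β χ z₀ R ρ x) x := by
  obtain ⟨f, hfd, -, hres⟩ := hC.exists_clean hcirc
  have hfs : ContinuousOn f (Metric.sphere z₀ R) := fun s hs =>
    (hfd s (hcirc.subset_strip hs) (by simp [Metric.mem_sphere.1 hs])).continuousAt.continuousWithinAt
  have key := hasDerivAt_circleIntegral_cpow hcirc.radius_pos (hfs.mul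
    (differentiable_inv_Gamma_add (ρ + 1)).continuous.continuousOn) (ρ + 1) hx
  rw [show residualTerm Q α β χ z₀ R (ρ + 1) = fun x => _ from funext (hres (ρ + 1)), hres ρ x]
  refine key.congr_deriv ?_
  congr 2
  funext s
  have h := Complex.one_div_Gamma_eq_self_mul_one_div_Gamma_add_one (s + ρ + 1)
  rw [h]
  simp only [Pi.mul_apply]
  push_cast
  rw [show s + (ρ + 1 : ℂ) - 1 = s + ρ by ring, show s + (ρ + 1 : ℂ) + 1 = s + ρ + 1 + 1 by ring]
  ring

theorem InClassC.isResidualFunction_residualTerm (hC : InClassC a b lam mu σa σb δ Q ω α β S χ)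
    {p R : ℝ} {z₀ : ℂ} (hcirc : IsAdmissibleCircle δ Q α β S χ p z₀ R) (ρ : ℝ) :
    IsResidualFunction (residualTerm Q α β χ z₀ R ρ) := by
  obtain ⟨f, hfd, -, hres⟩ := hC.exists_clean hcirc
  have hfs : ContinuousOn f (Metric.sphere z₀ R) := fun s hs =>
    (hfd s (hcirc.subset_strip hs) (by simp [Metric.mem_sphere.1 hs])).continuousAt.continuousWithinAt
  rw [show residualTerm Q α β χ z₀ R ρ = fun x => _ from funext (hres ρ)]
  exact isResidualFunction_circleIntegral hcirc.radius_pos (hfs.mul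
    (differentiable_inv_Gamma_add ρ).continuous.continuousOn) ρ

theorem tsum_mul_mul_left (f g : ℕ → ℂ) (z : ℂ) :
    ∑' n, f n * (z * g n) = z * ∑' n, f n * g n := by
  rw [← tsum_mul_left]
  exact tsum_congr fun n => mul_left_comm _ _ _

/-- The identity between the Riesz mean of order `ρ` and the dual series, for fixed contours. -/
def RieszIdentity {r : ℕ} (a b : ℕ → ℂ) (lam mu : ℕ → ℝ) (δ Q : ℝ) (ω : ℂ) (α : Fin r → ℝ)
    (β : Fin r → ℂ) (χ : ℂ → ℂ) (z₀ : ℂ) (R q c T ρ : ℝ) : Prop :=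
  ∀ x : ℝ, 0 < x → rieszSum a lam ρ x = residualTerm Q α β χ z₀ R ρ x +
    ω / (Q : ℂ) ^ (δ : ℂ) * ∑' n, starRingEnd ℂ (b n) *
      ((x : ℂ) ^ ((δ : ℂ) + ρ) * bentIntegral (integrand δ α β ρ (mu n / Q ^ 2 * x)) q c T)

theorem InClassC.sum_pos (hC : InClassC a b lam mu σa σb δ Q ω α β S χ) : 0 < ∑ i, α i :=
  Finset.sum_pos (fun i _ => hC.α_pos i) ⟨⟨0, hC.r_pos⟩, Finset.mem_univ _⟩

variable {p R q c T σ ρ : ℝ} {z₀ : ℂ}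

/-- The right-hand side of the identity of order `ρ + 1` has the right-hand side of the identity
of order `ρ` as its derivative. -/
theorem InClassC.hasDerivAt_dual (hC : InClassC a b lam mu σa σb δ Q ω α β S χ)
    (hcirc : IsAdmissibleCircle δ Q α β S χ p z₀ R) (hq : 0 < q) (hk : ∀ k : ℕ, q ≠ δ + k)
    (hb : σb < σ) (hσq : σ ≤ q) (hcq : c ≤ q) (hT : AbovePoles α β T)
    (hσ : (2 * σ - δ) * ∑ i, α i - 1 / 2 < ρ) (hc : (2 * c - δ) * ∑ i, α i < ρ) {x : ℝ}
    (hx : 0 < x) :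
    HasDerivAt (fun x : ℝ => residualTerm Q α β χ z₀ R (ρ + 1) x +
      ω / (Q : ℂ) ^ (δ : ℂ) * ∑' n, starRingEnd ℂ (b n) * ((x : ℂ) ^ ((δ : ℂ) + (ρ + 1 : ℝ)) *
        bentIntegral (integrand δ α β (ρ + 1) (mu n / Q ^ 2 * x)) q c T))
      (residualTerm Q α β χ z₀ R ρ x +
      ω / (Q : ℂ) ^ (δ : ℂ) * ∑' n, starRingEnd ℂ (b n) * ((x : ℂ) ^ ((δ : ℂ) + ρ) *
        bentIntegral (integrand δ α β ρ (mu n / Q ^ 2 * x)) q c T)) x :=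
  (hC.hasDerivAt_residualTerm hcirc ρ hx).add
    ((hasDerivAt_tsum_mul_bentIntegral hC.α_pos hC.sum_pos hC.β_re hC.Q_pos hq hk hσ hσq hcq hc hT
      hC.mu_seq (hC.abscissa_b.summable hC.mu_seq hb) hx).const_mul _)

theorem InClassC.rieszIdentity_of_add_one (hC : InClassC a b lam mu σa σb δ Q ω α β S χ)
    (hcirc : IsAdmissibleCircle δ Q α β S χ p z₀ R) (hq : 0 < q) (hk : ∀ k : ℕ, q ≠ δ + k)
    (hb : σb < σ) (hσq : σ ≤ q) (hcq : c ≤ q) (hT : AbovePoles α β T) (hρ : 0 < ρ)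
    (hσ : (2 * σ - δ) * ∑ i, α i - 1 / 2 < ρ) (hc : (2 * c - δ) * ∑ i, α i < ρ)
    (h : RieszIdentity a b lam mu δ Q ω α β χ z₀ R q c T (ρ + 1)) :
    RieszIdentity a b lam mu δ Q ω α β χ z₀ R q c T ρ := fun x hx => by
  refine (hasDerivAt_rieszSum hC.lam_seq hρ x).unique ?_
  refine (hC.hasDerivAt_dual hcirc hq hk hb hσq hcq hT hσ hc hx).congr_of_eventuallyEq ?_
  filter_upwards [Ioi_mem_nhds hx] with y hy
  exact h y hy

/-- Start at ρ + m with m large and differentiate m times. The conditions on σ and c at ρ persist at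
all higher orders, so one contour and one exponent σ serve for the whole descent. -/
theorem InClassC.rieszIdentity_of_pos (hC : InClassC a b lam mu σa σb δ Q ω α β S χ)
    (hcirc : IsAdmissibleCircle δ Q α β S χ p z₀ R) (hqp : q < p) (hq : 0 < q) (hqa : σa < q)
    (hqb : σb < q) (hA : δ - q < z₀.re - R) (hB : z₀.re + R < q) (hk : ∀ k : ℕ, q ≠ δ + k)
    (hb : σb < σ) (hσq : σ ≤ q) (hcq : c ≤ q) (hT : AbovePoles α β T) (hρ : 0 < ρ)
    (hσ : (2 * σ - δ) * ∑ i, α i - 1 / 2 < ρ) (hc : (2 * c - δ) * ∑ i, α i < ρ) :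
    RieszIdentity a b lam mu δ Q ω α β χ z₀ R q c T ρ := by
  have hdesc : ∀ m : ℕ, ∀ ρ : ℝ, 0 < ρ → (2 * σ - δ) * ∑ i, α i - 1 / 2 < ρ →
      (2 * c - δ) * ∑ i, α i < ρ → RieszIdentity a b lam mu δ Q ω α β χ z₀ R q c T (ρ + m) →
      RieszIdentity a b lam mu δ Q ω α β χ z₀ R q c T ρ := by
    intro m
    induction m with
    | zero => intro ρ _ _ _ h; simpa using h
    | succ m ih =>
      intro ρ h1 h2 h3 h
      refine hC.rieszIdentity_of_add_one hcirc hq hk hb hσq hcq hT h1 h2 h3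
        (ih (ρ + 1) (by linarith) (by linarith) (by linarith) ?_)
      convert h using 1
      push_cast
      ring
  obtain ⟨ρ₀, hlarge⟩ := hC.exists_rieszSum_eq_of_large hcirc hqp hq hqa hqb hA hB hk
  -- The second bound makes the straight line Re s = q itself an admissible contour at order ρ + m,
  -- so its integrals agree with those over the contour bent to c.
  obtain ⟨m, hm⟩ := exists_nat_ge (max ρ₀ ((2 * q - δ) * ∑ i, α i))
  refine hdesc m ρ hρ hσ hc fun x hx => ?_
  have hm1 := (le_max_left _ _).trans hm
  have hm2 := (le_max_right _ _).trans hm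
  rw [hlarge (ρ + m) (by linarith) T x hx]
  congr 1
  have e : ∀ n, bentIntegral (integrand δ α β (ρ + m) (mu n * x / Q ^ 2)) q q T =
      bentIntegral (integrand δ α β (ρ + m) (mu n / Q ^ 2 * x)) q c T := fun n => by
    rw [mul_div_right_comm]
    have hy : 0 < mu n / Q ^ 2 * x := mul_pos (div_pos (hC.mu_seq.1 n) (pow_pos hC.Q_pos 2)) hx
    have hm0 : (0 : ℝ) ≤ m := m.cast_nonneg
    exact bentIntegral_indep hC.α_pos hC.sum_pos hy (fun T =>
      (continuous_integrand_line hC.α_pos hC.β_re _ hq hk hy).intervalIntegrable _ _)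
      (by linarith) (by linarith) hT hT
  simp only [e]
  rw [tsum_mul_mul_left]
  ring

/-- If all coefficients vanished, the series would converge for every exponent, and the set of
exponents would have no lower bound. -/
theorem HasAbscissa.exists_ne_zero (h : HasAbscissa a lam σa) : ∃ n, a n ≠ 0 := by
  by_contra! hcon
  have := h.1 (show σa - 1 ∈ {x : ℝ | Summable fun n => ‖a n‖ * lam n ^ (-x)} by
    simp [hcon, summable_zero])
  linarith

/-- Since the dual side is too smooth for orders `ρ ≤ 0`, these do not occur. -/
theorem InClassC.order_pos (hC : InClassC a b lam mu σa σb δ Q ω α β S χ)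
    (hcirc : IsAdmissibleCircle δ Q α β S χ p z₀ R) (hqp : q < p) (hq : 0 < q) (hqa : σa < q)
    (hqb : σb < q) (hA : δ - q < z₀.re - R) (hB : z₀.re + R < q) (hk : ∀ k : ℕ, q ≠ δ + k)
    (hb : σb < σ) (hσq : σ ≤ q) (hcq : c ≤ q) (hT : AbovePoles α β T)
    (hσ : (2 * σ - δ) * ∑ i, α i - 1 / 2 < ρ) (hc : (2 * c - δ) * ∑ i, α i < ρ) : 0 < ρ := by
  by_contra! hρ
  obtain ⟨k, hak⟩ := hC.abscissa_a.exists_ne_zero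
  refine hak (eq_zero_of_differentiableAt_rieszSum_one hC.lam_seq (fun x hx => ?_) k)
  -- If ρ ≤ 0, the conditions also hold at orders 0 and 1. The identity then holds at order 1, and
  -- its dual side is differentiable because the formal derivative of order 0 still converges
  -- locally uniformly.
  have h := hC.rieszIdentity_of_pos hcirc hqp hq hqa hqb hA hB hk hb hσq hcq hT one_pos
    (by linarith) (by linarith)
  have hd := hC.hasDerivAt_dual hcirc hq hk hb hσq hcq hT (ρ := 0) (by linarith) (by linarith) hx
  rw [zero_add] at hd
  refine (hd.congr_of_eventuallyEq ?_).differentiableAt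
  filter_upwards [Ioi_mem_nhds hx] with y hy
  exact h y hy

end

/-- The largest element of δ + ℤ below p serves as q₀. To its right, and left of p, Γ(δ - s) has no
pole. -/
theorem exists_lt_forall_natCast_add_notMem (δ p : ℝ) :
    ∃ q₀ < p, ∀ q, q₀ < q → ∀ k : ℕ, ¬ (q ≤ δ + k ∧ δ + k < p) := by
  refine ⟨δ + (⌈p - δ⌉ - 1 : ℤ), ?_, fun q hq k hk => ?_⟩
  · have := Int.ceil_lt_add_one (p - δ)
    push_cast
    linarith
  · have h1 : (k : ℤ) < ⌈p - δ⌉ := Int.lt_ceil.2 (by push_cast; linarith [hk.2])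
    have h2 : ((k : ℤ) : ℝ) ≤ ((⌈p - δ⌉ - 1 : ℤ) : ℝ) := by exact_mod_cast Int.le_sub_one_of_lt h1
    rw [Int.cast_natCast] at h2
    linarith [hk.1]

theorem sphere_subset_strip {δ p R : ℝ} {z₀ : ℂ} (hR : 0 < R)
    (h : Metric.sphere z₀ R ⊆ strip δ p) : δ - p < z₀.re - R ∧ z₀.re + R < p := by
  have h1 := h (show z₀ + R ∈ Metric.sphere z₀ R by simp [abs_of_pos hR])
  have h2 := h (show z₀ - R ∈ Metric.sphere z₀ R by simp [abs_of_pos hR])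
  exact ⟨by simpa using h2.1, by simpa using h1.2⟩

end RieszSum

/-! ### The theorem -/

theorem theorem1p3 {r : ℕ} (a b : ℕ → ℂ) (lam mu : ℕ → ℝ) (σa σb δ Q : ℝ) (ω : ℂ)
    (α : Fin r → ℝ) (β : Fin r → ℂ) (S : Set ℂ) (χ : ℂ → ℂ)
    (hC : RieszSum.InClassC a b lam mu σa σb δ Q ω α β S χ)
    (p : ℝ) (hp : 0 < p) (hpa : σa < p) (hpb : σb < p) (hS : S ⊆ RieszSum.strip δ p)
    (z₀ : ℂ) (R : ℝ) (hcirc : RieszSum.IsAdmissibleCircle δ Q α β S χ p z₀ R)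
    (ρ : ℝ) (hρ : (2 * σb - δ) * ∑ i, α i - 1 / 2 < ρ)
    (hline : ¬ RieszSum.IsSingularity (RieszSum.gammaQuotient δ α β ρ) (p : ℂ)) :
    RieszSum.IsResidualFunction (RieszSum.residualTerm Q α β χ z₀ R ρ) ∧
    ∀ x : ℝ, 0 < x → ∃ J : ℕ → ℂ,
      (∀ n, RieszSum.HasBarnesIntegral δ α β ρ p (mu n * x / Q ^ 2) (J n)) ∧
      ((2 * p - δ) * ∑ i, α i - 1 ≤ ρ →
        ∀ n, RieszSum.HasLineIntegral
          (RieszSum.integrand δ α β ρ (mu n * x / Q ^ 2)) p (J n)) ∧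
      Summable (fun n => starRingEnd ℂ (b n) * J n) ∧
      RieszSum.rieszSum a lam ρ x =
        RieszSum.residualTerm Q α β χ z₀ R ρ x +
          ω * (x : ℂ) ^ ((δ : ℂ) + ρ) / (Q : ℂ) ^ (δ : ℂ) *
            ∑' n, starRingEnd ℂ (b n) * J n := by
  have hd := hC.sum_pos
  have hR := hcirc.radius_pos
  obtain ⟨hA, hB⟩ := RieszSum.sphere_subset_strip hR hcirc.subset_strip
  obtain ⟨q₀, hq₀, hqk⟩ := RieszSum.exists_lt_forall_natCast_add_notMem δ p
  -- Choose q below p but so close to it that the circle still lies between Re s = δ - q and Re s =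
  -- q, both Dirichlet series converge absolutely at q, and no pole has real part in [q, p).
  obtain ⟨q, hq, hqp⟩ := exists_between (show max q₀ (max (max 0 (max σa σb))
    (max (z₀.re + R) (δ - (z₀.re - R)))) < p from max_lt hq₀ (max_lt (max_lt hp (max_lt hpa hpb))
      (max_lt hB (by linarith))))
  simp only [max_lt_iff] at hq
  obtain ⟨hqq, ⟨hq0, hqa, hqb⟩, hqB, hqA⟩ := hq
  have hA' : δ - q < z₀.re - R := by linarith
  have hk := hqk q hqq
  have hk' : ∀ k : ℕ, q ≠ δ + k := fun k h => hk k ⟨h.le, h ▸ hqp⟩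
  -- The strict inequality assumed for ρ leaves room for an exponent σ > σ_b that still satisfies
  -- (2σ-δ)d - 1/2 < ρ.
  obtain ⟨σ, hσb, hσ⟩ := exists_between (show σb < min q (((ρ + 1 / 2) / ∑ i, α i + δ) / 2) from
    lt_min hqb (by
      have : 2 * σb - δ < (ρ + 1 / 2) / ∑ i, α i := (lt_div_iff₀ hd).2 (by linarith)
      linarith))
  have hσq := (hσ.trans_le (min_le_left _ _)).le
  have hσρ : (2 * σ - δ) * ∑ i, α i - 1 / 2 < ρ := by
    have : 2 * σ - δ < (ρ + 1 / 2) / ∑ i, α i := by linarith [hσ.trans_le (min_le_right _ _)]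
    linarith [(lt_div_iff₀ hd).1 this]
  -- Taking ρ - 1 in place of ρ makes the inequality strict.
  obtain ⟨c, hcq, hc⟩ : ∃ c ≤ q, (2 * c - δ) * ∑ i, α i < ρ := by
    refine ⟨min q (((ρ - 1) / ∑ i, α i + δ) / 2), min_le_left _ _, ?_⟩
    have h1 := min_le_right q (((ρ - 1) / ∑ i, α i + δ) / 2)
    have : 2 * min q (((ρ - 1) / ∑ i, α i + δ) / 2) - δ ≤ (ρ - 1) / ∑ i, α i := by linarith
    linarith [(le_div_iff₀ hd).1 this]
  obtain ⟨T, hT⟩ := RieszSum.exists_abovePoles α β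
  have hρ0 := hC.order_pos hcirc hqp hq0 hqa hqb hA' hqB hk' hσb hσq hcq hT hσρ hc
  have hid := hC.rieszIdentity_of_pos hcirc hqp hq0 hqa hqb hA' hqB hk' hσb hσq hcq hT hρ0 hσρ hc
  refine ⟨hC.isResidualFunction_residualTerm hcirc ρ, fun x hx => ?_⟩
  have hy : ∀ n, 0 < mu n * x / Q ^ 2 := fun n =>
    div_pos (mul_pos (hC.mu_seq.1 n) hx) (pow_pos hC.Q_pos 2)
  have hx' : (x : ℂ) ^ ((δ : ℂ) + ρ) ≠ 0 := by simp [Complex.cpow_eq_zero_iff, hx.ne']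
  refine ⟨fun n => RieszSum.bentIntegral (RieszSum.integrand δ α β ρ (mu n * x / Q ^ 2)) q c T,
    fun n => ?_, fun hpρ n => ?_, ?_, ?_⟩
  · exact RieszSum.hasBarnesIntegral_bentIntegral hC.α_pos hd hC.β_re hq0 hqp hk hline (hy n) hc hT
  · beta_reduce
    -- The integrals used in the identity have their middle part on Re s = q; they are moved back to
    -- the prescribed line Re s = p before the contour is straightened.
    rw [← RieszSum.bentIntegral_right_eq hC.α_pos hC.β_re hq0 hqp hk hline (hy n) hT]
    exact RieszSum.hasLineIntegral_bentIntegral hC.α_pos hd (hy n)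
      (RieszSum.intervalIntegrable_integrand_of_removable hC.α_pos hC.β_re hq0 hqp hk hline (hy n))
      hc hT hpρ
  · have hsum := RieszSum.summable_mul_bentIntegral hC.α_pos hd hC.β_re hC.Q_pos hq0 hk' hσρ hσq hc
      hT hC.mu_seq (hC.abscissa_b.summable hC.mu_seq hσb) hx
    refine (hsum.mul_left ((x : ℂ) ^ ((δ : ℂ) + ρ))⁻¹).congr fun n => ?_
    rw [mul_left_comm (starRingEnd ℂ (b n)), inv_mul_cancel_left₀ hx', ← mul_div_right_comm]
  · rw [hid x hx, RieszSum.tsum_mul_mul_left]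
    simp only [← mul_div_right_comm]
    ring
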